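/- Let $\Sigma=\mathbb{H}/\Gamma$ be a closed oriented hyperbolic surface, where $\Gamma<\mathrm{PSL}(2,\mathbb{R})$ is discrete and acts freely and cocompactly on $\mathbb{H}$. Let $\mathcal{T}(\Sigma)$ be its Teichmüller space: the connected component of the inclusion in the space of discrete, faithful, cocompact representations $\rho:\Gamma\to\mathrm{PSL}(2,\mathbb{R})$ (topology of pointwise convergence), up to conjugation. Let $\alpha\neq\beta$ be closed geodesics of $\Sigma$ that meet at a point $z$, and choose lifts of $\alpha$ and $\beta$ to $\mathbb{H}$ through a common lift of $z$; they are the axes of hyperbolic elements $a,b\in\Gamma$ determined by $\alpha$ and $\beta$. For $\rho\in\mathcal{T}(\Sigma)$ whose axes $\mathrm{ax}(\rho(a))$ and $\mathrm{ax}(\rho(b))$ cross, let $\alpha\angle_z\beta\,(\rho)\in\,]0,\pi[$ be the angle, measured in the counter-clockwise direction, from the line $\mathrm{ax}(\rho(a))$ to the line $\mathrm{ax}(\rho(b))$ at their crossing point. Suppose that $\alpha$ is simple, and let $\rho_0\in\mathcal{T}(\Sigma)$. For $t\in\mathbb{R}$ let $\rho_t$ be obtained from $\rho_0$ by the time $t$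 (left) Fenchel–Nielsen twist along $\alpha$, that is, by cutting $\mathbb{H}/\rho_0(\Gamma)$ along the geodesic $\alpha$ and regluing after a left twist of distance $t$. Then $\rho_t$ exists and lies in $\mathcal{T}(\Sigma)$ for every $t\in\mathbb{R}$, the angle $\alpha\angle_z\beta\,(\rho_t)\in\,]0,\pi[$ is defined for every $t\in\mathbb{R}$, and 1. for every $\theta\in\,]0,\pi[$ there is $t\in\mathbb{R}$ with $\alpha\angle_z\beta\,(\rho_t)=\theta$; 2. the limits of $\alpha\angle_z\beta\,(\rho_t)$ as $t\to+\infty$ and as $t\to-\infty$ both exist and belong to $\{0,\pi\}$. -/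

import Mathlib

open Filter Topology
open scoped UpperHalfPlane

noncomputable section

namespace FenchelNielsen

/-- The group `PSL(2, ℝ)` of orientation preserving isometries of the hyperbolic plane `ℍ`, with
the quotient topology. -/
abbrev PSL2R : Type := Matrix.ProjectiveSpecialLinearGroup (Fin 2) ℝ

/-- `SL(2, ℝ)` acting on `ℍ` by Möbius transformations. -/
def slPermHom : Matrix.SpecialLinearGroup (Fin 2) ℝ →* Equiv.Perm ℍ :=
  MulAction.toPermHom (Matrix.SpecialLinearGroup (Fin 2) ℝ) ℍ

theorem center_le_ker_slPermHom :
    Subgroup.center (Matrix.SpecialLinearGroup (Fin 2) ℝ) ≤ slPermHom.ker := by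
  intro A hA
  obtain ⟨r, hr, hA⟩ := Matrix.SpecialLinearGroup.mem_center_iff.mp hA
  have hr0 : (r : ℂ) ≠ 0 := by
    rintro h
    have : r = 0 := by exact_mod_cast h
    simp [this] at hr
  rw [MonoidHom.mem_ker]
  ext z
  change ((A • z : ℍ) : ℂ) = (z : ℂ)
  have h00 : A 0 0 = r := by rw [← hA]; simp
  have h01 : A 0 1 = 0 := by rw [← hA]; simp
  have h10 : A 1 0 = 0 := by rw [← hA]; simp
  have h11 : A 1 1 = r := by rw [← hA]; simp
  rw [UpperHalfPlane.coe_specialLinearGroup_apply]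
  simp [h00, h01, h10, h11, hr0]

/-- `PSL(2, ℝ)` acting on `ℍ` by Möbius transformations. -/
def pslPermHom : PSL2R →* Equiv.Perm ℍ :=
  QuotientGroup.lift _ slPermHom center_le_ker_slPermHom

instance : MulAction PSL2R ℍ where
  smul g z := pslPermHom g z
  one_smul z := by change pslPermHom 1 z = z; simp
  mul_smul g h z := by
    change pslPermHom (g * h) z = pslPermHom g (pslPermHom h z)
    simp

theorem mk_smul (A : Matrix.SpecialLinearGroup (Fin 2) ℝ) (z : ℍ) :
    ((A : PSL2R) • z) = A • z := rfl

/-! ### Geodesics, translations and axes -/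

/-- The point `i e ^ s`; the map `s ↦ i e ^ s` is the upward oriented imaginary axis,
parametrised by arc length. -/
def imagAxis (s : ℝ) : ℍ := ⟨Complex.I * (Real.exp s : ℂ), by
  rw [Complex.I_mul_im, Complex.ofReal_re]; exact Real.exp_pos s⟩

/-- The oriented complete geodesic which is the image under `h` of the upward oriented imaginary
axis, parametrised by arc length. Every oriented complete geodesic of `ℍ` is of this form. -/
def geodesic (h : PSL2R) (s : ℝ) : ℍ := h • imagAxis s

/-- The diagonal matrix with entries `e ^ (ℓ / 2)`, `e ^ (- ℓ / 2)`. -/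
def diagMatrix (ℓ : ℝ) : Matrix.SpecialLinearGroup (Fin 2) ℝ :=
  ⟨!![Real.exp (ℓ / 2), 0; 0, Real.exp (-(ℓ / 2))], by
    rw [Matrix.det_fin_two_of, ← Real.exp_add]; simp⟩

/-- The hyperbolic translation by the signed length `ℓ` along the oriented geodesic
`geodesic h`. -/
def translation (h : PSL2R) (ℓ : ℝ) : PSL2R := h * (diagMatrix ℓ : PSL2R) * h⁻¹

/-- `geodesic h` is, with one of its two orientations, the axis of the hyperbolic element `a`. -/
def IsAxis (a h : PSL2R) : Prop := ∃ ℓ : ℝ, ℓ ≠ 0 ∧ a = translation h ℓ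

/-- The axis of a hyperbolic element, as a subset of `ℍ` (empty if `a` is not hyperbolic). -/
def axis (a : PSL2R) : Set ℍ := {z | ∃ h : PSL2R, IsAxis a h ∧ z ∈ Set.range (geodesic h)}

/-- The open half plane to the left of the oriented geodesic `geodesic h`. -/
def leftSide (h : PSL2R) : Set ℍ := {z | (h⁻¹ • z).re < 0}

/-- The open half plane to the right of the oriented geodesic `geodesic h`. -/
def rightSide (h : PSL2R) : Set ℍ := {z | 0 < (h⁻¹ • z).re}

/-! ### Closed surfaces and Teichmüller space -/

/-- The quotient `ℍ / Γ`. -/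
abbrev Surface (Γ : Subgroup PSL2R) : Type := MulAction.orbitRel.Quotient Γ ℍ

/-- The covering projection `ℍ → ℍ / Γ`. -/
def proj (Γ : Subgroup PSL2R) (z : ℍ) : Surface Γ := Quotient.mk _ z

/-- `Γ` is a discrete group acting freely and cocompactly on `ℍ`, so that `ℍ / Γ` is a closed
oriented hyperbolic surface with fundamental group `Γ`. -/
structure IsClosedSurfaceGroup (Γ : Subgroup PSL2R) : Prop where
  discrete : DiscreteTopology Γ
  free : ∀ g ∈ Γ, ∀ z : ℍ, g • z = z → g = 1
  cocompact : CompactSpace (Surface Γ)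

/-- The closed geodesic of `ℍ / Γ` determined by `a`, i.e. the image of the axis of `a`. -/
def closedGeodesic (Γ : Subgroup PSL2R) (a : Γ) : Set (Surface Γ) := proj Γ '' axis (a : PSL2R)

/-- The closed geodesic of `ℍ / Γ` determined by the hyperbolic element `a`, traversed once as
a closed curve whose length is the translation length `ℓ` of `a`, is simple: the induced map
from the circle `ℝ / ℓ ℤ` to `ℍ / Γ` is injective. -/
def IsSimpleClosedGeodesic (Γ : Subgroup PSL2R) (a : Γ) : Prop :=
  ∃ (h : PSL2R) (ℓ : ℝ), 0 < ℓ ∧ (a : PSL2R) = translation h ℓ ∧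
    ∀ s t : ℝ, proj Γ (geodesic h s) = proj Γ (geodesic h t) → ∃ n : ℤ, t - s = n * ℓ

/-- The maps `Γ → PSL(2, ℝ)` that are isomorphisms of `Γ` onto a closed surface group, i.e. the
(discrete, faithful) holonomies of marked closed hyperbolic surfaces. -/
def fuchsianMaps (Γ : Subgroup PSL2R) : Set (Γ → PSL2R) :=
  {f | ∃ ρ : Γ →* PSL2R, ⇑ρ = f ∧ Function.Injective ρ ∧ IsClosedSurfaceGroup ρ.range}

/-- The representations of `Γ` that represent the points of the Teichmüller space of the surface
`ℍ / Γ`: the connected component of the inclusion of `Γ` in the space of discrete faithful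
cocompact representations, with the topology of pointwise convergence. The Teichmüller space
itself is the set of conjugacy classes of these representations. -/
def teichmuller (Γ : Subgroup PSL2R) : Set (Γ →* PSL2R) :=
  {ρ | ⇑ρ ∈ connectedComponentIn (fuchsianMaps Γ) (fun g : Γ => (g : PSL2R))}

/-! ### The Fenchel-Nielsen twist -/

section Twist

variable {Γ : Subgroup PSL2R}

/-- `geodesic h` is, with one of its two orientations, a lift to `ℍ` of the closed geodesic `α`
determined by `a` on the surface `ℍ / ρ(Γ)`. -/
def IsLift (ρ : Γ →* PSL2R) (a : Γ) (h : PSL2R) : Prop :=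
  ∃ g : Γ, IsAxis (ρ (g * a * g⁻¹)) h

/-- The complement in `ℍ` of the union of all lifts of `α`. -/
def offLifts (ρ : Γ →* PSL2R) (a : Γ) : Set ℍ :=
  {x | ∀ h, IsLift ρ a h → x ∉ Set.range (geodesic h)}

/-- The representation `ρ'` is the holonomy of a surface obtained from `ℍ / ρ(Γ)` by cutting it
along `α` and gluing it back after a left twist of distance `t`.

The lift to `ℍ` of the twist is the map `x ↦ E x • x`, defined off the lifts of `α`. It is
* an isometry on every complementary region of the lifts of `α` (two points off the lifts are in
  the same region iff no lift separates them);
* when two regions are adjacent along a lift, then, as seen from the region on the left of this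
  oriented lift, the region on its right is translated forward by `t` along the lift, i.e. to the
  left for an observer who faces the lift (reversing the orientation of the lift gives the same
  condition);
* equivariant with respect to `ρ` and `ρ'`. -/
def IsLeftTwist (ρ : Γ →* PSL2R) (a : Γ) (t : ℝ) (ρ' : Γ →* PSL2R) : Prop :=
  ∃ E : ℍ → PSL2R,
    (∀ x ∈ offLifts ρ a, ∀ y ∈ offLifts ρ a,
      (∀ h, IsLift ρ a h → ¬ (x ∈ leftSide h ∧ y ∈ rightSide h)) → E x = E y) ∧
    (∀ x ∈ offLifts ρ a, ∀ y ∈ offLifts ρ a, ∀ h, IsLift ρ a h →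
      x ∈ leftSide h → y ∈ rightSide h →
      (∀ k, IsLift ρ a k → x ∈ leftSide k → y ∈ rightSide k →
        Set.range (geodesic k) = Set.range (geodesic h)) →
      E y = E x * translation h t) ∧
    (∀ g : Γ, ∀ x ∈ offLifts ρ a, E (ρ g • x) * ρ g = ρ' g * E x)

end Twist

/-! ### Angles -/

/-- The velocity vector at time `s` of the oriented geodesic `geodesic h`, in the conformal
coordinate of `ℍ ⊆ ℂ`. -/
def velocity (h : PSL2R) (s : ℝ) : ℂ := deriv (fun u : ℝ => (geodesic h u : ℂ)) s

/-- The axes of `a` and `b` cross, and `θ ∈ ]0, π[` is the angle measured in the counter-clockwise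
direction from the axis of `a` to the axis of `b` at the crossing point (both axes being
unoriented lines). -/
def HasAngle (a b : PSL2R) (θ : ℝ) : Prop :=
  θ ∈ Set.Ioo 0 Real.pi ∧ ∃ (h k : PSL2R) (s u : ℝ), IsAxis a h ∧ IsAxis b k ∧
    geodesic h s = geodesic k u ∧
    velocity k u = Complex.exp (θ * Complex.I) * velocity h s

end FenchelNielsen

end

/-! Normalise so that the axis of `ρ₀ a` is the imaginary axis and take a base point `x` next to it.
The twist then fixes `ρ₀ a`, while `ρ₀ b` becomes diag(e^{t/2}, e^{-t/2}) · N_t. The diagonal factor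
is the shear along the axis of `ρ₀ a`, the first lift of α met on the way from `x` to `ρ₀ b • x`,
and N_t collects the shears along the remaining lifts followed by `ρ₀ b`. A matrix with positive
rows (p, q), (r, s) translates along an axis that meets the imaginary axis at an angle of cotangent
(s - p) / (2√(qr)). For the twist this is (e^{-t/2} s_t - e^{t/2} p_t) / (2√(q_t r_t)), with entries
taken from N_t. If p_t and s_t stay between positive constant multiples of √(q_t r_t), the cotangent
tends to -∞ as t → +∞ and to +∞ as t → -∞. The angle therefore tends to π and to 0, and by
continuity it takes every value in between.

The uniform bounds (`exists_isBalanced`) come from nesting. The half planes bounded by the lifts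
along the path decrease, and each shear preserves its own half plane, so N_t = K P_t = Q_t L. Here
P_t and Q_t are nonnegative, since inclusion of half planes is nonnegativity of a matrix. The
factors K and L are independent of t and strictly positive, since distinct lifts are at positive
distance and share no end point.

Crossing of axes is detected algebraically: given a hyperbolic element, its axis crosses that of a
second element exactly when the trace of the commutator is less than 2. In a closed surface group
every nontrivial element is hyperbolic, so the trace equals 2 only for commuting elements. Hence
crossing is constant on the connected component that defines Teichmüller space
(`commTrace_lt_two_iff`). This shows that the lifts of α stay disjoint (`lifts_disjoint`) and that
the axes of `a` and `b` cross for every `ρ`.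

The twist itself is built from the nested family of half planes. The ordered product of the shears
between two points is a cocycle (`cocycle_mul`), equivariant under `ρ`, and `g ↦ c(x, ρ g • x) * ρ
g` is the new holonomy (`twist`). Any developing map with the prescribed jumps equals this cocycle
up to a left factor, so every left twist is conjugate to `twist` (`eq_conj_twist`). Discreteness and
cocompactness follow by comparing distances before and after shearing
(`dist_le_dist_transitionProd`, `dist_transitionProd_le`, `exists_region`). Continuity in t,
starting from `ρ` at t = 0, keeps the twist in the component. -/

noncomputable section

namespace FenchelNielsen

/-! ### The group `PSL(2, ℝ)` and its action -/

/-- The group `SL(2, ℝ)`. -/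
abbrev SL2R : Type := Matrix.SpecialLinearGroup (Fin 2) ℝ

theorem SL2R.det_eq (A : SL2R) : A 0 0 * A 1 1 - A 0 1 * A 1 0 = 1 := by
  have := A.det_coe
  rwa [Matrix.det_fin_two] at this

/-- The element of `SL(2, ℝ)` with given entries. -/
def mkSL (a b c d : ℝ) (h : a * d - b * c = 1) : SL2R :=
  ⟨!![a, b; c, d], by rw [Matrix.det_fin_two_of, h]⟩

@[simp] theorem mkSL_00 (a b c d : ℝ) (h) : mkSL a b c d h 0 0 = a := rfl
@[simp] theorem mkSL_01 (a b c d : ℝ) (h) : mkSL a b c d h 0 1 = b := rfl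
@[simp] theorem mkSL_10 (a b c d : ℝ) (h) : mkSL a b c d h 1 0 = c := rfl
@[simp] theorem mkSL_11 (a b c d : ℝ) (h) : mkSL a b c d h 1 1 = d := rfl

theorem SL2R.ext' {A B : SL2R} (h00 : A 0 0 = B 0 0) (h01 : A 0 1 = B 0 1) (h10 : A 1 0 = B 1 0)
    (h11 : A 1 1 = B 1 1) : A = B := by
  ext i j
  fin_cases i <;> fin_cases j <;> assumption

theorem SL2R.mul_00 (A B : SL2R) : (A * B) 0 0 = A 0 0 * B 0 0 + A 0 1 * B 1 0 := by
  simp [Matrix.mul_apply, Fin.sum_univ_two]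

theorem SL2R.mul_01 (A B : SL2R) : (A * B) 0 1 = A 0 0 * B 0 1 + A 0 1 * B 1 1 := by
  simp [Matrix.mul_apply, Fin.sum_univ_two]

theorem SL2R.mul_10 (A B : SL2R) : (A * B) 1 0 = A 1 0 * B 0 0 + A 1 1 * B 1 0 := by
  simp [Matrix.mul_apply, Fin.sum_univ_two]

theorem SL2R.mul_11 (A B : SL2R) : (A * B) 1 1 = A 1 0 * B 0 1 + A 1 1 * B 1 1 := by
  simp [Matrix.mul_apply, Fin.sum_univ_two]

theorem SL2R.inv_00 (A : SL2R) : A⁻¹ 0 0 = A 1 1 := by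
  simp [Matrix.SpecialLinearGroup.coe_inv, Matrix.adjugate_fin_two]

theorem SL2R.inv_01 (A : SL2R) : A⁻¹ 0 1 = - A 0 1 := by
  simp [Matrix.SpecialLinearGroup.coe_inv, Matrix.adjugate_fin_two]

theorem SL2R.inv_10 (A : SL2R) : A⁻¹ 1 0 = - A 1 0 := by
  simp [Matrix.SpecialLinearGroup.coe_inv, Matrix.adjugate_fin_two]

theorem SL2R.inv_11 (A : SL2R) : A⁻¹ 1 1 = A 0 0 := by
  simp [Matrix.SpecialLinearGroup.coe_inv, Matrix.adjugate_fin_two]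

theorem SL2R.one_00 : (1 : SL2R) 0 0 = 1 := by simp
theorem SL2R.one_01 : (1 : SL2R) 0 1 = 0 := by simp
theorem SL2R.one_10 : (1 : SL2R) 1 0 = 0 := by simp
theorem SL2R.one_11 : (1 : SL2R) 1 1 = 1 := by simp

theorem SL2R.mem_center_iff {A : SL2R} : A ∈ Subgroup.center SL2R ↔ A = 1 ∨ A = -1 := by
  rw [Matrix.SpecialLinearGroup.mem_center_iff]
  constructor
  · rintro ⟨r, hr, h⟩
    have hr' : r ^ 2 = 1 := by simpa using hr
    have h00 : A 0 0 = r := by rw [← h]; simp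
    have h01 : A 0 1 = 0 := by rw [← h]; simp
    have h10 : A 1 0 = 0 := by rw [← h]; simp
    have h11 : A 1 1 = r := by rw [← h]; simp
    rcases (show r = 1 ∨ r = -1 from mul_self_eq_one_iff.mp (by rwa [← sq])) with h1 | h1
    · left
      apply SL2R.ext' <;> simp [*]
    · right
      apply SL2R.ext' <;> simp [*]
  · rintro (rfl | rfl)
    · exact ⟨1, by simp, by simp⟩
    · refine ⟨-1, by simp, ?_⟩
      ext i j
      fin_cases i <;> fin_cases j <;> simp

theorem mk_eq_mk_iff {A B : SL2R} : (A : PSL2R) = (B : PSL2R) ↔ B = A ∨ B = -A := by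
  rw [QuotientGroup.eq, SL2R.mem_center_iff, inv_mul_eq_iff_eq_mul, inv_mul_eq_iff_eq_mul]
  simp

theorem exists_mk (g : PSL2R) : ∃ A : SL2R, (A : PSL2R) = g := QuotientGroup.mk_surjective g

theorem mk_neg (A : SL2R) : ((-A : SL2R) : PSL2R) = (A : PSL2R) := by
  rw [mk_eq_mk_iff]; simp

theorem mk_mul (A B : SL2R) : ((A * B : SL2R) : PSL2R) = (A : PSL2R) * (B : PSL2R) := rfl
theorem mk_inv (A : SL2R) : ((A⁻¹ : SL2R) : PSL2R) = (A : PSL2R)⁻¹ := rfl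
theorem mk_one : ((1 : SL2R) : PSL2R) = 1 := rfl

/-! ### Topology of PSL(2, ℝ) and its isometric action -/

instance : ContinuousSMul PSL2R ℍ where
  continuous_smul := by
    have h : IsOpenQuotientMap (Prod.map (QuotientGroup.mk : SL2R → PSL2R) (id : ℍ → ℍ)) :=
      QuotientGroup.isOpenQuotientMap_mk.prodMap IsOpenQuotientMap.id
    rw [← h.continuous_comp_iff]
    exact (continuous_smul : Continuous fun p : SL2R × ℍ => p.1 • p.2)

instance : IsIsometricSMul PSL2R ℍ where
  isometry_smul g := by
    obtain ⟨A, rfl⟩ := exists_mk g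
    exact isometry_smul ℍ A

theorem isClosed_center : IsClosed (Subgroup.center SL2R : Set SL2R) := by
  have : (Subgroup.center SL2R : Set SL2R) = {1, -1} := by
    ext A; exact SL2R.mem_center_iff
  rw [this]
  exact (Set.toFinite _).isClosed

instance : T2Space PSL2R := by
  have : IsClosed (Subgroup.center SL2R : Set SL2R) := isClosed_center
  infer_instance

theorem continuous_mk : Continuous (QuotientGroup.mk : SL2R → PSL2R) :=
  QuotientGroup.isOpenQuotientMap_mk.continuous

theorem coe_mk_smul (A : SL2R) (z : ℍ) :
    (((A : PSL2R) • z : ℍ) : ℂ) = (A 0 0 * z + A 0 1) / (A 1 0 * z + A 1 1) := by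
  rw [mk_smul, UpperHalfPlane.coe_specialLinearGroup_apply]; simp

theorem denom_ne_zero (A : SL2R) (z : ℍ) : (A 1 0 * z + A 1 1 : ℂ) ≠ 0 := by
  have := UpperHalfPlane.linear_ne_zero (cd := ![A 1 0, A 1 1]) z (by
    intro h
    have h0 := congrFun h 0
    have h1 := congrFun h 1
    simp at h0 h1
    have := A.det_eq
    simp [h0, h1] at this)
  simpa using this

theorem normSq_denom_pos (A : SL2R) (z : ℍ) : 0 < Complex.normSq (A 1 0 * z + A 1 1) :=
  Complex.normSq_pos.mpr (denom_ne_zero A z)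

/-- The denominator is positive, so the side of the imaginary axis on which the image lies is
decided by the numerator P|z|² + S·re z + Q, where S² = 1 + 4PQ. All the half plane lemmas work with
this form. -/
theorem re_mk_smul (A : SL2R) (z : ℍ) :
    ((A : PSL2R) • z : ℍ).re = (A 0 0 * A 1 0 * Complex.normSq z +
      (A 0 0 * A 1 1 + A 0 1 * A 1 0) * z.re + A 0 1 * A 1 1) /
        Complex.normSq (A 1 0 * z + A 1 1) := by
  rw [← UpperHalfPlane.coe_re, coe_mk_smul, Complex.div_re, ← add_div]
  congr 1
  simp [Complex.normSq_apply]
  ring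

theorem im_mk_smul (A : SL2R) (z : ℍ) :
    ((A : PSL2R) • z : ℍ).im = z.im / Complex.normSq (A 1 0 * z + A 1 1) := by
  rw [← UpperHalfPlane.coe_im, coe_mk_smul, Complex.div_im, ← sub_div]
  congr 1
  have := A.det_eq
  simp
  linear_combination (z.im) * this

/-! ### Diagonal matrices and rotations -/

@[simp] theorem diagMatrix_00 (s : ℝ) : diagMatrix s 0 0 = Real.exp (s / 2) := rfl
@[simp] theorem diagMatrix_01 (s : ℝ) : diagMatrix s 0 1 = 0 := rfl
@[simp] theorem diagMatrix_10 (s : ℝ) : diagMatrix s 1 0 = 0 := rfl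
@[simp] theorem diagMatrix_11 (s : ℝ) : diagMatrix s 1 1 = Real.exp (-(s / 2)) := rfl

theorem diagMatrix_add (s t : ℝ) : diagMatrix (s + t) = diagMatrix s * diagMatrix t := by
  apply SL2R.ext' <;> simp only [SL2R.mul_00, SL2R.mul_01, SL2R.mul_10, SL2R.mul_11,
    diagMatrix_00, diagMatrix_01, diagMatrix_10, diagMatrix_11]
  · rw [mul_zero, add_zero, ← Real.exp_add]; ring_nf
  · simp
  · simp
  · rw [mul_zero, zero_add, ← Real.exp_add]; ring_nf

@[simp] theorem diagMatrix_zero : diagMatrix 0 = 1 := by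
  apply SL2R.ext' <;> simp

theorem diagMatrix_neg (s : ℝ) : diagMatrix (-s) = (diagMatrix s)⁻¹ := by
  rw [eq_inv_iff_mul_eq_one, ← diagMatrix_add]; simp

theorem continuous_diagMatrix : Continuous diagMatrix := by
  refine Continuous.subtype_mk ?_ _
  refine continuous_matrix fun i j => ?_
  fin_cases i <;> fin_cases j <;> simp <;> fun_prop

/-- The class in `PSL(2, ℝ)` of a diagonal matrix. -/
def diagP (s : ℝ) : PSL2R := (diagMatrix s : PSL2R)

theorem diagP_add (s t : ℝ) : diagP (s + t) = diagP s * diagP t := by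
  rw [diagP, diagMatrix_add]; rfl

@[simp] theorem diagP_zero : diagP 0 = 1 := by rw [diagP, diagMatrix_zero]; rfl
theorem diagP_neg (s : ℝ) : diagP (-s) = (diagP s)⁻¹ := by rw [diagP, diagMatrix_neg]; rfl
theorem continuous_diagP : Continuous diagP := continuous_mk.comp continuous_diagMatrix
theorem diagP_comm (s t : ℝ) : diagP s * diagP t = diagP t * diagP s := by
  rw [← diagP_add, ← diagP_add, add_comm]

theorem translation_eq (h : PSL2R) (t : ℝ) : translation h t = h * diagP t * h⁻¹ := rfl

theorem imagAxis_coe (s : ℝ) : (imagAxis s : ℂ) = Complex.I * (Real.exp s : ℂ) := rfl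
@[simp] theorem imagAxis_re (s : ℝ) : (imagAxis s).re = 0 := by
  rw [← UpperHalfPlane.coe_re, imagAxis_coe]; simp

@[simp] theorem imagAxis_im (s : ℝ) : (imagAxis s).im = Real.exp s := by
  rw [← UpperHalfPlane.coe_im, imagAxis_coe, Complex.I_mul_im, Complex.ofReal_re]

theorem eq_imagAxis {z : ℍ} (hz : z.re = 0) : z = imagAxis (Real.log z.im) := by
  apply UpperHalfPlane.ext
  apply Complex.ext
  · simp [imagAxis_coe, hz]
  · simp [imagAxis_coe, Real.exp_log z.im_pos]

theorem coe_diagP_smul (s : ℝ) (z : ℍ) : ((diagP s • z : ℍ) : ℂ) = (Real.exp s : ℂ) * z := by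
  rw [diagP, coe_mk_smul]
  have : (Real.exp s : ℂ) = Real.exp (s / 2) / Real.exp (-(s / 2)) := by
    rw [← Complex.ofReal_div, ← Real.exp_sub]; ring_nf
  simp only [diagMatrix_00, diagMatrix_01, diagMatrix_10, diagMatrix_11, this]
  simp
  ring

@[simp] theorem re_diagP_smul (s : ℝ) (z : ℍ) : (diagP s • z).re = Real.exp s * z.re := by
  rw [← UpperHalfPlane.coe_re, coe_diagP_smul, Complex.re_ofReal_mul, UpperHalfPlane.coe_re]

theorem diagP_smul_imagAxis (s t : ℝ) : diagP s • imagAxis t = imagAxis (s + t) := by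
  apply UpperHalfPlane.ext
  rw [coe_diagP_smul, imagAxis_coe, imagAxis_coe, Real.exp_add]
  push_cast; ring

theorem imagAxis_eq (s : ℝ) : imagAxis s = diagP s • imagAxis 0 := by
  rw [diagP_smul_imagAxis, add_zero]

theorem geodesic_eq (h : PSL2R) (s : ℝ) : geodesic h s = (h * diagP s) • imagAxis 0 := by
  rw [geodesic, imagAxis_eq, mul_smul]

theorem geodesic_mul (g h : PSL2R) (s : ℝ) : geodesic (g * h) s = g • geodesic h s := by
  rw [geodesic, geodesic, mul_smul]

theorem geodesic_mul_diagP (h : PSL2R) (s t : ℝ) :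
    geodesic (h * diagP s) t = geodesic h (s + t) := by
  rw [geodesic_mul, geodesic, diagP_smul_imagAxis]; rfl

theorem translation_smul_geodesic (h : PSL2R) (t s : ℝ) :
    translation h t • geodesic h s = geodesic h (t + s) := by
  rw [translation_eq, geodesic, mul_smul, inv_smul_smul, mul_smul, diagP_smul_imagAxis]; rfl

theorem translation_add (h : PSL2R) (s t : ℝ) :
    translation h (s + t) = translation h s * translation h t := by
  simp only [translation_eq, diagP_add]; group

@[simp] theorem translation_zero (h : PSL2R) : translation h 0 = 1 := by
  simp [translation_eq]

theorem translation_neg (h : PSL2R) (t : ℝ) : translation h (-t) = (translation h t)⁻¹ := by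
  simp only [translation_eq, diagP_neg]; group

theorem translation_conj (g h : PSL2R) (t : ℝ) :
    translation (g * h) t = g * translation h t * g⁻¹ := by
  simp only [translation_eq]; group

theorem translation_mul_diagP (h : PSL2R) (s t : ℝ) :
    translation (h * diagP s) t = translation h t := by
  have := diagP_comm s t
  simp only [translation_eq]
  calc h * diagP s * diagP t * (h * diagP s)⁻¹ = h * (diagP s * diagP t) * (diagP s)⁻¹ * h⁻¹ := by
        group
    _ = _ := by rw [this]; group

theorem continuous_translation (h : PSL2R) : Continuous (translation h) := by
  have : Continuous fun t => h * diagP t * h⁻¹ :=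
    (continuous_const.mul continuous_diagP).mul continuous_const
  exact this

theorem translation_zpow (h : PSL2R) (t : ℝ) (n : ℤ) :
    translation h t ^ n = translation h (n * t) := by
  have hn : ∀ n : ℕ, translation h t ^ n = translation h (n * t) := by
    intro n
    induction n with
    | zero => simp
    | succ n ih => rw [pow_succ, ih, ← translation_add]; push_cast; ring_nf
  obtain ⟨m, rfl | rfl⟩ := n.eq_nat_or_neg
  · rw [zpow_natCast, hn]; simp
  · rw [zpow_neg, zpow_natCast, hn, ← translation_neg]; push_cast; ring_nf

theorem isometry_imagAxis : Isometry imagAxis := by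
  have := UpperHalfPlane.isometry_vertical_line 0
  convert this using 2 with s
  apply UpperHalfPlane.ext
  apply Complex.ext <;> simp [imagAxis_coe, Complex.exp_ofReal_re]

theorem isometry_geodesic (h : PSL2R) : Isometry (geodesic h) :=
  (isometry_smul ℍ h).comp isometry_imagAxis

theorem dist_geodesic (h : PSL2R) (s t : ℝ) : dist (geodesic h s) (geodesic h t) = |s - t| := by
  rw [(isometry_geodesic h).dist_eq, Real.dist_eq]

theorem continuous_geodesic (h : PSL2R) : Continuous (geodesic h) := (isometry_geodesic h).continuous

/-- The oriented geodesic line underlying `geodesic h`, as a set. -/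
def line (h : PSL2R) : Set ℍ := Set.range (geodesic h)

theorem mem_line_iff {h : PSL2R} {z : ℍ} : z ∈ line h ↔ (h⁻¹ • z).re = 0 := by
  constructor
  · rintro ⟨s, rfl⟩
    rw [geodesic, inv_smul_smul, imagAxis_re]
  · intro hz
    exact ⟨Real.log (h⁻¹ • z).im, by rw [geodesic, ← eq_imagAxis hz, smul_inv_smul]⟩

theorem mem_rightSide_iff {h : PSL2R} {z : ℍ} : z ∈ rightSide h ↔ 0 < (h⁻¹ • z).re := Iff.rfl
theorem mem_leftSide_iff {h : PSL2R} {z : ℍ} : z ∈ leftSide h ↔ (h⁻¹ • z).re < 0 := Iff.rfl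

theorem smul_mem_line_iff {g h : PSL2R} {z : ℍ} : g • z ∈ line (g * h) ↔ z ∈ line h := by
  rw [mem_line_iff, mem_line_iff, mul_inv_rev, mul_smul, inv_smul_smul]

theorem smul_mem_rightSide_iff {g h : PSL2R} {z : ℍ} :
    g • z ∈ rightSide (g * h) ↔ z ∈ rightSide h := by
  rw [mem_rightSide_iff, mem_rightSide_iff, mul_inv_rev, mul_smul, inv_smul_smul]

theorem rightSide_mul_diagP (h : PSL2R) (s : ℝ) : rightSide (h * diagP s) = rightSide h := by
  ext z
  rw [mem_rightSide_iff, mem_rightSide_iff, mul_inv_rev, mul_smul, ← diagP_neg, re_diagP_smul]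
  simp [Real.exp_pos]

theorem leftSide_mul_diagP (h : PSL2R) (s : ℝ) : leftSide (h * diagP s) = leftSide h := by
  ext z
  rw [mem_leftSide_iff, mem_leftSide_iff, mul_inv_rev, mul_smul, ← diagP_neg, re_diagP_smul]
  simp [mul_neg_iff, Real.exp_pos, (Real.exp_pos _).not_gt]

theorem line_mul_diagP (h : PSL2R) (s : ℝ) : line (h * diagP s) = line h := by
  ext z
  rw [mem_line_iff, mem_line_iff, mul_inv_rev, mul_smul, ← diagP_neg, re_diagP_smul]
  simp

/-- The rotation by the angle `θ` around `i`. -/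
def rotMatrix (θ : ℝ) : SL2R :=
  mkSL (Real.cos (θ / 2)) (Real.sin (θ / 2)) (-Real.sin (θ / 2)) (Real.cos (θ / 2)) (by
    have := Real.sin_sq_add_cos_sq (θ / 2); linear_combination this)

/-- The class in `PSL(2, ℝ)` of the rotation by the angle `θ` around `i`. -/
def rotP (θ : ℝ) : PSL2R := (rotMatrix θ : PSL2R)

theorem rotMatrix_add (θ φ : ℝ) : rotMatrix (θ + φ) = rotMatrix θ * rotMatrix φ := by
  apply SL2R.ext' <;> simp only [SL2R.mul_00, SL2R.mul_01, SL2R.mul_10, SL2R.mul_11,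
    rotMatrix, mkSL_00, mkSL_01, mkSL_10, mkSL_11, add_div, Real.cos_add, Real.sin_add] <;> ring

@[simp] theorem rotMatrix_zero : rotMatrix 0 = 1 := by
  apply SL2R.ext' <;> simp [rotMatrix]

theorem rotP_add (θ φ : ℝ) : rotP (θ + φ) = rotP θ * rotP φ := by
  rw [rotP, rotMatrix_add]; rfl

@[simp] theorem rotP_zero : rotP 0 = 1 := by rw [rotP, rotMatrix_zero]; rfl

theorem continuous_rotP : Continuous rotP := by
  refine continuous_mk.comp ?_
  refine Continuous.subtype_mk ?_ _
  refine continuous_matrix fun i j => ?_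
  fin_cases i <;> fin_cases j <;> simp <;> fun_prop

/-- The rotation by the angle `π` around `i`, which reverses the imaginary axis. -/
def revP : PSL2R := rotP Real.pi

theorem coe_revP_smul (z : ℍ) : ((revP • z : ℍ) : ℂ) = -1 / z := by
  rw [revP, rotP, coe_mk_smul]
  simp [rotMatrix, div_neg, neg_div]

theorem revP_smul_imagAxis (s : ℝ) : revP • imagAxis s = imagAxis (-s) := by
  apply UpperHalfPlane.ext
  rw [coe_revP_smul, imagAxis_coe, imagAxis_coe, Real.exp_neg]
  have : (Real.exp s : ℂ) ≠ 0 := by exact_mod_cast (Real.exp_pos s).ne'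
  push_cast
  field_simp
  simp

theorem re_revP_smul (z : ℍ) : (revP • z).re = -(z.re / Complex.normSq z) := by
  rw [← UpperHalfPlane.coe_re, coe_revP_smul, Complex.div_re]
  simp [neg_div]

theorem revP_mul_self : revP * revP = 1 := by
  rw [revP, ← rotP_add, rotP, ← mk_one, mk_eq_mk_iff]
  right
  apply SL2R.ext' <;> simp [rotMatrix]

theorem revP_inv : revP⁻¹ = revP := inv_eq_of_mul_eq_one_right revP_mul_self

theorem revP_conj_diagP (s : ℝ) : revP * diagP s * revP⁻¹ = diagP (-s) := by
  rw [revP, rotP, diagP, diagP, ← mk_inv, ← mk_mul, ← mk_mul, mk_eq_mk_iff]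
  left
  apply SL2R.ext' <;> simp [SL2R.mul_00, SL2R.mul_01, SL2R.mul_10, SL2R.mul_11, rotMatrix,
    SL2R.inv_00, SL2R.inv_01, SL2R.inv_10, SL2R.inv_11, neg_div]

theorem normSq_coe_pos (z : ℍ) : 0 < Complex.normSq (z : ℂ) :=
  Complex.normSq_pos.mpr (UpperHalfPlane.ne_zero z)

theorem rightSide_mul_revP (h : PSL2R) : rightSide (h * revP) = leftSide h := by
  ext z
  rw [mem_rightSide_iff, mem_leftSide_iff, mul_inv_rev, mul_smul, revP_inv, re_revP_smul, ← neg_div]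
  rw [lt_div_iff₀ (normSq_coe_pos _)]; simp

theorem line_mul_revP (h : PSL2R) : line (h * revP) = line h := by
  ext z
  rw [mem_line_iff, mem_line_iff, mul_inv_rev, mul_smul, revP_inv, re_revP_smul, ← neg_div]
  simp [UpperHalfPlane.ne_zero]

theorem translation_mul_revP (h : PSL2R) (t : ℝ) : translation (h * revP) t = translation h (-t) := by
  rw [translation_eq, translation_eq, ← revP_conj_diagP]; group

theorem geodesic_mul_revP (h : PSL2R) (s : ℝ) : geodesic (h * revP) s = geodesic h (-s) := by
  rw [geodesic_mul, geodesic, geodesic, revP_smul_imagAxis]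

theorem isAxis_mul_revP {a h : PSL2R} (H : IsAxis a h) : IsAxis a (h * revP) := by
  obtain ⟨l, hl, rfl⟩ := H
  exact ⟨-l, by simpa using hl, by rw [translation_mul_revP, neg_neg]⟩

theorem isAxis_conj {a h : PSL2R} (g : PSL2R) (H : IsAxis a h) : IsAxis (g * a * g⁻¹) (g * h) := by
  obtain ⟨l, hl, rfl⟩ := H
  exact ⟨l, hl, (translation_conj g h l).symm⟩

/-! ### Segments -/

/-- Move `x` to i and rotate around i until the image of `y` is on the imaginary axis. Such an angle
exists by the intermediate value theorem, since the rotation by π changes the sign of the real part.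
-/
theorem exists_geodesic (x y : ℍ) : ∃ h : PSL2R, geodesic h 0 = x ∧ geodesic h (dist x y) = y := by
  have hI : imagAxis 0 = UpperHalfPlane.I := by
    apply UpperHalfPlane.ext; simp [imagAxis_coe]
  set g : PSL2R := (x.toSL2R : PSL2R) with hg
  have hgx : g • imagAxis 0 = x := by rw [hI, hg, mk_smul, UpperHalfPlane.toSL2R_smul_I]
  set v := g⁻¹ • y with hv
  have hcont : Continuous fun θ : ℝ => (rotP θ • v).re :=
    UpperHalfPlane.continuous_re.comp (continuous_rotP.smul continuous_const)
  have hIVT : ∃ θ : ℝ, (rotP θ • v).re = 0 := by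
    have h0 : (rotP 0 • v).re = v.re := by simp
    have h1 : (rotP Real.pi • v).re = -(v.re / Complex.normSq v) := re_revP_smul v
    have hn := normSq_coe_pos v
    rcases le_total 0 v.re with h | h
    · have := mem_range_of_exists_le_of_exists_ge (c := 0) hcont
        ⟨Real.pi, by rw [h1, neg_nonpos]; positivity⟩ ⟨0, by rw [h0]; exact h⟩
      exact this
    · have := mem_range_of_exists_le_of_exists_ge (c := 0) hcont
        ⟨0, by rw [h0]; exact h⟩ ⟨Real.pi, by
          rw [h1, ← neg_div]; exact div_nonneg (by linarith) hn.le⟩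
      exact this
  obtain ⟨θ, hθ⟩ := hIVT
  obtain ⟨u, hu⟩ : ∃ u, rotP θ • v = imagAxis u := ⟨_, eq_imagAxis hθ⟩
  have hrot : rotP θ • imagAxis 0 = imagAxis 0 := by
    apply UpperHalfPlane.ext
    rw [rotP, coe_mk_smul]
    have := denom_ne_zero (rotMatrix θ) (imagAxis 0)
    rw [div_eq_iff this]
    simp [imagAxis_coe, rotMatrix]
    ring_nf
    simp
  set h := g * (rotP θ)⁻¹ with hh
  have hx : geodesic h 0 = x := by
    rw [geodesic, hh, mul_smul, inv_smul_eq_iff.mpr hrot.symm, hgx]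
  have hy : geodesic h u = y := by
    rw [geodesic, hh, mul_smul, ← hu, inv_smul_smul, hv, smul_inv_smul]
  have hd : dist x y = |u| := by
    rw [← hx, ← hy, dist_geodesic]; simp
  rcases le_total 0 u with h0 | h0
  · exact ⟨h, hx, by rw [hd, abs_of_nonneg h0, hy]⟩
  · refine ⟨h * revP, ?_, ?_⟩
    · rw [geodesic_mul_revP]; simpa using hx
    · rw [geodesic_mul_revP, hd, abs_of_nonpos h0, neg_neg, hy]

/-- A segment that leaves the complement of a half plane for the half plane crosses its boundary. -/
theorem exists_mem_line_dist {h : PSL2R} {x w : ℍ} (hx : x ∉ rightSide h) (hw : w ∈ rightSide h) :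
    ∃ p ∈ line h, dist x p + dist p w = dist x w := by
  obtain ⟨k, hk0, hk1⟩ := exists_geodesic x w
  have hcont : ContinuousOn (fun s : ℝ => (h⁻¹ • geodesic k s).re) (Set.Icc 0 (dist x w)) :=
    (UpperHalfPlane.continuous_re.comp ((continuous_const_smul h⁻¹).comp
      (continuous_geodesic k))).continuousOn
  have := intermediate_value_Icc (dist_nonneg) hcont
  have h0 : (0 : ℝ) ∈ Set.Icc (h⁻¹ • geodesic k 0).re (h⁻¹ • geodesic k (dist x w)).re := by
    rw [hk0, hk1]
    exact ⟨not_lt.mp hx, le_of_lt hw⟩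
  obtain ⟨s, hs, hs0⟩ := this h0
  refine ⟨geodesic k s, mem_line_iff.mpr hs0, ?_⟩
  have h1 : dist x (geodesic k s) = s := by
    rw [← hk0, dist_geodesic, zero_sub, abs_neg, abs_of_nonneg hs.1]
  have h2 : dist (geodesic k s) w = dist x w - s := by
    nth_rw 1 [← hk1]
    rw [dist_geodesic, abs_of_nonpos (by linarith [hs.2])]; ring
  rw [h1, h2]; ring

/-! ### Velocities and angles -/

theorem coe_geodesic (A : SL2R) (u : ℝ) : (geodesic (A : PSL2R) u : ℂ) =
    (A 0 0 * (Complex.I * Complex.exp u) + A 0 1) / (A 1 0 * (Complex.I * Complex.exp u) + A 1 1) := by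
  rw [geodesic, coe_mk_smul, imagAxis_coe]; push_cast; rfl

theorem geodesic_denom_ne_zero (A : SL2R) (u : ℝ) :
    (A 1 0 * (Complex.I * Complex.exp u) + A 1 1 : ℂ) ≠ 0 := by
  have := denom_ne_zero A (imagAxis u)
  rw [imagAxis_coe] at this
  push_cast at this
  exact this

theorem velocity_mk (A : SL2R) (s : ℝ) : velocity (A : PSL2R) s =
    Complex.I * Complex.exp s / (A 1 0 * (Complex.I * Complex.exp s) + A 1 1) ^ 2 := by
  have hne := geodesic_denom_ne_zero A s
  have hz : HasDerivAt (fun u : ℝ => Complex.I * Complex.exp (u : ℂ))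
      (Complex.I * Complex.exp s) s := by
    have := (Complex.hasDerivAt_exp (s : ℂ)).comp_ofReal
    exact this.const_mul Complex.I
  have hn : HasDerivAt (fun u : ℝ => (A 0 0 : ℂ) * (Complex.I * Complex.exp (u : ℂ)) + A 0 1)
      ((A 0 0 : ℂ) * (Complex.I * Complex.exp s)) s := (hz.const_mul _).add_const _
  have hd : HasDerivAt (fun u : ℝ => (A 1 0 : ℂ) * (Complex.I * Complex.exp (u : ℂ)) + A 1 1)
      ((A 1 0 : ℂ) * (Complex.I * Complex.exp s)) s := (hz.const_mul _).add_const _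
  have hq := hn.div hd hne
  have hfun : (fun u : ℝ => (geodesic (A : PSL2R) u : ℂ)) = fun u : ℝ =>
      ((A 0 0 : ℂ) * (Complex.I * Complex.exp (u : ℂ)) + A 0 1) /
        ((A 1 0 : ℂ) * (Complex.I * Complex.exp (u : ℂ)) + A 1 1) := by
    funext u; exact coe_geodesic A u
  rw [velocity, hfun]
  refine hq.deriv.trans ?_
  congr 1
  have hdet : (A 0 0 : ℂ) * A 1 1 - A 0 1 * A 1 0 = 1 := by exact_mod_cast A.det_eq
  linear_combination (Complex.I * Complex.exp s) * hdet

theorem velocity_ne_zero (h : PSL2R) (s : ℝ) : velocity h s ≠ 0 := by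
  obtain ⟨A, rfl⟩ := exists_mk h
  rw [velocity_mk]
  exact div_ne_zero (mul_ne_zero Complex.I_ne_zero (Complex.exp_ne_zero _))
    (pow_ne_zero _ (geodesic_denom_ne_zero A s))

theorem velocity_mk_mul (C : SL2R) (h : PSL2R) (s : ℝ) : velocity ((C : PSL2R) * h) s =
    velocity h s / (C 1 0 * (geodesic h s : ℂ) + C 1 1) ^ 2 := by
  obtain ⟨A, rfl⟩ := exists_mk h
  rw [← mk_mul, velocity_mk, velocity_mk, coe_geodesic, div_div, ← mul_pow]
  have hne := geodesic_denom_ne_zero A s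
  congr 2
  rw [SL2R.mul_10, SL2R.mul_11]
  push_cast
  have e : ∀ n d c e : ℂ, d ≠ 0 → d * (c * (n / d) + e) = c * n + e * d := by
    intro n d c e hd
    field_simp
  rw [e _ _ _ _ hne]
  ring

theorem velocity_mul_diagP (h : PSL2R) (s : ℝ) : velocity (h * diagP s) 0 = velocity h s := by
  rw [velocity, velocity]
  simp only [geodesic_mul_diagP]
  have := deriv_comp_const_add (f := fun u : ℝ => (geodesic h u : ℂ)) s 0
  rw [add_zero] at this
  exact this

theorem rotP_smul (θ : ℝ) : rotP θ • imagAxis 0 = imagAxis 0 := by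
  apply UpperHalfPlane.ext
  rw [rotP, coe_mk_smul]
  have := denom_ne_zero (rotMatrix θ) (imagAxis 0)
  rw [div_eq_iff this]
  simp [imagAxis_coe, rotMatrix]
  ring_nf
  simp

/-- Velocities at the common point i are multiplied by the same conformal factor of `g`, so only g =
1 has to be computed. There the square in the Möbius derivative turns the half angles of `rotMatrix`
into the angle `φ`. -/
theorem velocity_mul_rotP (g : PSL2R) (φ : ℝ) :
    velocity (g * rotP φ) 0 = Complex.exp (φ * Complex.I) * velocity g 0 := by
  obtain ⟨C, rfl⟩ := exists_mk g
  have h1 : velocity (rotP φ) 0 = Complex.exp (φ * Complex.I) * Complex.I := by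
    rw [rotP, velocity_mk]
    have hne := geodesic_denom_ne_zero (rotMatrix φ) 0
    have he : Complex.exp (φ * Complex.I) =
        (Real.cos (φ / 2) + Real.sin (φ / 2) * Complex.I) ^ 2 := by
      have : Complex.exp (φ * Complex.I) = Complex.exp ((φ / 2 : ℝ) * Complex.I) ^ 2 := by
        rw [← Complex.exp_nat_mul]; congr 1; push_cast; ring
      rw [this, Complex.exp_mul_I, Complex.ofReal_cos, Complex.ofReal_sin]
    have hsc : (Real.sin (φ / 2) : ℂ) ^ 2 + (Real.cos (φ / 2) : ℂ) ^ 2 = 1 := by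
      exact_mod_cast Real.sin_sq_add_cos_sq (φ / 2)
    rw [div_eq_iff (pow_ne_zero _ hne), he]
    simp only [rotMatrix, mkSL_10, mkSL_11, Complex.ofReal_zero, Complex.exp_zero, mul_one,
      Complex.ofReal_neg]
    rw [mul_right_comm, ← mul_pow]
    have : ((Real.cos (φ / 2) : ℂ) + Real.sin (φ / 2) * Complex.I) *
        (-(Real.sin (φ / 2) : ℂ) * Complex.I + Real.cos (φ / 2)) = 1 := by
      linear_combination hsc - (Real.sin (φ / 2) : ℂ) ^ 2 * Complex.I_sq
    rw [this]; ring
  have h2 : velocity (1 : PSL2R) 0 = Complex.I := by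
    rw [← mk_one, velocity_mk]; simp
  have h3 := velocity_mk_mul C 1 0
  rw [mul_one, h2] at h3
  rw [velocity_mk_mul, h1, h3, geodesic, geodesic, rotP_smul, one_smul]
  ring

theorem exists_rotP_of_smul_eq {g : PSL2R} (hg : g • imagAxis 0 = imagAxis 0) :
    ∃ φ, g = rotP φ := by
  obtain ⟨A, rfl⟩ := exists_mk g
  have h1 := congrArg ((↑) : ℍ → ℂ) hg
  rw [coe_mk_smul, div_eq_iff (denom_ne_zero _ _), imagAxis_coe] at h1
  have hre := congrArg Complex.re h1
  have him := congrArg Complex.im h1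
  simp at hre him
  have hdet := A.det_eq
  have hnorm : ‖(⟨A 0 0, A 0 1⟩ : ℂ)‖ = 1 := by
    rw [Complex.norm_def, Complex.normSq_mk, Real.sqrt_eq_one]
    linear_combination hdet + A 0 0 * him + A 0 1 * hre
  have hz : (⟨A 0 0, A 0 1⟩ : ℂ) ≠ 0 := by
    intro h; rw [h] at hnorm; simp at hnorm
  set φ := Complex.arg ⟨A 0 0, A 0 1⟩ with hφ
  have hc : Real.cos φ = A 0 0 := by rw [hφ, Complex.cos_arg hz, hnorm]; simp
  have hs : Real.sin φ = A 0 1 := by rw [hφ, Complex.sin_arg, hnorm]; simp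
  refine ⟨2 * φ, ?_⟩
  rw [rotP]
  congr 1
  have : 2 * φ / 2 = φ := by ring
  apply SL2R.ext' <;> simp [rotMatrix, this, hc, hs]
  · linarith
  · linarith

theorem exists_rotP_of_smul_eq_smul {g h : PSL2R} (hg : g • imagAxis 0 = h • imagAxis 0) :
    ∃ φ, h = g * rotP φ := by
  obtain ⟨φ, hφ⟩ := exists_rotP_of_smul_eq (g := g⁻¹ * h) (by
    rw [mul_smul, ← hg, inv_smul_smul])
  exact ⟨φ, by rw [← hφ]; group⟩

/-- The rotation by 2π is -1 in SL(2, ℝ), hence trivial in PSL(2, ℝ). -/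
theorem rotP_eq_of_exp_eq {θ φ : ℝ}
    (h : Complex.exp (φ * Complex.I) = Complex.exp (θ * Complex.I)) : rotP φ = rotP θ := by
  obtain ⟨n, hn⟩ := Complex.exp_eq_exp_iff_exists_int.mp h
  have hn' : φ = θ + n * (2 * Real.pi) := by
    have : (φ : ℂ) = ((θ + n * (2 * Real.pi) : ℝ) : ℂ) := by
      have := mul_right_cancel₀ Complex.I_ne_zero
        (hn.trans (show _ = ((θ + n * (2 * Real.pi) : ℝ) : ℂ) * Complex.I by push_cast; ring))
      exact this
    exact_mod_cast this
  have h2 : ∀ n : ℤ, rotP (n * (2 * Real.pi)) = 1 := by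
    intro n
    rw [rotP, ← mk_one, mk_eq_mk_iff]
    have hs : Real.sin (n * (2 * Real.pi) / 2) = 0 := by
      rw [show (n * (2 * Real.pi) / 2 : ℝ) = n * Real.pi by ring, Real.sin_int_mul_pi]
    have hc := Real.sin_sq_add_cos_sq (n * (2 * Real.pi) / 2)
    rw [hs] at hc
    have hc' : Real.cos (n * (2 * Real.pi) / 2) = 1 ∨ Real.cos (n * (2 * Real.pi) / 2) = -1 :=
      mul_self_eq_one_iff.mp (by nlinarith)
    rcases hc' with h1 | h1
    · left; apply SL2R.ext' <;> simp [rotMatrix, hs, h1]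
    · right; apply SL2R.ext' <;> simp [rotMatrix, hs, h1]
  rw [hn', rotP_add, h2, mul_one]

/-- Removes derivatives from the notion of angle: a single frame `g` at the crossing point, pointing
along the first axis, is turned by `θ` into a frame along the second. -/
theorem hasAngle_iff {a b : PSL2R} {θ : ℝ} : HasAngle a b θ ↔ θ ∈ Set.Ioo 0 Real.pi ∧
    ∃ (g : PSL2R) (l t : ℝ), l ≠ 0 ∧ t ≠ 0 ∧ a = translation g l ∧
      b = translation (g * rotP θ) t := by
  refine and_congr_right fun _ => ?_
  constructor
  · rintro ⟨h, k, s, u, ⟨l, hl, rfl⟩, ⟨t, ht, rfl⟩, hg, hv⟩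
    rw [geodesic_eq, geodesic_eq] at hg
    obtain ⟨φ, hφ⟩ := exists_rotP_of_smul_eq_smul hg
    rw [← velocity_mul_diagP k u, ← velocity_mul_diagP h s, hφ, velocity_mul_rotP] at hv
    have := rotP_eq_of_exp_eq (mul_right_cancel₀ (velocity_ne_zero _ _) hv)
    refine ⟨h * diagP s, l, t, hl, ht, (translation_mul_diagP _ _ _).symm, ?_⟩
    rw [← this, ← hφ, translation_mul_diagP]
  · rintro ⟨g, l, t, hl, ht, rfl, rfl⟩
    refine ⟨g, g * rotP θ, 0, 0, ⟨l, hl, rfl⟩, ⟨t, ht, rfl⟩, ?_, velocity_mul_rotP _ _⟩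
    rw [geodesic, geodesic, mul_smul, rotP_smul]

theorem HasAngle.conj {a b : PSL2R} {θ : ℝ} (g : PSL2R) (H : HasAngle a b θ) :
    HasAngle (g * a * g⁻¹) (g * b * g⁻¹) θ := by
  rw [hasAngle_iff] at H ⊢
  obtain ⟨hθ, h, l, t, hl, ht, rfl, rfl⟩ := H
  refine ⟨hθ, g * h, l, t, hl, ht, (translation_conj _ _ _).symm, ?_⟩
  rw [mul_assoc g h, translation_conj g (h * rotP θ)]

theorem hasAngle_conj_iff {a b : PSL2R} {θ : ℝ} (g : PSL2R) :
    HasAngle (g * a * g⁻¹) (g * b * g⁻¹) θ ↔ HasAngle a b θ := by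
  refine ⟨fun H => ?_, HasAngle.conj g⟩
  have := H.conj g⁻¹
  have e : ∀ x : PSL2R, g⁻¹ * (g * x * g⁻¹) * g⁻¹⁻¹ = x := fun x => by group
  rwa [e, e] at this

/-! ### Uniqueness of axes -/

theorem exists_diagP {A : SL2R} (h01 : A 0 1 = 0) (h10 : A 1 0 = 0) :
    ∃ s, (A : PSL2R) = diagP s := by
  have hdet := A.det_eq
  rw [h01, zero_mul, sub_zero] at hdet
  have key : ∀ B : SL2R, B 0 1 = 0 → B 1 0 = 0 → B 0 0 * B 1 1 = 1 → 0 < B 0 0 →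
      ∃ s, (B : PSL2R) = diagP s := by
    intro B h1 h2 h3 h4
    refine ⟨2 * Real.log (B 0 0), ?_⟩
    rw [diagP]
    congr 1
    have e : 2 * Real.log (B 0 0) / 2 = Real.log (B 0 0) := by ring
    apply SL2R.ext' <;> simp [h1, h2, e, Real.exp_log h4, Real.exp_neg]
    exact eq_inv_of_mul_eq_one_right h3
  rcases lt_trichotomy (A 0 0) 0 with h | h | h
  · rw [← mk_neg]
    exact key (-A) (by simp [h01]) (by simp [h10]) (by simpa using hdet) (by simpa using h)
  · rw [h, zero_mul] at hdet; exact absurd hdet zero_ne_one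
  · exact key A h01 h10 hdet h

/-- The two products vanish exactly when the images A00/A10 of ∞ and A01/A11 of 0 lie in {0, ∞},
that is, when `A` preserves the imaginary axis. -/
theorem exists_diagP_or {A : SL2R} (h1 : A 0 0 * A 1 0 = 0) (h2 : A 0 1 * A 1 1 = 0) :
    ∃ s, (A : PSL2R) = diagP s ∨ (A : PSL2R) = diagP s * revP := by
  have hdet := A.det_eq
  rcases eq_or_ne (A 1 0) 0 with h10 | h10
  · have h11 : A 1 1 ≠ 0 := by rintro h; simp [h, h10] at hdet
    have h01 : A 0 1 = 0 := by simpa [h11] using h2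
    obtain ⟨s, hs⟩ := exists_diagP h01 h10
    exact ⟨s, Or.inl hs⟩
  · have h00 : A 0 0 = 0 := by simpa [h10] using h1
    have h01 : A 0 1 ≠ 0 := by rintro h; simp [h, h00] at hdet
    have h11 : A 1 1 = 0 := by simpa [h01] using h2
    obtain ⟨s, hs⟩ := exists_diagP (A := A * rotMatrix Real.pi)
      (by simp [SL2R.mul_01, rotMatrix, h00]) (by simp [SL2R.mul_10, rotMatrix, h11])
    refine ⟨s, Or.inr ?_⟩
    rw [← hs, mk_mul, mul_assoc]
    change _ = _ * (revP * revP)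
    rw [revP_mul_self, mul_one]

theorem eq_of_line_eq {h k : PSL2R} (H : line k = line h) :
    ∃ s, k = h * diagP s ∨ k = h * diagP s * revP := by
  obtain ⟨A, hA⟩ := exists_mk (h⁻¹ * k)
  have hre : ∀ s, ((A : PSL2R) • imagAxis s).re = 0 := by
    intro s
    have : geodesic k s ∈ line h := H ▸ ⟨s, rfl⟩
    rw [mem_line_iff, geodesic, ← mul_smul, ← hA] at this
    exact this
  have hq : ∀ s, A 0 0 * A 1 0 * (Real.exp s) ^ 2 + A 0 1 * A 1 1 = 0 := by
    intro s
    have := hre s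
    rw [re_mk_smul, div_eq_zero_iff, or_iff_left (normSq_denom_pos _ _).ne'] at this
    rw [imagAxis_re, imagAxis_coe] at this
    simpa [Complex.normSq_apply, sq, Complex.exp_ofReal_re, ← Complex.ofReal_exp] using this
  -- The condition P e^{2s} + Q = 0 at e^s = 1 and at e^s = 2 forces P = Q = 0.
  have h0 := hq 0
  have h1 := hq (Real.log 2)
  rw [Real.exp_zero] at h0
  rw [Real.exp_log two_pos] at h1
  obtain ⟨s, hs | hs⟩ := exists_diagP_or (A := A) (by linarith) (by linarith)
  · exact ⟨s, Or.inl (by rw [← hs, hA]; group)⟩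
  · exact ⟨s, Or.inr (by rw [mul_assoc, ← hs, hA]; group)⟩

theorem eq_of_translation_eq {h k : PSL2R} {l m : ℝ} (hl : l ≠ 0)
    (H : translation h l = translation k m) :
    ∃ s, k = h * diagP s ∨ k = h * diagP s * revP := by
  obtain ⟨A, hA⟩ := exists_mk (h⁻¹ * k)
  have hc : diagP l * (A : PSL2R) = (A : PSL2R) * diagP m := by
    rw [hA]
    rw [translation_eq, translation_eq] at H
    calc diagP l * (h⁻¹ * k) = h⁻¹ * (h * diagP l * h⁻¹) * k := by group
      _ = _ := by rw [H]; group
  have hl' : l = 2 * (l / 2) := by ring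
  have hm' : m = 2 * (m / 2) := by ring
  have key : A 0 0 * A 1 0 = 0 ∧ A 0 1 * A 1 1 = 0 := by
    have hdet := A.det_eq
    rw [diagP, diagP, ← mk_mul, ← mk_mul, mk_eq_mk_iff] at hc
    have e1 := Real.exp_pos (l / 2)
    have e2 := Real.exp_pos (-(l / 2))
    have e3 := Real.exp_pos (m / 2)
    have e4 := Real.exp_pos (-(m / 2))
    rcases hc with hc | hc
    · have c00 := congrArg (fun M : SL2R => M 0 0) hc
      have c01 := congrArg (fun M : SL2R => M 0 1) hc
      have c10 := congrArg (fun M : SL2R => M 1 0) hc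
      have c11 := congrArg (fun M : SL2R => M 1 1) hc
      simp only [SL2R.mul_00, SL2R.mul_01, SL2R.mul_10, SL2R.mul_11, diagMatrix_00, diagMatrix_01,
        diagMatrix_10, diagMatrix_11, mul_zero, zero_mul, add_zero, zero_add] at c00 c01 c10 c11
      constructor
      · by_contra hne
        obtain ⟨n0, n1⟩ := mul_ne_zero_iff.mp hne
        have h0 : Real.exp (m / 2) = Real.exp (l / 2) :=
          mul_left_cancel₀ n0 (by linarith)
        have h1 : Real.exp (m / 2) = Real.exp (-(l / 2)) :=
          mul_left_cancel₀ n1 (by linarith)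
        have := Real.exp_injective (h0.symm.trans h1)
        exact hl (by linarith)
      · by_contra hne
        obtain ⟨n0, n1⟩ := mul_ne_zero_iff.mp hne
        have h0 : Real.exp (-(m / 2)) = Real.exp (l / 2) :=
          mul_left_cancel₀ n0 (by linarith)
        have h1 : Real.exp (-(m / 2)) = Real.exp (-(l / 2)) :=
          mul_left_cancel₀ n1 (by linarith)
        have := Real.exp_injective (h0.symm.trans h1)
        exact hl (by linarith)
    -- With the opposite sign the first row of `A` has to vanish. This is absurd, but it already
    -- yields the two products required.
    · have c00 := congrArg (fun M : SL2R => M 0 0) hc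
      have c01 := congrArg (fun M : SL2R => M 0 1) hc
      simp only [SL2R.mul_00, SL2R.mul_01, diagMatrix_00, diagMatrix_01,
        diagMatrix_10, diagMatrix_11, mul_zero, zero_mul, add_zero, zero_add,
        Matrix.SpecialLinearGroup.coe_neg, Matrix.neg_apply] at c00 c01
      have h0 : A 0 0 = 0 := by
        have : A 0 0 * (Real.exp (m / 2) + Real.exp (l / 2)) = 0 := by linarith
        rcases mul_eq_zero.mp this with h | h
        · exact h
        · linarith
      have h1 : A 0 1 = 0 := by
        have : A 0 1 * (Real.exp (-(m / 2)) + Real.exp (l / 2)) = 0 := by linarith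
        rcases mul_eq_zero.mp this with h | h
        · exact h
        · linarith
      simp [h0, h1]
  obtain ⟨s, hs | hs⟩ := exists_diagP_or key.1 key.2
  · exact ⟨s, Or.inl (by rw [← hs, hA]; group)⟩
  · exact ⟨s, Or.inr (by rw [mul_assoc, ← hs, hA]; group)⟩

theorem line_eq_of_isAxis {a h k : PSL2R} (hh : IsAxis a h) (hk : IsAxis a k) : line h = line k := by
  obtain ⟨l, hl, rfl⟩ := hh
  obtain ⟨m, hm, e⟩ := hk
  obtain ⟨s, rfl | rfl⟩ := eq_of_translation_eq hl e
  · rw [line_mul_diagP]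
  · rw [line_mul_revP, line_mul_diagP]

theorem axis_eq_line {a h : PSL2R} (hh : IsAxis a h) : axis a = line h := by
  ext z
  constructor
  · rintro ⟨k, hk, hz⟩
    rw [line_eq_of_isAxis hh hk]; exact hz
  · exact fun hz => ⟨h, hh, hz⟩

/-! ### Half planes -/

theorem re_mk_smul_pos_iff (A : SL2R) (z : ℍ) : 0 < ((A : PSL2R) • z : ℍ).re ↔
    0 < A 0 0 * A 1 0 * Complex.normSq z + (A 0 0 * A 1 1 + A 0 1 * A 1 0) * z.re +
      A 0 1 * A 1 1 := by
  rw [re_mk_smul, lt_div_iff₀ (normSq_denom_pos _ _), zero_mul]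

theorem re_mk_smul_neg_iff (A : SL2R) (z : ℍ) : ((A : PSL2R) • z : ℍ).re < 0 ↔
    A 0 0 * A 1 0 * Complex.normSq z + (A 0 0 * A 1 1 + A 0 1 * A 1 0) * z.re +
      A 0 1 * A 1 1 < 0 := by
  rw [re_mk_smul, div_lt_iff₀ (normSq_denom_pos _ _), zero_mul]

/-- Positivity of P|z|² + S·re z + Q whenever re z > 0 forces P, Q ≥ 0 and S ≥ 1. Then A00 and A11
have the same sign, and so, weakly, do the off-diagonal entries, so one of ±A is nonnegative. Each
sign is obtained by testing a suitable point. -/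
theorem exists_nonneg_of_mapsTo {g : PSL2R} (H : ∀ z : ℍ, 0 < z.re → 0 < (g • z).re) :
    ∃ A : SL2R, (A : PSL2R) = g ∧ 0 < A 0 0 ∧ 0 ≤ A 0 1 ∧ 0 ≤ A 1 0 ∧ 0 < A 1 1 := by
  obtain ⟨A, rfl⟩ := exists_mk g
  have hdet := A.det_eq
  have key : ∀ x y : ℝ, 0 < x → 0 < y → 0 < A 0 0 * A 1 0 * (x * x + y * y) +
      (A 0 0 * A 1 1 + A 0 1 * A 1 0) * x + A 0 1 * A 1 1 := by
    intro x y hx hy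
    have := H ⟨⟨x, y⟩, hy⟩ hx
    rw [re_mk_smul_pos_iff] at this
    simpa [Complex.normSq_apply] using this
  have hS2 : (A 0 0 * A 1 1 + A 0 1 * A 1 0) ^ 2 = 1 + 4 * (A 0 0 * A 1 0) * (A 0 1 * A 1 1) := by
    linear_combination (A 0 0 * A 1 1 - A 0 1 * A 1 0 + 1) * hdet
  have hfin : 0 ≤ A 0 0 * A 1 0 ∧ 0 ≤ A 0 1 * A 1 1 ∧ 1 ≤ A 0 0 * A 1 1 + A 0 1 * A 1 0 := by
    generalize A 0 0 * A 1 0 = P at key hS2 ⊢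
    generalize A 0 1 * A 1 1 = Q at key hS2 ⊢
    generalize A 0 0 * A 1 1 + A 0 1 * A 1 0 = S at key hS2 ⊢
    have hP : 0 ≤ P := by
      by_contra! hP
      -- If P < 0 the form is negative at 1 + i(N + 1), where the quadratic term dominates.
      set N := (|S| + |Q|) / (-P) with hN
      have hN0 : 0 ≤ N := by apply div_nonneg <;> first | positivity | linarith
      have hPN : P * N = -(|S| + |Q|) := by
        have := hP.ne
        rw [hN]; field_simp
      have := key 1 (N + 1) one_pos (by linarith)
      nlinarith [le_abs_self S, le_abs_self Q, mul_nonneg hN0 hN0, mul_nonneg hN0 (neg_pos.mpr hP).le,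
        mul_nonneg (mul_nonneg hN0 hN0) (neg_pos.mpr hP).le]
    have hQ : 0 ≤ Q := by
      by_contra! hQ
      -- If Q < 0 the form is negative at ε + iε for small ε: it is at most Q + (2P + |S|)ε.
      set D := 2 * P + |S| + 1 with hD
      have hD0 : 0 < D := by positivity
      obtain ⟨ε, hε, hε1, hε2⟩ : ∃ ε : ℝ, 0 < ε ∧ ε ≤ 1 ∧ ε ≤ -Q / D :=
        ⟨min 1 (-Q / D), lt_min one_pos (div_pos (by linarith) hD0), min_le_left _ _,
          min_le_right _ _⟩
      have h1 := key ε ε hε hε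
      rw [le_div_iff₀ hD0] at hε2
      have h2 : S * ε ≤ |S| * ε := mul_le_mul_of_nonneg_right (le_abs_self S) hε.le
      have h3 : P * (ε * ε) ≤ P * ε := by
        apply mul_le_mul_of_nonneg_left _ hP
        nlinarith
      nlinarith
    have hPQ := mul_nonneg hP hQ
    refine ⟨hP, hQ, ?_⟩
    by_contra! hS
    have hS1 : S ≤ -1 := by nlinarith
    rcases hP.eq_or_lt with h0 | h0
    · have := key (Q + 1) 1 (by linarith) one_pos
      rw [← h0] at this
      nlinarith
    -- The zero set of the form is the circle around -S/(2P) of radius 1/(2P), because S² = 1 + 4PQ.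
    -- Its top point has positive real part when S < 0, contradicting positivity.
    · have := key (-S / (2 * P)) (1 / (2 * P)) (by apply div_pos <;> linarith) (by positivity)
      have e : P * (-S / (2 * P) * (-S / (2 * P)) + 1 / (2 * P) * (1 / (2 * P))) +
          S * (-S / (2 * P)) + Q = (1 + 4 * P * Q - S ^ 2) / (4 * P) := by field_simp; ring
      rw [e, hS2] at this
      simp at this
  obtain ⟨hP, hQ, hS⟩ := hfin
  have had : 0 < A 0 0 * A 1 1 := by linarith
  rcases lt_or_ge 0 (A 0 0) with ha | ha
  · have hd := (pos_iff_pos_of_mul_pos had).mp ha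
    exact ⟨A, rfl, ha, nonneg_of_mul_nonneg_left hQ hd, nonneg_of_mul_nonneg_right hP ha, hd⟩
  · have ha : A 0 0 < 0 := lt_of_le_of_ne ha (by rintro h; simp [h] at had)
    have hd : A 1 1 < 0 := (neg_iff_neg_of_mul_pos had).mp ha
    refine ⟨-A, mk_neg A, ?_, ?_, ?_, ?_⟩ <;> simp only [Matrix.SpecialLinearGroup.coe_neg,
      Matrix.neg_apply, Left.nonneg_neg_iff, Left.neg_pos_iff]
    · exact ha
    · by_contra! h; nlinarith
    · by_contra! h; nlinarith
    · exact hd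

theorem exists_nonneg_of_rightSide_subset {h k : PSL2R} (H : rightSide h ⊆ rightSide k) :
    ∃ A : SL2R, (A : PSL2R) = k⁻¹ * h ∧ 0 < A 0 0 ∧ 0 ≤ A 0 1 ∧ 0 ≤ A 1 0 ∧ 0 < A 1 1 := by
  refine exists_nonneg_of_mapsTo fun z hz => ?_
  have : h • z ∈ rightSide h := by rwa [mem_rightSide_iff, inv_smul_smul]
  have := H this
  rwa [mem_rightSide_iff, ← mul_smul] at this

/-- The change of frame and its inverse are both nonnegative, but inversion changes the sign of the
off-diagonal entries, so these vanish. -/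
theorem eq_of_rightSide_eq {h k : PSL2R} (H : rightSide k = rightSide h) :
    ∃ s, k = h * diagP s := by
  obtain ⟨A, hA, a00, a01, a10, a11⟩ := exists_nonneg_of_rightSide_subset H.subset
  obtain ⟨B, hB, b00, b01, b10, b11⟩ := exists_nonneg_of_rightSide_subset H.symm.subset
  have hBA : (B : PSL2R) = ((A⁻¹ : SL2R) : PSL2R) := by rw [mk_inv, hA, hB]; group
  have key : A 0 1 = 0 ∧ A 1 0 = 0 := by
    rcases mk_eq_mk_iff.mp hBA with h1 | h1
    · have e1 : -A 0 1 = B 0 1 := by rw [← h1, SL2R.inv_01]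
      have e2 : -A 1 0 = B 1 0 := by rw [← h1, SL2R.inv_10]
      constructor <;> linarith
    · have e1 : A 1 1 = -B 0 0 := by
        rw [← SL2R.inv_00, h1]; simp
      linarith
  obtain ⟨s, hs⟩ := exists_diagP key.1 key.2
  exact ⟨s, by rw [← hs, hA]; group⟩

theorem translation_eq_of_rightSide_eq {h k : PSL2R} (H : rightSide k = rightSide h) (t : ℝ) :
    translation k t = translation h t := by
  obtain ⟨s, rfl⟩ := eq_of_rightSide_eq H
  exact translation_mul_diagP h s t

theorem line_eq_of_rightSide_eq {h k : PSL2R} (H : rightSide k = rightSide h) :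
    line k = line h := by
  obtain ⟨s, rfl⟩ := eq_of_rightSide_eq H
  exact line_mul_diagP h s

theorem rightSide_eq_or_of_line_eq {h k : PSL2R} (H : line k = line h) :
    rightSide k = rightSide h ∨ rightSide k = leftSide h := by
  obtain ⟨s, rfl | rfl⟩ := eq_of_line_eq H
  · exact Or.inl (rightSide_mul_diagP h s)
  · exact Or.inr (by rw [rightSide_mul_revP, leftSide_mul_diagP])

/-- Half planes bounded by disjoint lines are nested. -/
theorem nested_of_disjoint {h k : PSL2R} (H : Disjoint (line h) (line k)) :
    rightSide k ⊆ rightSide h ∨ leftSide k ⊆ rightSide h ∨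
      rightSide k ⊆ leftSide h ∨ rightSide h ⊆ rightSide k := by
  obtain ⟨A, hA⟩ := exists_mk (h⁻¹ * k)
  have hdet := A.det_eq
  have hS2 : (A 0 0 * A 1 1 + A 0 1 * A 1 0) ^ 2 = 1 + 4 * (A 0 0 * A 1 0) * (A 0 1 * A 1 1) := by
    linear_combination (A 0 0 * A 1 1 - A 0 1 * A 1 0 + 1) * hdet
  -- Intersections of the two lines correspond to the positive roots y = e^{2s} of P y + Q. Having
  -- none forces P and Q to have weakly the same sign; then S² = 1 + 4PQ ≥ 1, so S ≠ 0. The four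
  -- sign patterns of (P, Q) and S are the four ways of being nested.
  have hne : ∀ y : ℝ, 0 < y → A 0 0 * A 1 0 * y + A 0 1 * A 1 1 ≠ 0 := by
    intro y hy h0
    have h1 : geodesic k (Real.log y / 2) ∈ line h := by
      rw [mem_line_iff, geodesic, ← mul_smul, ← hA, re_mk_smul, div_eq_zero_iff]
      left
      rw [imagAxis_re, mul_zero, add_zero, ← h0]
      congr 2
      rw [Complex.normSq_apply, UpperHalfPlane.coe_re, UpperHalfPlane.coe_im, imagAxis_re,
        imagAxis_im, ← Real.exp_add, add_halves, Real.exp_log hy]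
      ring
    exact Set.disjoint_left.mp H h1 ⟨_, rfl⟩
  have hmem : ∀ z : ℍ, h⁻¹ • z = (A : PSL2R) • (k⁻¹ • z) := by
    intro z; rw [hA, mul_smul, smul_inv_smul]
  have hsign : (0 ≤ A 0 0 * A 1 0 ∧ 0 ≤ A 0 1 * A 1 1) ∨
      (A 0 0 * A 1 0 ≤ 0 ∧ A 0 1 * A 1 1 ≤ 0) := by
    by_contra! hcon
    rcases lt_trichotomy (A 0 0 * A 1 0) 0 with h1 | h1 | h1
    · have h2 : 0 < A 0 1 * A 1 1 := hcon.2 h1.le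
      exact hne (-(A 0 1 * A 1 1) / (A 0 0 * A 1 0)) (div_pos_of_neg_of_neg (by linarith) h1)
        (by rw [mul_div_cancel₀ _ h1.ne]; ring)
    · exact absurd (hcon.1 h1.ge) (not_lt.mpr (hcon.2 h1.le).le)
    · have h2 : A 0 1 * A 1 1 < 0 := hcon.1 h1.le
      exact hne (-(A 0 1 * A 1 1) / (A 0 0 * A 1 0)) (div_pos (by linarith) h1)
        (by rw [mul_div_cancel₀ _ h1.ne']; ring)
  have hS0 : A 0 0 * A 1 1 + A 0 1 * A 1 0 ≠ 0 := by
    intro h0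
    rw [h0] at hS2
    rcases hsign with ⟨h1, h2⟩ | ⟨h1, h2⟩
    · nlinarith [mul_nonneg h1 h2]
    · nlinarith [mul_nonneg_of_nonpos_of_nonpos h1 h2]
  simp only [Set.subset_def, mem_rightSide_iff, mem_leftSide_iff, hmem, re_mk_smul_pos_iff,
    re_mk_smul_neg_iff]
  have hn := fun z : ℍ => normSq_coe_pos (k⁻¹ • z)
  rcases hsign with ⟨h1, h2⟩ | ⟨h1, h2⟩ <;> rcases hS0.lt_or_gt with h3 | h3
  · right; left
    intro z hz
    have := mul_nonneg h1 (hn z).le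
    nlinarith [mul_pos_of_neg_of_neg h3 hz]
  · left
    intro z hz
    have := mul_nonneg h1 (hn z).le
    nlinarith [mul_pos h3 hz]
  · right; right; left
    intro z hz
    have := mul_nonneg (neg_nonneg.mpr h1) (hn z).le
    nlinarith [mul_neg_of_neg_of_pos h3 hz]
  · right; right; right
    intro z hz
    have := mul_nonneg (neg_nonneg.mpr h1) (hn z).le
    by_contra! hcon
    nlinarith [mul_nonpos_of_nonneg_of_nonpos h3.le hcon]

/-! ### Translations along rotated axes -/

/-- The explicit matrix of a translation whose axis meets the imaginary axis at i e^s under the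
angle `θ`. Both the crossing criterion and the formula for the angle are read off from its entries.
-/
theorem translation_diagP_rotP (s θ t : ℝ) : translation (diagP s * rotP θ) t =
    ((mkSL (Real.cosh (t / 2) + Real.cos θ * Real.sinh (t / 2))
      (-(Real.exp s * Real.sin θ * Real.sinh (t / 2)))
      (-(Real.exp (-s) * Real.sin θ * Real.sinh (t / 2)))
      (Real.cosh (t / 2) - Real.cos θ * Real.sinh (t / 2)) (by
        have h1 := Real.cosh_sq (t / 2)
        have h2 := Real.sin_sq_add_cos_sq θ
        have h3 : Real.exp s * Real.exp (-s) = 1 := by rw [← Real.exp_add]; simp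
        linear_combination h1 - Real.sin θ ^ 2 * Real.sinh (t / 2) ^ 2 * h3 -
          Real.sinh (t / 2) ^ 2 * h2) : SL2R) : PSL2R) := by
  rw [translation_eq, diagP, rotP, diagP, ← mk_mul, ← mk_inv, ← mk_mul, ← mk_mul]
  congr 1
  have hc : Real.cos θ = Real.cos (θ / 2) ^ 2 - Real.sin (θ / 2) ^ 2 := by
    rw [← Real.cos_two_mul']; ring_nf
  have hs : Real.sin θ = 2 * Real.sin (θ / 2) * Real.cos (θ / 2) := by
    rw [← Real.sin_two_mul]; ring_nf
  have h2 := Real.sin_sq_add_cos_sq (θ / 2)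
  have e1 : Real.exp (t / 2) = Real.cosh (t / 2) + Real.sinh (t / 2) := by
    rw [Real.cosh_add_sinh]
  have e2 : Real.exp (-(t / 2)) = Real.cosh (t / 2) - Real.sinh (t / 2) := by
    rw [Real.cosh_sub_sinh]
  have h3 : Real.exp (s / 2) * Real.exp (-(s / 2)) = 1 := by rw [← Real.exp_add]; simp
  have h4 : Real.exp s = Real.exp (s / 2) ^ 2 := by rw [← Real.exp_nat_mul]; ring_nf
  have h5 : Real.exp (-s) = Real.exp (-(s / 2)) ^ 2 := by rw [← Real.exp_nat_mul]; ring_nf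
  apply SL2R.ext' <;> simp only [SL2R.mul_00, SL2R.mul_01, SL2R.mul_10, SL2R.mul_11, SL2R.inv_00,
    SL2R.inv_01, SL2R.inv_10, SL2R.inv_11, rotMatrix, mkSL_00, mkSL_01, mkSL_10, mkSL_11,
    diagMatrix_00, diagMatrix_01, diagMatrix_10, diagMatrix_11, hc, hs, e1, e2, h4, h5] <;>
  generalize Real.exp (s / 2) = p at * <;> generalize Real.exp (-(s / 2)) = q at * <;>
  generalize Real.cosh (t / 2) = C at * <;> generalize Real.sinh (t / 2) = S at * <;>
  generalize Real.cos (θ / 2) = c at * <;> generalize Real.sin (θ / 2) = d at *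
  · linear_combination (C + (c ^ 2 - d ^ 2) * S) * h3 + p * q * C * h2
  · ring
  · ring
  · linear_combination (C - (c ^ 2 - d ^ 2) * S) * h3 + p * q * C * h2

/-! ### Traces of commutators -/

/-- The trace of the commutator of two elements of `SL(2, ℝ)`. -/
def slCommTrace (A B : SL2R) : ℝ := Matrix.trace (A * B * A⁻¹ * B⁻¹ : SL2R).1

theorem slCommTrace_neg_left (A B : SL2R) : slCommTrace (-A) B = slCommTrace A B := by
  simp only [slCommTrace, inv_neg, neg_mul, mul_neg, neg_neg]

theorem slCommTrace_neg_right (A B : SL2R) : slCommTrace A (-B) = slCommTrace A B := by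
  simp only [slCommTrace, inv_neg, neg_mul, mul_neg, neg_neg]

/-- The trace of the commutator of two elements of `PSL(2, ℝ)`. -/
def commTrace (g h : PSL2R) : ℝ := slCommTrace g.out h.out

/-- The signs of the lifts cancel in a commutator, so the choice made by `Quotient.out` is
immaterial. -/
theorem commTrace_mk (A B : SL2R) : commTrace (A : PSL2R) (B : PSL2R) = slCommTrace A B := by
  have hA : ((A : PSL2R).out : PSL2R) = (A : PSL2R) := QuotientGroup.out_eq' _
  have hB : ((B : PSL2R).out : PSL2R) = (B : PSL2R) := QuotientGroup.out_eq' _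
  rw [commTrace]
  rcases mk_eq_mk_iff.mp hA with h1 | h1 <;> rcases mk_eq_mk_iff.mp hB with h2 | h2 <;>
    conv_rhs => rw [h1, h2]
  · rw [slCommTrace_neg_right]
  · rw [slCommTrace_neg_left]
  · rw [slCommTrace_neg_left, slCommTrace_neg_right]

theorem continuous_slCommTrace : Continuous fun p : SL2R × SL2R => slCommTrace p.1 p.2 := by
  have h : Continuous fun p : SL2R × SL2R => p.1 * p.2 * p.1⁻¹ * p.2⁻¹ := by fun_prop
  exact (continuous_subtype_val.comp h).matrix_trace

theorem continuous_commTrace : Continuous fun p : PSL2R × PSL2R => commTrace p.1 p.2 := by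
  rw [← (QuotientGroup.isOpenQuotientMap_mk.prodMap
    QuotientGroup.isOpenQuotientMap_mk).continuous_comp_iff]
  convert continuous_slCommTrace with p
  exact commTrace_mk _ _

theorem commTrace_conj (g a b : PSL2R) :
    commTrace (g * a * g⁻¹) (g * b * g⁻¹) = commTrace a b := by
  obtain ⟨G, rfl⟩ := exists_mk g
  obtain ⟨A, rfl⟩ := exists_mk a
  obtain ⟨B, rfl⟩ := exists_mk b
  rw [← mk_inv, ← mk_mul, ← mk_mul, ← mk_mul, ← mk_mul, commTrace_mk, commTrace_mk, slCommTrace,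
    slCommTrace]
  have : G * A * G⁻¹ * (G * B * G⁻¹) * (G * A * G⁻¹)⁻¹ * (G * B * G⁻¹)⁻¹ =
      G * (A * B * A⁻¹ * B⁻¹ * G⁻¹) := by group
  rw [this, Matrix.SpecialLinearGroup.coe_mul, Matrix.trace_mul_comm,
    ← Matrix.SpecialLinearGroup.coe_mul, inv_mul_cancel_right]

theorem commTrace_diagP (l : ℝ) (B : SL2R) : commTrace (diagP l) (B : PSL2R) =
    2 - B 0 1 * B 1 0 * (Real.exp (l / 2) - Real.exp (-(l / 2))) ^ 2 := by
  rw [diagP, commTrace_mk, slCommTrace, Matrix.trace_fin_two]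
  have hdet := B.det_eq
  have h3 : Real.exp (l / 2) * Real.exp (-(l / 2)) = 1 := by rw [← Real.exp_add]; simp
  simp only [SL2R.mul_00, SL2R.mul_01, SL2R.mul_10, SL2R.mul_11, SL2R.inv_00,
    SL2R.inv_01, SL2R.inv_10, SL2R.inv_11, diagMatrix_00, diagMatrix_01, diagMatrix_10,
    diagMatrix_11]
  generalize Real.exp (l / 2) = p at *
  generalize Real.exp (-(l / 2)) = q at *
  linear_combination 2 * hdet + (2 * B 0 0 * B 1 1 - 2 * B 0 1 * B 1 0) * h3

theorem exp_half_sub_ne_zero {l : ℝ} (hl : l ≠ 0) :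
    Real.exp (l / 2) - Real.exp (-(l / 2)) ≠ 0 := by
  intro h
  have := Real.exp_injective (sub_eq_zero.mp h)
  exact hl (by linarith)

/-- The fixed points of `B` are the roots of B10 x² + (B11 - B00) x - B01. When B01 · B10 > 0 their
product is negative, so they are separated by the fixed points 0 and ∞ of the diagonal element: the
axes cross. -/
theorem commTrace_diagP_lt_iff {l : ℝ} (hl : l ≠ 0) (B : SL2R) :
    commTrace (diagP l) (B : PSL2R) < 2 ↔ 0 < B 0 1 * B 1 0 := by
  rw [commTrace_diagP]
  have : 0 < (Real.exp (l / 2) - Real.exp (-(l / 2))) ^ 2 := by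
    have := exp_half_sub_ne_zero hl
    positivity
  constructor
  · intro h; exact pos_of_mul_pos_left (by linarith) this.le
  · intro h; have := mul_pos h this; linarith

/-- If the axes of two hyperbolic elements meet, then they coincide or cross. -/
theorem commTrace_lt_or_line_eq {a b h k : PSL2R} (ha : IsAxis a h) (hb : IsAxis b k) {z : ℍ}
    (hz : z ∈ line h) (hz' : z ∈ line k) : commTrace a b < 2 ∨ line h = line k := by
  obtain ⟨l, hl, rfl⟩ := ha
  obtain ⟨t, ht, rfl⟩ := hb
  obtain ⟨s, rfl⟩ := hz
  obtain ⟨u, hu⟩ := hz'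
  rw [geodesic_eq, geodesic_eq] at hu
  obtain ⟨φ, hφ⟩ := exists_rotP_of_smul_eq_smul hu.symm
  have hk : k = h * (diagP s * rotP φ) * (diagP u)⁻¹ := by
    rw [eq_mul_inv_iff_mul_eq, hφ]; group
  rw [← diagP_neg] at hk
  have e1 : translation k t = h * translation (diagP s * rotP φ) t * h⁻¹ := by
    rw [hk, translation_mul_diagP, translation_conj]
  have e2 : line k = line (h * (diagP s * rotP φ)) := by rw [hk, line_mul_diagP]
  rw [e1, translation_eq h, commTrace_conj, e2, translation_diagP_rotP, commTrace_diagP_lt_iff hl]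
  have hsh : Real.sinh (t / 2) ≠ 0 := by
    rw [Real.sinh_ne_zero]; exact div_ne_zero ht two_ne_zero
  rcases eq_or_ne (Real.sin φ) 0 with h0 | h0
  · right
    have h1 : 2 * Real.sin (φ / 2) * Real.cos (φ / 2) = 0 := by
      rw [← Real.sin_two_mul, ← h0]; ring_nf
    obtain ⟨v, hv | hv⟩ := exists_diagP_or (A := rotMatrix φ) (by simp [rotMatrix]; grind)
      (by simp [rotMatrix]; grind)
    · rw [rotP, hv, ← mul_assoc, line_mul_diagP, line_mul_diagP]
    · rw [rotP, hv, ← mul_assoc, ← mul_assoc, line_mul_revP, line_mul_diagP, line_mul_diagP]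
  · left
    have h3 : Real.exp s * Real.exp (-s) = 1 := by rw [← Real.exp_add]; simp
    simp only [mkSL_01, mkSL_10]
    have : -(Real.exp s * Real.sin φ * Real.sinh (t / 2)) *
        -(Real.exp (-s) * Real.sin φ * Real.sinh (t / 2)) =
        (Real.sin φ * Real.sinh (t / 2)) ^ 2 := by
      linear_combination (Real.sin φ * Real.sinh (t / 2)) ^ 2 * h3
    rw [this]
    positivity

/-! ### The angle of a positive matrix with the imaginary axis -/

/-- The cotangent of the angle from the imaginary axis to the axis of a matrix with positive
entries. -/
def cotAngle (B : SL2R) : ℝ := (|B 1 1| - |B 0 0|) / (2 * √(B 0 1 * B 1 0))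

theorem cotAngle_neg (B : SL2R) : cotAngle (-B) = cotAngle B := by
  simp [cotAngle]

/-- The parameters solve the equations of `translation_diagP_rotP`. The ratio of the off-diagonal
entries is e^{2s}, their product w² is (sin θ sinh(t/2))², and the difference of the diagonal
entries gives cot θ = κ, so sin θ = 1/r. The translation length is negative because the off-diagonal
entries are positive. -/
theorem exists_translation_of_pos {B : SL2R} (h00 : 0 < B 0 0) (h01 : 0 < B 0 1)
    (h10 : 0 < B 1 0) (h11 : 0 < B 1 1) : ∃ s t, t ≠ 0 ∧
      (B : PSL2R) = translation (diagP s * rotP (Real.pi / 2 - Real.arctan (cotAngle B))) t := by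
  have hdet := B.det_eq
  set w := √(B 0 1 * B 1 0) with hw
  have hw0 : 0 < w := Real.sqrt_pos.mpr (by positivity)
  have hw2 : w ^ 2 = B 0 1 * B 1 0 := Real.sq_sqrt (by positivity)
  set κ := cotAngle B with hκ
  have hκ' : 2 * w * κ = B 1 1 - B 0 0 := by
    rw [hκ, cotAngle, abs_of_pos h00, abs_of_pos h11, ← hw]; field_simp
  set r := √(1 + κ ^ 2) with hr
  have hr0 : 0 < r := Real.sqrt_pos.mpr (by positivity)
  have hr2 : r ^ 2 = 1 + κ ^ 2 := Real.sq_sqrt (by positivity)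
  have hs : Real.exp (Real.log (B 0 1 / w)) = B 0 1 / w := Real.exp_log (by positivity)
  have hs' : Real.exp (-Real.log (B 0 1 / w)) = w / B 0 1 := by
    rw [Real.exp_neg, hs, inv_div]
  have hτ : -2 * Real.arsinh (w * r) / 2 = -Real.arsinh (w * r) := by ring
  have hch : √(1 + (w * r) ^ 2) = (B 0 0 + B 1 1) / 2 := by
    rw [Real.sqrt_eq_iff_mul_self_eq (by positivity) (by positivity)]
    rw [mul_pow, hr2]
    linear_combination (1 / 4 * (2 * w * κ + B 1 1 - B 0 0)) * hκ' +  hw2 - hdet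
  refine ⟨Real.log (B 0 1 / w), -2 * Real.arsinh (w * r), ?_, ?_⟩
  · have : Real.arsinh (w * r) ≠ 0 := by rw [Ne, Real.arsinh_eq_zero_iff]; positivity
    simpa using this
  · rw [translation_diagP_rotP]
    congr 1
    apply SL2R.ext' <;> simp only [mkSL_00, mkSL_01, mkSL_10, mkSL_11, hs, hs', hτ, Real.cosh_neg,
      Real.sinh_neg, Real.sinh_arsinh, Real.cosh_arsinh, Real.cos_pi_div_two_sub,
      Real.sin_pi_div_two_sub, Real.sin_arctan, Real.cos_arctan, hch, ← hr]
    · field_simp; linear_combination hκ'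
    · field_simp
    · field_simp; linear_combination (-1) * hw2
    · field_simp; linear_combination (-1) * hκ'

theorem exists_translation_of_mul_pos {B : SL2R} (h : 0 < B 0 1 * B 1 0) :
    ∃ s θ t, t ≠ 0 ∧ (B : PSL2R) = translation (diagP s * rotP θ) t := by
  have hdet := B.det_eq
  have had : 0 < B 0 0 * B 1 1 := by linarith
  have key : ∀ C : SL2R, 0 < C 0 0 → 0 < C 1 1 → 0 < C 0 1 * C 1 0 →
      ∃ s θ t, t ≠ 0 ∧ (C : PSL2R) = translation (diagP s * rotP θ) t := by
    intro C h00 h11 h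
    rcases lt_or_ge 0 (C 0 1) with h01 | h01
    · obtain ⟨s, t, ht, e⟩ := exists_translation_of_pos h00 h01
        ((pos_iff_pos_of_mul_pos h).mp h01) h11
      exact ⟨s, _, t, ht, e⟩
    · have h01 : C 0 1 < 0 := lt_of_le_of_ne h01 (by rintro h'; simp [h'] at h)
      have h10 := (neg_iff_neg_of_mul_pos h).mp h01
      obtain ⟨s, t, ht, e⟩ := exists_translation_of_pos (B := C⁻¹) (by rwa [SL2R.inv_00])
        (by rw [SL2R.inv_01]; linarith) (by rw [SL2R.inv_10]; linarith) (by rwa [SL2R.inv_11])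
      refine ⟨s, Real.pi / 2 - Real.arctan (cotAngle C⁻¹), -t, by simpa using ht, ?_⟩
      rw [translation_neg, ← e, mk_inv, inv_inv]
  rcases lt_or_ge 0 (B 0 0) with h00 | h00
  · exact key B h00 ((pos_iff_pos_of_mul_pos had).mp h00) h
  · have h00 : B 0 0 < 0 := lt_of_le_of_ne h00 (by rintro h'; simp [h'] at had)
    have h11 := (neg_iff_neg_of_mul_pos had).mp h00
    rw [← mk_neg]
    apply key (-B) <;> simp <;> assumption

/-- Crossing axes: if the trace of the commutator is less than `2`, then the second element is
hyperbolic and its axis meets the axis of the first one. -/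
theorem exists_isAxis_of_commTrace_lt {a b h : PSL2R} (ha : IsAxis a h) (H : commTrace a b < 2) :
    ∃ k, IsAxis b k ∧ ∃ z, z ∈ line h ∧ z ∈ line k := by
  obtain ⟨l, hl, rfl⟩ := ha
  obtain ⟨B, hB⟩ := exists_mk (h⁻¹ * b * h)
  have hb : b = h * (B : PSL2R) * h⁻¹ := by rw [hB]; group
  rw [hb, translation_eq, commTrace_conj, commTrace_diagP_lt_iff hl] at H
  obtain ⟨s, θ, t, ht, e⟩ := exists_translation_of_mul_pos H
  refine ⟨h * (diagP s * rotP θ), ⟨t, ht, by rw [hb, e, translation_conj h (_ * _)]⟩,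
    geodesic h s, ⟨s, rfl⟩, ⟨0, ?_⟩⟩
  rw [geodesic, geodesic_eq, mul_smul, mul_smul, mul_smul, rotP_smul]

theorem hasAngle_diagP_iff {l : ℝ} (hl : l ≠ 0) {B : SL2R} (h00 : 0 < B 0 0) (h01 : 0 < B 0 1)
    (h10 : 0 < B 1 0) (h11 : 0 < B 1 1) (θ : ℝ) :
    HasAngle (diagP l) (B : PSL2R) θ ↔ θ = Real.pi / 2 - Real.arctan (cotAngle B) := by
  rw [hasAngle_iff]
  constructor
  · rintro ⟨hθ, g, m, t, hm, ht, e1, e2⟩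
    have hl1 : diagP l = translation 1 l := by rw [translation_eq]; simp
    rw [hl1] at e1
    obtain ⟨s, t', e3⟩ : ∃ s t', (B : PSL2R) = translation (diagP s * rotP θ) t' := by
      obtain ⟨s, hs | hs⟩ := eq_of_translation_eq hl e1
      · exact ⟨s, t, by rw [e2, hs, one_mul]⟩
      -- The frame may point the other way along the first axis. The half turn commutes with the
      -- rotation by `θ`, so it reverses the second axis as well and `θ` is unchanged.
      · refine ⟨s, -t, ?_⟩
        rw [e2, hs, one_mul, ← translation_mul_revP, mul_assoc, mul_assoc, revP, ← rotP_add,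
          ← rotP_add, add_comm]
    have hsin : 0 < Real.sin θ := Real.sin_pos_of_pos_of_lt_pi hθ.1 hθ.2
    have hκ : cotAngle B = Real.tan (Real.pi / 2 - θ) := by
      rw [translation_diagP_rotP] at e3
      set C := mkSL (Real.cosh (t' / 2) + Real.cos θ * Real.sinh (t' / 2))
        (-(Real.exp s * Real.sin θ * Real.sinh (t' / 2)))
        (-(Real.exp (-s) * Real.sin θ * Real.sinh (t' / 2)))
        (Real.cosh (t' / 2) - Real.cos θ * Real.sinh (t' / 2)) _ with hC
      have hCB : C = B := by
        rcases mk_eq_mk_iff.mp e3 with h | h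
        · exact h
        · exfalso
          have f0 : C 0 0 = - B 0 0 := by rw [h]; simp
          have f1 : C 1 1 = - B 1 1 := by rw [h]; simp
          rw [hC, mkSL_00] at f0
          rw [hC, mkSL_11] at f1
          have := Real.cosh_pos (t' / 2)
          linarith
      rw [← hCB] at h00 h01 h10 h11 ⊢
      rw [cotAngle, abs_of_pos h00, abs_of_pos h11]
      rw [hC] at h00 h01 h10 h11 ⊢
      simp only [mkSL_00, mkSL_01, mkSL_10, mkSL_11] at h00 h01 h10 h11 ⊢
      have hsh : Real.sinh (t' / 2) < 0 := by
        by_contra! hcon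
        have : 0 ≤ Real.exp s * Real.sin θ * Real.sinh (t' / 2) := by positivity
        linarith
      have h3 : Real.exp s * Real.exp (-s) = 1 := by rw [← Real.exp_add]; simp
      have e : -(Real.exp s * Real.sin θ * Real.sinh (t' / 2)) *
        -(Real.exp (-s) * Real.sin θ * Real.sinh (t' / 2)) =
          (Real.sin θ * -Real.sinh (t' / 2)) ^ 2 := by
        linear_combination (Real.sin θ * Real.sinh (t' / 2)) ^ 2 * h3
      rw [e, Real.sqrt_sq (by apply mul_nonneg <;> linarith), Real.tan_eq_sin_div_cos,
        Real.sin_pi_div_two_sub, Real.cos_pi_div_two_sub]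
      have := hsh.ne
      field_simp
      ring
    rw [hκ, Real.arctan_tan (by linarith [hθ.2]) (by linarith [hθ.1])]
    ring
  · rintro rfl
    obtain ⟨s, t, ht, e⟩ := exists_translation_of_pos h00 h01 h10 h11
    refine ⟨⟨?_, ?_⟩, diagP s, l, t, hl, ht, ?_, e⟩
    · linarith [Real.arctan_lt_pi_div_two (cotAngle B)]
    · linarith [Real.neg_pi_div_two_lt_arctan (cotAngle B)]
    · rw [translation_eq, diagP_comm s l]; group

/-! ### Discrete cocompact groups -/

theorem dist_smul_smul' (g : PSL2R) (x y : ℍ) : dist (g • x) (g • y) = dist x y :=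
  dist_smul g x y

/-- The orbit map of SL(2, ℝ) at i is proper, so these elements lie in a compact set; a discrete
subgroup is closed and meets it in a finite set. -/
theorem finite_setOf_dist_le {Γ : Subgroup PSL2R} (hΓ : DiscreteTopology Γ) (z : ℍ) (R : ℝ) :
    {g : PSL2R | g ∈ Γ ∧ dist z (g • z) ≤ R}.Finite := by
  set R' := R + 2 * dist UpperHalfPlane.I z
  have hK : IsCompact ((fun A : SL2R => A • UpperHalfPlane.I) ⁻¹'
      Metric.closedBall UpperHalfPlane.I R') :=
    UpperHalfPlane.isProperMap_smul_I.isCompact_preimage (isCompact_closedBall _ _)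
  have hK' := hK.image continuous_mk
  have hcl : IsClosed (Γ : Set PSL2R) := Subgroup.isClosed_of_discrete
  have hfin : ((QuotientGroup.mk '' ((fun A : SL2R => A • UpperHalfPlane.I) ⁻¹'
      Metric.closedBall UpperHalfPlane.I R')) ∩ (Γ : Set PSL2R) : Set PSL2R).Finite := by
    refine (hK'.inter_right hcl).finite ?_
    have : IsDiscrete (Γ : Set PSL2R) := ⟨hΓ⟩
    exact this.mono Set.inter_subset_right
  refine hfin.subset ?_
  rintro g ⟨hg, hd⟩
  refine ⟨?_, hg⟩
  obtain ⟨A, rfl⟩ := exists_mk g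
  refine ⟨A, ?_, rfl⟩
  rw [Set.mem_preimage, Metric.mem_closedBall, dist_comm]
  change dist UpperHalfPlane.I ((A : PSL2R) • UpperHalfPlane.I) ≤ R'
  have h1 := dist_triangle4 UpperHalfPlane.I z ((A : PSL2R) • z) ((A : PSL2R) • UpperHalfPlane.I)
  rw [dist_smul_smul', dist_comm z UpperHalfPlane.I] at h1
  simp only [R']; linarith

theorem isOpenMap_proj (Γ : Subgroup PSL2R) : IsOpenMap (proj Γ) :=
  isOpenMap_quotient_mk'_mul (Γ := Γ) (T := ℍ)

theorem continuous_proj (Γ : Subgroup PSL2R) : Continuous (proj Γ) := continuous_quotient_mk'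

theorem proj_eq_iff {Γ : Subgroup PSL2R} {z w : ℍ} : proj Γ z = proj Γ w ↔ ∃ g ∈ Γ, g • w = z := by
  rw [proj, proj, Quotient.eq, MulAction.orbitRel_apply, MulAction.mem_orbit_iff]
  constructor
  · rintro ⟨g, hg⟩; exact ⟨g, g.2, hg⟩
  · rintro ⟨g, hg, h⟩; exact ⟨⟨g, hg⟩, h⟩

theorem exists_dist_le {Γ : Subgroup PSL2R} (hΓ : CompactSpace (Surface Γ)) (x₀ : ℍ) :
    ∃ D : ℝ, ∀ z : ℍ, ∃ g ∈ Γ, dist z (g • x₀) ≤ D := by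
  have hcov : (Set.univ : Set (Surface Γ)) ⊆ ⋃ n : ℕ, proj Γ '' Metric.ball x₀ n := by
    rintro p -
    obtain ⟨z, rfl⟩ := Quotient.mk_surjective p
    obtain ⟨n, hn⟩ := exists_nat_gt (dist z x₀)
    exact Set.mem_iUnion.mpr ⟨n, z, hn, rfl⟩
  obtain ⟨n, hn⟩ := isCompact_univ.elim_directed_cover _
    (fun n : ℕ => isOpenMap_proj Γ _ Metric.isOpen_ball) hcov
    (directed_of_isDirected_le fun m n hmn =>
      Set.image_mono (Metric.ball_subset_ball (by exact_mod_cast hmn)))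
  refine ⟨n, fun z => ?_⟩
  obtain ⟨w, hw, e⟩ := hn (Set.mem_univ (proj Γ z))
  obtain ⟨g, hg, rfl⟩ := proj_eq_iff.mp e.symm
  refine ⟨g, hg, ?_⟩
  rw [dist_smul_smul']
  exact (Metric.mem_ball.mp hw).le

theorem compactSpace_of_exists_dist_le {Γ : Subgroup PSL2R} {x₀ : ℍ} {D : ℝ}
    (h : ∀ z : ℍ, ∃ g ∈ Γ, dist z (g • x₀) ≤ D) : CompactSpace (Surface Γ) := by
  have hK : IsCompact (proj Γ '' Metric.closedBall x₀ D) :=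
    (isCompact_closedBall x₀ D).image (continuous_proj Γ)
  refine ⟨hK.of_isClosed_subset isClosed_univ ?_⟩
  rintro p -
  obtain ⟨z, rfl⟩ := Quotient.mk_surjective p
  obtain ⟨g, hg, hd⟩ := h z
  refine ⟨g⁻¹ • z, ?_, ?_⟩
  · rw [Metric.mem_closedBall, ← dist_smul_smul' g, smul_inv_smul]; exact hd
  · exact proj_eq_iff.mpr ⟨g⁻¹, Γ.inv_mem hg, rfl⟩

theorem exists_pos_forall_of_finite {α : Type*} {P : ℝ → α → Prop} {S : Set α} (hS : S.Finite)
    (h : ∀ x ∈ S, ∃ δ > 0, P δ x) (hP : ∀ x, ∀ δ δ' : ℝ, δ ≤ δ' → P δ' x → P δ x) :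
    ∃ δ > 0, ∀ x ∈ S, P δ x := by
  have h' : ∀ᶠ δ : ℝ in 𝓝[>] 0, ∀ x ∈ S, P δ x := by
    rw [Filter.eventually_all_finite hS]
    intro x hx
    obtain ⟨δ, hδ, hp⟩ := h x hx
    filter_upwards [Ioc_mem_nhdsGT hδ] with ε hε
    exact hP x ε δ hε.2 hp
  obtain ⟨δ, h1, h2⟩ := (h'.and self_mem_nhdsWithin).exists
  exact ⟨δ, h2, h1⟩

/-- Conjugation brings the point into a compact ball by cocompactness. Only finitely many elements
move a point of this ball by less than 1, and each nontrivial one, having no fixed point, has a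
positive minimal displacement there. -/
theorem exists_le_dist_smul {Γ : Subgroup PSL2R} (hΓ : IsClosedSurfaceGroup Γ) :
    ∃ ε > 0, ∀ g ∈ Γ, g ≠ 1 → ∀ z : ℍ, ε ≤ dist z (g • z) := by
  set x₀ := UpperHalfPlane.I
  obtain ⟨D, hD⟩ := exists_dist_le hΓ.cocompact x₀
  -- An element that moves a point of the ball of radius D by at most 1 moves its centre by at most
  -- 2D + 1.
  have hfin := finite_setOf_dist_le hΓ.discrete x₀ (2 * D + 1)
  have hpos : ∀ g ∈ Γ, g ≠ 1 → ∃ ε > 0, ∀ z ∈ Metric.closedBall x₀ D, ε ≤ dist z (g • z) := by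
    intro g hg hg1
    have hc : Continuous fun z : ℍ => dist z (g • z) :=
      continuous_id.dist (continuous_const_smul g)
    rcases (Metric.closedBall x₀ D).eq_empty_or_nonempty with he | hne
    · exact ⟨1, one_pos, by simp [he]⟩
    · obtain ⟨w, -, hmin⟩ := (isCompact_closedBall x₀ D).exists_isMinOn hne hc.continuousOn
      refine ⟨dist w (g • w), ?_, fun z hz => hmin hz⟩
      rw [gt_iff_lt, dist_pos]
      intro h
      exact hg1 (hΓ.free g hg w h.symm)
  choose! ε hε0 hε using hpos
  obtain ⟨δ, hδ0, hδ⟩ := exists_pos_forall_of_finite (P := fun δ g => g ≠ 1 → δ ≤ ε g) hfin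
    (fun g hg => by
      by_cases hg1 : g = 1
      · exact ⟨1, one_pos, fun h => absurd hg1 h⟩
      · exact ⟨ε g, hε0 g hg.1 hg1, fun _ => le_rfl⟩)
    (fun g δ δ' hle h hg1 => hle.trans (h hg1))
  refine ⟨min δ 1, lt_min hδ0 one_pos, fun g hg hg1 z => ?_⟩
  obtain ⟨k, hk, hd⟩ := hD z
  set w := k⁻¹ • z with hw
  have hz : z = k • w := by rw [hw, smul_inv_smul]
  have hwx : dist w x₀ ≤ D := by rw [← dist_smul_smul' k, ← hz]; exact hd
  set g' := k⁻¹ * g * k with hg'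
  have hg'Γ : g' ∈ Γ := Γ.mul_mem (Γ.mul_mem (Γ.inv_mem hk) hg) hk
  have hg'1 : g' ≠ 1 := by
    intro h
    apply hg1
    have : g = k * g' * k⁻¹ := by rw [hg']; group
    rw [this, h]; group
  have hdist : dist z (g • z) = dist w (g' • w) := by
    rw [← dist_smul_smul' k w, ← hz, hg', mul_smul, mul_smul, ← hz, smul_inv_smul]
  rw [hdist]
  by_cases hmem : g' ∈ {g : PSL2R | g ∈ Γ ∧ dist x₀ (g • x₀) ≤ 2 * D + 1}
  · exact (min_le_left _ _).trans ((hδ g' hmem hg'1).trans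
      (hε g' hg'Γ hg'1 w (Metric.mem_closedBall.mpr hwx)))
  · refine (min_le_right _ _).trans ?_
    by_contra! hcon
    apply hmem
    refine ⟨hg'Γ, ?_⟩
    have h1 := dist_triangle4 x₀ w (g' • w) (g' • x₀)
    rw [dist_smul_smul', dist_comm x₀ w] at h1
    linarith

/-! ### Elements of closed surface groups are hyperbolic -/

theorem sinh_half_dist_smul (A : SL2R) (z : ℍ) : Real.sinh (dist z ((A : PSL2R) • z) / 2) =
    ‖(A 1 0 * z ^ 2 + (A 1 1 - A 0 0) * z - A 0 1 : ℂ)‖ / (2 * z.im) := by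
  have hne := denom_ne_zero A z
  have hn : 0 < ‖(A 1 0 * z + A 1 1 : ℂ)‖ := norm_pos_iff.mpr hne
  rw [UpperHalfPlane.sinh_half_dist, im_mk_smul, ← Complex.sq_norm, Complex.dist_eq, coe_mk_smul]
  have e1 : z.im * (z.im / ‖(A 1 0 * z + A 1 1 : ℂ)‖ ^ 2) =
      (z.im / ‖(A 1 0 * z + A 1 1 : ℂ)‖) ^ 2 := by field_simp
  have e2 : (z : ℂ) - (A 0 0 * z + A 0 1) / (A 1 0 * z + A 1 1) =
      (A 1 0 * z ^ 2 + (A 1 1 - A 0 0) * z - A 0 1 : ℂ) / (A 1 0 * z + A 1 1) := by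
    rw [eq_div_iff hne, sub_mul, div_mul_cancel₀ _ hne]; ring
  rw [e1, Real.sqrt_sq (div_nonneg z.im_pos.le hn.le), e2, norm_div]
  have := z.im_pos
  field_simp

/-- Non-hyperbolic elements have arbitrarily small displacement. The test point is high up when ∞ is
fixed; otherwise it lies slightly above the fixed point, which has height √m/|A10| in the closed
half plane. -/
theorem exists_sinh_half_dist_le {A : SL2R}
    (ht : (A 0 0 + A 1 1) ^ 2 ≤ 4) {η : ℝ} (hη : 0 < η) :
    ∃ z : ℍ, Real.sinh (dist z ((A : PSL2R) • z) / 2) ≤ η := by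
  have hdet := A.det_eq
  rcases eq_or_ne (A 1 0) 0 with hc | hc
  · have had : (A 1 1 - A 0 0) = 0 := by
      rw [hc, mul_zero, sub_zero] at hdet
      have : (A 1 1 - A 0 0) ^ 2 = 0 := by nlinarith [sq_nonneg (A 1 1 - A 0 0)]
      simpa using this
    have hy : 0 < (|A 0 1| + 1) / η := by positivity
    refine ⟨⟨⟨0, (|A 0 1| + 1) / η⟩, hy⟩, ?_⟩
    have had' : (A 1 1 - A 0 0 : ℂ) = 0 := by exact_mod_cast had
    rw [sinh_half_dist_smul, hc, had']
    simp only [Complex.ofReal_zero, zero_mul, zero_add, zero_sub, norm_neg, Complex.norm_real,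
      Real.norm_eq_abs]
    change |A 0 1| / (2 * ((|A 0 1| + 1) / η)) ≤ η
    rw [div_le_iff₀ (by positivity)]
    have : η * (2 * ((|A 0 1| + 1) / η)) = 2 * (|A 0 1| + 1) := by field_simp
    rw [this]
    have := abs_nonneg (A 0 1)
    linarith
  · set m := (4 - (A 0 0 + A 1 1) ^ 2) / 4 with hm
    have hm0 : 0 ≤ m := by rw [hm]; linarith
    set r := √(m + η ^ 2) with hr
    have hr2 : r ^ 2 = m + η ^ 2 := Real.sq_sqrt (by positivity)
    have hr0 : 0 < r := Real.sqrt_pos.mpr (by positivity)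
    have hrη : η ≤ r := Real.le_sqrt_of_sq_le (by linarith)
    have hca : 0 < |A 1 0| := abs_pos.mpr hc
    have hy : 0 < r / |A 1 0| := by positivity
    refine ⟨⟨⟨(A 0 0 - A 1 1) / (2 * A 1 0), r / |A 1 0|⟩, hy⟩, ?_⟩
    rw [sinh_half_dist_smul]
    have e : (A 1 0 * (⟨(A 0 0 - A 1 1) / (2 * A 1 0), r / |A 1 0|⟩ : ℂ) ^ 2 +
        (A 1 1 - A 0 0) * (⟨(A 0 0 - A 1 1) / (2 * A 1 0), r / |A 1 0|⟩ : ℂ) - A 0 1 : ℂ) =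
        ((-η ^ 2 / A 1 0 : ℝ) : ℂ) := by
      have hY : A 1 0 * A 1 0 * (r / |A 1 0| * (r / |A 1 0|)) = m + η ^ 2 := by
        rw [div_mul_div_comm, ← sq, ← sq, ← sq, hr2, sq_abs]; field_simp
      have hX : 2 * A 1 0 * ((A 0 0 - A 1 1) / (2 * A 1 0)) = A 0 0 - A 1 1 := by field_simp
      rw [hm] at hY
      generalize (A 0 0 - A 1 1) / (2 * A 1 0) = X at *
      generalize r / |A 1 0| = Y at *
      apply Complex.ext
      · simp only [sq, Complex.sub_re, Complex.add_re, Complex.mul_re, Complex.ofReal_re,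
          Complex.ofReal_im, Complex.mul_im, Complex.sub_im]
        rw [eq_div_iff hc]
        linear_combination (1 / 4) * (2 * A 1 0 * X - (A 0 0 - A 1 1)) * hX - hY + hdet
      · simp only [sq, Complex.sub_im, Complex.add_im, Complex.mul_im, Complex.ofReal_re,
          Complex.ofReal_im, Complex.mul_re, Complex.sub_re]
        linear_combination Y * hX
    change ‖(A 1 0 * (⟨(A 0 0 - A 1 1) / (2 * A 1 0), r / |A 1 0|⟩ : ℂ) ^ 2 +
        (A 1 1 - A 0 0) * (⟨(A 0 0 - A 1 1) / (2 * A 1 0), r / |A 1 0|⟩ : ℂ) - A 0 1 : ℂ)‖ /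
        (2 * (r / |A 1 0|)) ≤ η
    rw [e, Complex.norm_real, Real.norm_eq_abs, abs_div, abs_neg, abs_of_nonneg (sq_nonneg η),
      div_le_iff₀ (by positivity), div_le_iff₀ hca]
    have : η * (2 * (r / |A 1 0|)) * |A 1 0| = 2 * (η * r) := by field_simp
    rw [this]
    nlinarith

theorem isAxis_of_mul_eq {A P : SL2R} {l : ℝ} (hl : l ≠ 0) (h : A * P = P * diagMatrix l) :
    IsAxis (A : PSL2R) (P : PSL2R) := by
  refine ⟨l, hl, ?_⟩
  rw [translation, ← mk_inv, ← mk_mul, ← mk_mul, ← h, mul_inv_cancel_right]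

theorem exists_isAxis_of_trace_gt {A : SL2R} (ht : 4 < (A 0 0 + A 1 1) ^ 2) :
    ∃ h, IsAxis (A : PSL2R) h := by
  have key : ∀ B : SL2R, 2 < B 0 0 + B 1 1 → ∃ h, IsAxis (B : PSL2R) h := by
    intro B ht
    have hdet := B.det_eq
    set t := B 0 0 + B 1 1 with htd
    set r := √(t ^ 2 - 4) with hr
    have hr2 : r ^ 2 = t ^ 2 - 4 := Real.sq_sqrt (by nlinarith)
    have hr0 : 0 < r := Real.sqrt_pos.mpr (by nlinarith)
    set x := (t + r) / 2 with hx
    set y := (t - r) / 2 with hy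
    have hxy : x * y = 1 := by rw [hx, hy]; linear_combination (-1 / 4) * hr2
    have hxs : x + y = B 0 0 + B 1 1 := by rw [hx, hy]; ring
    have hxd : 0 < x - y := by rw [hx, hy]; linarith
    have hx1 : 1 < x := by rw [hx]; linarith
    have hl : (2 * Real.log x) ≠ 0 := mul_ne_zero two_ne_zero (Real.log_pos hx1).ne'
    have el : 2 * Real.log x / 2 = Real.log x := by ring
    have e1 : Real.exp (2 * Real.log x / 2) = x := by rw [el, Real.exp_log (by linarith)]
    have e2 : Real.exp (-(2 * Real.log x / 2)) = y := by
      rw [el, Real.exp_neg, Real.exp_log (by linarith)]; exact inv_eq_of_mul_eq_one_right hxy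
    have hx2 : x ^ 2 - x * (B 0 0 + B 1 1) + 1 = 0 := by rw [← hxs]; linear_combination hxy * (-1)
    have hy2 : y ^ 2 - y * (B 0 0 + B 1 1) + 1 = 0 := by rw [← hxs]; linear_combination hxy * (-1)
    rcases eq_or_ne (B 1 0) 0 with hc | hc
    · rcases eq_or_ne (B 0 1) 0 with hb | hb
      · obtain ⟨s, hs⟩ := exists_diagP hb hc
        refine ⟨1, s, ?_, by rw [hs, translation_eq]; group⟩
        rintro rfl
        rw [diagP_zero, ← mk_one] at hs
        rcases mk_eq_mk_iff.mp hs with h | h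
        · have h0 := congrArg (fun M : SL2R => M 0 0) h
          have h1 := congrArg (fun M : SL2R => M 1 1) h
          simp only [SL2R.one_00, SL2R.one_11] at h0 h1
          linarith
        · have h0 := congrArg (fun M : SL2R => M 0 0) h
          have h1 := congrArg (fun M : SL2R => M 1 1) h
          simp only [SL2R.one_00, SL2R.one_11, Matrix.SpecialLinearGroup.coe_neg,
            Matrix.neg_apply] at h0 h1
          linarith
      · obtain ⟨u, hu⟩ : ∃ u, u * (B 0 1 * (y - x)) = 1 :=
          ⟨_, inv_mul_cancel₀ (mul_ne_zero hb (by linarith))⟩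
        clear_value x y
        refine ⟨_, isAxis_of_mul_eq (P := mkSL (B 0 1 * u) (B 0 1) ((x - B 0 0) * u) (y - B 0 0)
          (by linear_combination hu)) hl ?_⟩
        apply SL2R.ext' <;> simp only [SL2R.mul_00, SL2R.mul_01, SL2R.mul_10, SL2R.mul_11,
          mkSL_00, mkSL_01, mkSL_10, mkSL_11, diagMatrix_00, diagMatrix_01, diagMatrix_10,
          diagMatrix_11, e1, e2]
        · ring
        · ring
        · linear_combination (-u) * hx2 - u * hdet
        · linear_combination (-1) * hy2 - hdet
    -- The columns of the conjugating matrix are eigenvectors for the eigenvalues x and y; `u`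
    -- rescales the first one to make the determinant 1.
    · obtain ⟨u, hu⟩ : ∃ u, u * (B 1 0 * (x - y)) = 1 :=
        ⟨_, inv_mul_cancel₀ (mul_ne_zero hc (by linarith))⟩
      clear_value x y
      refine ⟨_, isAxis_of_mul_eq (P := mkSL ((x - B 1 1) * u) (y - B 1 1) (B 1 0 * u) (B 1 0)
        (by linear_combination hu)) hl ?_⟩
      apply SL2R.ext' <;> simp only [SL2R.mul_00, SL2R.mul_01, SL2R.mul_10, SL2R.mul_11,
        mkSL_00, mkSL_01, mkSL_10, mkSL_11, diagMatrix_00, diagMatrix_01, diagMatrix_10,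
        diagMatrix_11, e1, e2]
      · linear_combination (-u) * hx2 - u * hdet
      · linear_combination (-1) * hy2 - hdet
      · ring
      · ring
  rcases lt_or_ge 0 (A 0 0 + A 1 1) with h | h
  · exact key A (by nlinarith)
  · rw [← mk_neg]
    apply key
    simp only [Matrix.SpecialLinearGroup.coe_neg, Matrix.neg_apply]
    nlinarith

theorem exists_isAxis {Γ : Subgroup PSL2R} (hΓ : IsClosedSurfaceGroup Γ) {g : PSL2R} (hg : g ∈ Γ)
    (h1 : g ≠ 1) : ∃ h, IsAxis g h := by
  obtain ⟨A, rfl⟩ := exists_mk g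
  refine exists_isAxis_of_trace_gt ?_
  by_contra! hcon
  obtain ⟨ε, hε, H⟩ := exists_le_dist_smul hΓ
  have hpos : 0 < Real.sinh (ε / 2) := Real.sinh_pos_iff.mpr (by linarith)
  obtain ⟨z, hz⟩ := exists_sinh_half_dist_le (A := A) hcon (η := Real.sinh (ε / 2) / 2) (by linarith)
  have := H _ hg h1 z
  have : Real.sinh (ε / 2) ≤ Real.sinh (dist z ((A : PSL2R) • z) / 2) :=
    Real.sinh_le_sinh.mpr (by linarith)
  linarith

theorem translation_eq_one_iff {h : PSL2R} {t : ℝ} : translation h t = 1 ↔ t = 0 := by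
  constructor
  · intro H
    have h1 := translation_smul_geodesic h t 0
    rw [H, one_smul, add_zero] at h1
    have := dist_geodesic h 0 t
    rw [← h1, dist_self] at this
    simpa using this.symm
  · rintro rfl; simp

theorem not_isAxis_one (h : PSL2R) : ¬ IsAxis 1 h := by
  rintro ⟨l, hl, e⟩
  exact hl (translation_eq_one_iff.mp e.symm)

theorem eq_one_of_pow_eq_one {Γ : Subgroup PSL2R} (hΓ : IsClosedSurfaceGroup Γ) {g : PSL2R}
    (hg : g ∈ Γ) {n : ℕ} (hn : n ≠ 0) (h : g ^ n = 1) : g = 1 := by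
  by_contra h1
  obtain ⟨k, l, hl, rfl⟩ := exists_isAxis hΓ hg h1
  have := translation_zpow k l n
  rw [zpow_natCast, h, eq_comm, translation_eq_one_iff] at this
  rcases mul_eq_zero.mp this with h2 | h2
  · exact hn (by exact_mod_cast h2)
  · exact hl h2

theorem IsAxis.trace_gt {A : SL2R} {h : PSL2R} (H : IsAxis (A : PSL2R) h) :
    4 < (A 0 0 + A 1 1) ^ 2 := by
  obtain ⟨l, hl, e⟩ := H
  obtain ⟨P, rfl⟩ := exists_mk h
  rw [translation, ← mk_inv, ← mk_mul, ← mk_mul] at e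
  have hdet := P.det_eq
  have e1 : (P * diagMatrix l * P⁻¹) 0 0 + (P * diagMatrix l * P⁻¹) 1 1 =
      Real.exp (l / 2) + Real.exp (-(l / 2)) := by
    simp only [SL2R.mul_00, SL2R.mul_01, SL2R.mul_10, SL2R.mul_11, SL2R.inv_00,
      SL2R.inv_01, SL2R.inv_10, SL2R.inv_11, diagMatrix_00, diagMatrix_01, diagMatrix_10,
      diagMatrix_11]
    linear_combination (Real.exp (l / 2) + Real.exp (-(l / 2))) * hdet
  have h3 : Real.exp (l / 2) * Real.exp (-(l / 2)) = 1 := by rw [← Real.exp_add]; simp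
  have h4 : 0 < (Real.exp (l / 2) - Real.exp (-(l / 2))) ^ 2 := by
    have := exp_half_sub_ne_zero hl
    positivity
  have h5 : (A 0 0 + A 1 1) ^ 2 = (Real.exp (l / 2) + Real.exp (-(l / 2))) ^ 2 := by
    rw [← e1]
    rcases mk_eq_mk_iff.mp e with h | h <;> rw [h]
    simp only [Matrix.SpecialLinearGroup.coe_neg, Matrix.neg_apply]; ring
  rw [h5]; nlinarith

/-- A nontrivial commutator is hyperbolic, hence its trace cannot be 2. -/
theorem commute_of_commTrace_eq_two {Γ : Subgroup PSL2R} (hΓ : IsClosedSurfaceGroup Γ)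
    {g h : PSL2R} (hg : g ∈ Γ) (hh : h ∈ Γ) (H : commTrace g h = 2) : g * h = h * g := by
  by_contra hne
  have h1 : g * h * g⁻¹ * h⁻¹ ≠ 1 := by
    intro h1
    rw [mul_inv_eq_one, mul_inv_eq_iff_eq_mul] at h1
    exact hne h1
  obtain ⟨k, hk⟩ := exists_isAxis hΓ
    (Γ.mul_mem (Γ.mul_mem (Γ.mul_mem hg hh) (Γ.inv_mem hg)) (Γ.inv_mem hh)) h1
  obtain ⟨A, rfl⟩ := exists_mk g
  obtain ⟨B, rfl⟩ := exists_mk h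
  rw [commTrace_mk, slCommTrace, Matrix.trace_fin_two] at H
  rw [← mk_inv, ← mk_inv, ← mk_mul, ← mk_mul, ← mk_mul] at hk
  have := hk.trace_gt
  rw [H] at this
  norm_num at this

/-- `b` preserves the axis of `a`. If it preserves the orientation it is a translation along this
axis; if it reverses it, its square is trivial, which no hyperbolic element allows. -/
theorem line_eq_of_commute {a b h k : PSL2R} (ha : IsAxis a h) (hb : IsAxis b k)
    (hab : a * b = b * a) : line h = line k := by
  obtain ⟨l, hl, rfl⟩ := ha
  have h1 : translation h l = translation (b * h) l := by
    rw [translation_conj, ← hab, mul_inv_cancel_right]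
  obtain ⟨s, hs | hs⟩ := eq_of_translation_eq hl h1
  · have hb' : b = translation h s := by rw [translation_eq, ← hs]; group
    have hs0 : s ≠ 0 := by
      rintro rfl
      rw [translation_zero] at hb'
      exact not_isAxis_one k (hb' ▸ hb)
    exact line_eq_of_isAxis ⟨s, hs0, hb'⟩ hb
  · exfalso
    have hb2 : b ^ 2 = 1 := by
      have e : b = h * diagP s * revP * h⁻¹ := by rw [← hs]; group
      have e2 : diagP s * revP * (diagP s * revP) = 1 := by
        have := revP_conj_diagP s
        calc diagP s * revP * (diagP s * revP) = diagP s * (revP * diagP s * revP⁻¹) *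
              (revP * revP) := by group
          _ = 1 := by rw [this, revP_mul_self, diagP_neg]; group
      calc b ^ 2 = h * (diagP s * revP * (diagP s * revP)) * h⁻¹ := by rw [sq, e]; group
        _ = 1 := by rw [e2]; group
    obtain ⟨m, hm, rfl⟩ := hb
    have := translation_zpow k m 2
    rw [show ((2 : ℤ)) = ((2 : ℕ) : ℤ) by rfl, zpow_natCast, hb2, eq_comm,
      translation_eq_one_iff] at this
    simp at this
    exact hm this

/-! ### Deformations -/

theorem mem_fuchsianMaps_iff {Γ : Subgroup PSL2R} {ρ : Γ →* PSL2R} :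
    ⇑ρ ∈ fuchsianMaps Γ ↔ Function.Injective ρ ∧ IsClosedSurfaceGroup ρ.range := by
  constructor
  · rintro ⟨ρ', h, h1, h2⟩
    rw [← DFunLike.coe_injective h]
    exact ⟨h1, h2⟩
  · rintro ⟨h1, h2⟩
    exact ⟨ρ, rfl, h1, h2⟩

theorem subtype_mem_fuchsianMaps {Γ : Subgroup PSL2R} (hΓ : IsClosedSurfaceGroup Γ) :
    (fun g : Γ => (g : PSL2R)) ∈ fuchsianMaps Γ :=
  ⟨Γ.subtype, rfl, Γ.subtype_injective, by rwa [Subgroup.range_subtype]⟩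

theorem mem_fuchsianMaps_of_mem_teichmuller {Γ : Subgroup PSL2R} {ρ : Γ →* PSL2R}
    (hρ : ρ ∈ teichmuller Γ) : ⇑ρ ∈ fuchsianMaps Γ := connectedComponentIn_subset _ _ hρ

theorem commTrace_ne_two {Γ : Subgroup PSL2R} {f : Γ → PSL2R} (hf : f ∈ fuchsianMaps Γ) {x y : Γ}
    (hxy : x * y ≠ y * x) : commTrace (f x) (f y) ≠ 2 := by
  obtain ⟨ρ, rfl, h1, h2⟩ := hf
  intro h
  have := commute_of_commTrace_eq_two h2 ⟨x, rfl⟩ ⟨y, rfl⟩ h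
  rw [← map_mul, ← map_mul] at this
  exact hxy (h1 this)

/-- Crossing persists under deformation: the commutator trace varies continuously and, for
noncommuting elements, never takes the value 2. -/
theorem commTrace_lt_two_of_isPreconnected {Γ : Subgroup PSL2R} {S : Set (Γ → PSL2R)}
    (hS : IsPreconnected S) (hSF : S ⊆ fuchsianMaps Γ) {f g : Γ → PSL2R} (hf : f ∈ S) (hg : g ∈ S)
    {x y : Γ} (hxy : x * y ≠ y * x) (h : commTrace (f x) (f y) < 2) :
    commTrace (g x) (g y) < 2 := by
  have hx : Continuous fun f : Γ → PSL2R => f x := continuous_apply x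
  have hy : Continuous fun f : Γ → PSL2R => f y := continuous_apply y
  have hxy' : Continuous fun f : Γ → PSL2R => (f x, f y) := hx.prodMk hy
  have hcont : ContinuousOn (fun f : Γ → PSL2R => commTrace (f x) (f y)) S :=
    (continuous_commTrace.comp hxy').continuousOn
  by_contra! hcon
  have hi := hS.intermediate_value hf hg hcont
  obtain ⟨k, hk, h2⟩ := hi (show (2 : ℝ) ∈ Set.Icc _ _ from ⟨h.le, hcon⟩)
  exact commTrace_ne_two (hSF hk) hxy h2

theorem commTrace_lt_two_iff {Γ : Subgroup PSL2R} (hΓ : IsClosedSurfaceGroup Γ) {ρ : Γ →* PSL2R}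
    (hρ : ρ ∈ teichmuller Γ) {x y : Γ} (hxy : x * y ≠ y * x) :
    commTrace (ρ x) (ρ y) < 2 ↔ commTrace (x : PSL2R) (y : PSL2R) < 2 :=
  have hmem := mem_connectedComponentIn (subtype_mem_fuchsianMaps hΓ)
  ⟨commTrace_lt_two_of_isPreconnected (g := fun g : Γ => (g : PSL2R))
      isPreconnected_connectedComponentIn (connectedComponentIn_subset _ _) hρ hmem hxy,
    commTrace_lt_two_of_isPreconnected (f := fun g : Γ => (g : PSL2R))
      isPreconnected_connectedComponentIn (connectedComponentIn_subset _ _) hmem hρ hxy⟩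

/-! ### The lifts of a simple closed geodesic -/

/-- A common point of the axis and its translate by `g` projects to one point of the simple closed
curve, so its two parameters differ by a multiple of the length. Freeness of the action then makes
`g` a power of `a`. -/
theorem commute_of_mem_line {Γ : Subgroup PSL2R} (hΓ : IsClosedSurfaceGroup Γ) {a : Γ}
    {h : PSL2R} {l : ℝ} (ha : (a : PSL2R) = translation h l)
    (hs : ∀ s t : ℝ, proj Γ (geodesic h s) = proj Γ (geodesic h t) → ∃ n : ℤ, t - s = n * l)
    {g : Γ} {z : ℍ} (hz : z ∈ line h) (hz' : z ∈ line (g * h)) :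
    a * (g * a * g⁻¹) = (g * a * g⁻¹) * a := by
  obtain ⟨t, rfl⟩ := hz
  obtain ⟨s, hst⟩ := hz'
  rw [geodesic_mul] at hst
  obtain ⟨n, hn⟩ := hs t s (proj_eq_iff.mpr ⟨g, g.2, hst⟩)
  have h1 : ((a : PSL2R) ^ n * g) • geodesic h s = geodesic h s := by
    rw [mul_smul, hst, ha, translation_zpow, translation_smul_geodesic, ← hn, sub_add_cancel]
  have h2 := hΓ.free _ (Γ.mul_mem (Γ.zpow_mem a.2 n) g.2) _ h1
  have h3 : g = (a ^ n)⁻¹ := by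
    apply Subtype.ext
    rw [eq_comm, Subgroup.coe_inv, inv_eq_iff_mul_eq_one]
    exact_mod_cast h2
  rw [h3]
  group

/-- Two lifts that meet without coinciding cross. The commutator trace carries this crossing back to
the original surface, where simplicity excludes it. -/
theorem lifts_disjoint {Γ : Subgroup PSL2R} (hΓ : IsClosedSurfaceGroup Γ) {a : Γ}
    (ha : IsSimpleClosedGeodesic Γ a) {ρ : Γ →* PSL2R} (hρ : ρ ∈ teichmuller Γ) {h k : PSL2R}
    (hh : IsLift ρ a h) (hk : IsLift ρ a k) : line h = line k ∨ Disjoint (line h) (line k) := by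
  rw [or_iff_not_imp_right, Set.not_disjoint_iff]
  rintro ⟨z, hz, hz'⟩
  obtain ⟨g, hg⟩ := hh
  obtain ⟨g', hg'⟩ := hk
  by_cases hc : (g * a * g⁻¹) * (g' * a * g'⁻¹) = (g' * a * g'⁻¹) * (g * a * g⁻¹)
  · exact line_eq_of_commute hg hg' (by rw [← map_mul, hc, map_mul])
  · refine (commTrace_lt_or_line_eq hg hg' hz hz').resolve_left fun hlt => hc ?_
    rw [commTrace_lt_two_iff hΓ hρ hc] at hlt
    obtain ⟨h₀, l, hl, e, hs⟩ := ha
    have hax : IsAxis (a : PSL2R) h₀ := ⟨l, hl.ne', e⟩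
    obtain ⟨k', hk', w, hw, hw'⟩ := exists_isAxis_of_commTrace_lt
      (isAxis_conj (g : PSL2R) hax) hlt
    rw [line_eq_of_isAxis hk' (isAxis_conj (g' : PSL2R) hax)] at hw'
    have h1 : (g : PSL2R)⁻¹ • w ∈ line h₀ := by
      rwa [← smul_mem_line_iff (g := (g : PSL2R)), smul_inv_smul]
    have h2 : (g : PSL2R)⁻¹ • w ∈ line (((g⁻¹ * g' : Γ) : PSL2R) * h₀) := by
      rw [← smul_mem_line_iff (g := (g : PSL2R)), smul_inv_smul]
      simpa [← mul_assoc] using hw'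
    have h3 := commute_of_mem_line hΓ e hs h1 h2
    calc g * a * g⁻¹ * (g' * a * g'⁻¹) = g * (a * ((g⁻¹ * g') * a * (g⁻¹ * g')⁻¹)) * g⁻¹ := by
          group
      _ = _ := by rw [h3]; group

theorem commTrace_lt_two_of_mem_axis {Γ : Subgroup PSL2R} (hΓ : IsClosedSurfaceGroup Γ) {a b : Γ}
    {z : ℍ} (hza : z ∈ axis (a : PSL2R)) (hzb : z ∈ axis (b : PSL2R))
    (hab : closedGeodesic Γ a ≠ closedGeodesic Γ b) {ρ : Γ →* PSL2R} (hρ : ρ ∈ teichmuller Γ) :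
    commTrace (ρ a) (ρ b) < 2 := by
  obtain ⟨h, hh, hz⟩ := hza
  obtain ⟨k, hk, hz'⟩ := hzb
  have hne : line h ≠ line k := by
    intro H
    apply hab
    rw [closedGeodesic, closedGeodesic, axis_eq_line hh, axis_eq_line hk, H]
  rw [commTrace_lt_two_iff hΓ hρ]
  · exact (commTrace_lt_or_line_eq hh hk hz hz').resolve_right hne
  · intro hc
    exact hne (line_eq_of_commute hh hk (by exact_mod_cast congrArg Subtype.val hc))

/-! ### Nested families of half spaces -/

/-- The half spaces of the family `𝓗` that contain `y` but not `x`. -/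
def sep {X : Type*} (𝓗 : Set (Set X)) (x y : X) : Set (Set X) := {H | H ∈ 𝓗 ∧ x ∉ H ∧ y ∈ H}

/-- A discrete nested family `𝓗` of half spaces whose boundaries are disjoint from `O`, together
with an element `T H` of a group for each of the half spaces `H`, to be thought of as the
transition between the two sides of the boundary of `H`. -/
structure HalfSpaceSystem {X G : Type*} [Group G] (O : Set X) (𝓗 : Set (Set X)) (T : Set X → G) :
    Prop where
  compl : ∀ H ∈ 𝓗, ∃ H' ∈ 𝓗, (∀ x ∈ O, x ∈ H' ↔ x ∉ H) ∧ T H' = (T H)⁻¹ ∧ Disjoint H H'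
  nested : ∀ H ∈ 𝓗, ∀ K ∈ 𝓗, H ⊆ K ∨ K ⊆ H ∨ Disjoint H K ∨ ∀ x ∈ O, x ∈ H ∨ x ∈ K
  finite_sep : ∀ x y, (sep 𝓗 x y).Finite
  exists_adj : ∀ H ∈ 𝓗, ∃ z ∈ O, ∃ z' ∈ O, z ∉ H ∧ z' ∈ H ∧ ∀ K ∈ 𝓗, z ∉ K → z' ∈ K → K = H

/-- The list `l` enumerates the half spaces that contain `y` but not `x`, in decreasing order. -/
def IsPath {X : Type*} (𝓗 : Set (Set X)) (x y : X) (l : List (Set X)) : Prop :=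
  l.Pairwise (fun H K => K ⊂ H) ∧ ∀ H, H ∈ l ↔ H ∈ sep 𝓗 x y

theorem IsPath.unique {X : Type*} {𝓗 : Set (Set X)} {x y : X} {l l' : List (Set X)}
    (h : IsPath 𝓗 x y l) (h' : IsPath 𝓗 x y l') : l = l' := by
  have n : ∀ {m : List (Set X)}, m.Pairwise (fun H K => K ⊂ H) → m.Nodup := fun hm =>
    hm.imp fun hab => by rintro rfl; exact hab.ne rfl
  refine List.Perm.eq_of_pairwise ?_ h.1 h'.1
    ((List.perm_ext_iff_of_nodup (n h.1) (n h'.1)).mpr fun H => (h.2 H).trans (h'.2 H).symm)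
  intro a b _ _ hab hba
  exact absurd hba hab.asymm

theorem exists_pairwise_list {X : Type*} {S : Set (Set X)} (hS : S.Finite)
    (hc : ∀ H ∈ S, ∀ K ∈ S, H ⊆ K ∨ K ⊆ H) :
    ∃ l : List (Set X), l.Pairwise (fun H K => K ⊂ H) ∧ ∀ H, H ∈ l ↔ H ∈ S := by
  induction hn : S.ncard generalizing S with
  | zero =>
    rw [Set.ncard_eq_zero hS] at hn
    exact ⟨[], List.Pairwise.nil, by simp [hn]⟩
  | succ n ih =>
    have hne : S.Nonempty := by
      rw [Set.nonempty_iff_ne_empty]; rintro rfl; simp at hn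
    obtain ⟨m, hm⟩ := hS.exists_minimal hne
    obtain ⟨l, hl, hl'⟩ := ih (S := S \ {m}) (hS.subset Set.sdiff_subset)
      (fun H hH K hK => hc H hH.1 K hK.1) (by rw [Set.ncard_sdiff_singleton_of_mem hm.1, hn]; rfl)
    refine ⟨l ++ [m], ?_, ?_⟩
    · rw [List.pairwise_append]
      refine ⟨hl, List.pairwise_singleton _ _, ?_⟩
      intro H hH K hK
      rw [List.mem_singleton] at hK
      subst hK
      rw [hl'] at hH
      have hle : K ⊆ H := (hc K hm.1 H hH.1).elim id fun h => hm.2 hH.1 h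
      exact hle.ssubset_of_ne fun h => hH.2 h.symm
    · intro H
      rw [List.mem_append, hl', List.mem_singleton]
      constructor
      · rintro (h | rfl)
        · exact h.1
        · exact hm.1
      · intro h
        by_cases e : H = m
        · exact Or.inr e
        · exact Or.inl ⟨h, e⟩

open Classical in
/-- The decreasing list of the half spaces that contain `y` but not `x`. -/
def path {X : Type*} (𝓗 : Set (Set X)) (x y : X) : List (Set X) :=
  if h : ∃ l, IsPath 𝓗 x y l then h.choose else []

theorem IsPath.path_eq {X : Type*} {𝓗 : Set (Set X)} {x y : X} {l : List (Set X)}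
    (h : IsPath 𝓗 x y l) : path 𝓗 x y = l := by
  have h' : ∃ l, IsPath 𝓗 x y l := ⟨l, h⟩
  rw [path, dif_pos h']
  exact h'.choose_spec.unique h

/-- The product of the transitions along the path from `x` to `y`. -/
def cocycle {X G : Type*} [Group G] (𝓗 : Set (Set X)) (T : Set X → G) (x y : X) : G :=
  ((path 𝓗 x y).map T).prod

/-- The function `E` is constant on the complementary regions, and jumps by `T H` across the
boundary of `H`. -/
structure IsDeveloping {X G : Type*} [Group G] (O : Set X) (𝓗 : Set (Set X)) (T : Set X → G)
    (E : X → G) : Prop where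
  const : ∀ x ∈ O, ∀ y ∈ O, sep 𝓗 x y = ∅ → E x = E y
  jump : ∀ x ∈ O, ∀ y ∈ O, ∀ H, sep 𝓗 x y = {H} → E y = E x * T H

namespace HalfSpaceSystem

variable {X G : Type*} [Group G] {O : Set X} {𝓗 : Set (Set X)} {T : Set X → G}

/-- Half spaces that contain `y` but not `x` are neither disjoint nor covering, so nestedness makes
them a finite chain. -/
theorem isPath_path (hs : HalfSpaceSystem O 𝓗 T) {x : X} (hx : x ∈ O) (y : X) :
    IsPath 𝓗 x y (path 𝓗 x y) := by
  have h' : ∃ l, IsPath 𝓗 x y l := by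
    refine exists_pairwise_list (hs.finite_sep x y) ?_
    rintro H ⟨hH, hxH, hyH⟩ K ⟨hK, hxK, hyK⟩
    rcases hs.nested H hH K hK with h | h | h | h
    · exact Or.inl h
    · exact Or.inr h
    · exact absurd hyK (Set.disjoint_left.mp h hyH)
    · exact absurd (h x hx) (by tauto)
  rw [path, dif_pos h']
  exact h'.choose_spec

theorem eq_of_eq_on (hs : HalfSpaceSystem O 𝓗 T) {H K : Set X} (hH : H ∈ 𝓗) (hK : K ∈ 𝓗)
    (h : ∀ x ∈ O, x ∈ K ↔ x ∈ H) : K = H := by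
  obtain ⟨z, hz, z', hz', h1, h2, h3⟩ := hs.exists_adj H hH
  exact h3 K hK (by rwa [h z hz]) (by rwa [h z' hz'])

theorem sep_eq_empty_symm (hs : HalfSpaceSystem O 𝓗 T) {x y : X} (hx : x ∈ O) (hy : y ∈ O)
    (h : sep 𝓗 x y = ∅) : sep 𝓗 y x = ∅ := by
  rw [Set.eq_empty_iff_forall_notMem] at h ⊢
  rintro H ⟨hH, h1, h2⟩
  obtain ⟨H', hH', h3, -⟩ := hs.compl H hH
  exact h H' ⟨hH', by rw [h3 x hx]; tauto, by rwa [h3 y hy]⟩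

theorem sep_congr_right (hs : HalfSpaceSystem O 𝓗 T) {y z : X} (hy : y ∈ O) (hz : z ∈ O)
    (h : sep 𝓗 y z = ∅) (x : X) : sep 𝓗 x y = sep 𝓗 x z := by
  have h' := hs.sep_eq_empty_symm hy hz h
  rw [Set.eq_empty_iff_forall_notMem] at h h'
  ext H
  constructor
  · rintro ⟨hH, h1, h2⟩
    refine ⟨hH, h1, ?_⟩
    by_contra h3
    exact h' H ⟨hH, h3, h2⟩
  · rintro ⟨hH, h1, h2⟩
    refine ⟨hH, h1, ?_⟩
    by_contra h3
    exact h H ⟨hH, h3, h2⟩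

/-- The two points next to the boundary of the last half space of a path. -/
theorem exists_adj_of_isPath_concat (hs : HalfSpaceSystem O 𝓗 T) {x y : X} (hx : x ∈ O)
    (hy : y ∈ O) {l : List (Set X)} {m : Set X} (h : IsPath 𝓗 x y (l ++ [m])) :
    ∃ z ∈ O, ∃ z' ∈ O, IsPath 𝓗 x z l ∧ sep 𝓗 z z' = {m} ∧ sep 𝓗 z' y = ∅ := by
  obtain ⟨hm, hxm, hym⟩ := (h.2 m).mp (by simp)
  have hpw := List.pairwise_append.mp h.1
  have hlm : ∀ K ∈ l, m ⊂ K := fun K hK => hpw.2.2 K hK m (by simp)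
  obtain ⟨z, hz, z', hz', h1, h2, h3⟩ := hs.exists_adj m hm
  -- The complementary half space of such a `K` contains z' but not z, hence is `m`.
  have hback : ∀ K ∈ 𝓗, z ∈ K → z' ∉ K → ∀ w ∈ O, w ∈ K ↔ w ∉ m := by
    intro K hK hzK hzK' w hw
    obtain ⟨K', hK', hc, -⟩ := hs.compl K hK
    have := h3 K' hK' (by rw [hc z hz]; tauto) (by rwa [hc z' hz'])
    rw [← this, hc w hw, not_not]
  refine ⟨z, hz, z', hz', ⟨hpw.1, fun K => ?_⟩, ?_, ?_⟩
  · constructor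
    · intro hK
      obtain ⟨hK1, hK2, hK3⟩ := (h.2 K).mp (by simp [hK])
      refine ⟨hK1, hK2, ?_⟩
      by_contra hzK
      exact (hlm K hK).ne (h3 K hK1 hzK ((hlm K hK).1 h2)).symm
    · rintro ⟨hK, hxK, hzK⟩
      have hz'K : z' ∈ K := by
        by_contra hcon
        exact hxK ((hback K hK hzK hcon x hx).mpr hxm)
      have hyK : y ∈ K := by
        rcases hs.nested K hK m hm with h4 | h4 | h4 | h4
        · exact absurd (h4 hzK) h1
        · exact h4 hym
        · exact absurd h2 (Set.disjoint_left.mp h4 hz'K)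
        · exact absurd (h4 x hx) (by tauto)
      have := (h.2 K).mpr ⟨hK, hxK, hyK⟩
      rw [List.mem_append, List.mem_singleton] at this
      exact this.resolve_right (by rintro rfl; exact h1 hzK)
  · ext K
    rw [Set.mem_singleton_iff]
    exact ⟨fun hK => h3 K hK.1 hK.2.1 hK.2.2, by rintro rfl; exact ⟨hm, h1, h2⟩⟩
  · rw [Set.eq_empty_iff_forall_notMem]
    rintro K ⟨hK, hz'K, hyK⟩
    rcases hs.nested K hK m hm with h4 | h4 | h4 | h4
    · have := (h.2 K).mpr ⟨hK, fun hxK => hxm (h4 hxK), hyK⟩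
      rw [List.mem_append, List.mem_singleton] at this
      rcases this with h5 | rfl
      · exact (hlm K h5).2 h4
      · exact hz'K h2
    · exact hz'K (h4 h2)
    · exact Set.disjoint_left.mp h4 hyK hym
    · have hzK : z ∈ K := (h4 z hz).resolve_right h1
      exact (hback K hK hzK hz'K y hy).mp hyK hym

/-- Uniqueness: a developing map is determined by its value at one point. The induction peels off
the half space nearest to `y`, whose jump is the last factor of the product. -/
theorem eq_mul_cocycle (hs : HalfSpaceSystem O 𝓗 T) {E : X → G} (hE : IsDeveloping O 𝓗 T E)
    {x y : X} (hx : x ∈ O) (hy : y ∈ O) : E y = E x * cocycle 𝓗 T x y := by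
  have key : ∀ l : List (Set X), ∀ y ∈ O, IsPath 𝓗 x y l → E y = E x * (l.map T).prod := by
    intro l
    induction l using List.reverseRecOn with
    | nil =>
      intro y hy h
      rw [List.map_nil, List.prod_nil, mul_one]
      refine (hE.const x hx y hy ?_).symm
      rw [Set.eq_empty_iff_forall_notMem]
      intro H hH
      simpa using (h.2 H).mpr hH
    | append_singleton l m ih =>
      intro y hy h
      obtain ⟨z, hz, z', hz', h1, h2, h3⟩ := hs.exists_adj_of_isPath_concat hx hy h
      rw [← hE.const z' hz' y hy h3, hE.jump z hz z' hz' m h2, ih z hz h1]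
      simp [mul_assoc]
  exact key _ y hy (hs.isPath_path hx y)

theorem isPath_append (hs : HalfSpaceSystem O 𝓗 T) {x y z : X} (hx : x ∈ O) (hy : y ∈ O)
    (hz : z ∈ O) {H : Set X} (h : sep 𝓗 y z = {H}) (hxH : x ∉ H) :
    IsPath 𝓗 x z (path 𝓗 x y ++ [H]) := by
  have hp := hs.isPath_path hx y
  obtain ⟨hH, hyH, hzH⟩ : H ∈ sep 𝓗 y z := by rw [h]; rfl
  have hzK : ∀ K ∈ sep 𝓗 x y, z ∈ K := by
    rintro K ⟨hK, hxK, hyK⟩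
    by_contra hzK
    obtain ⟨K', hK', hc, -⟩ := hs.compl K hK
    have : K' ∈ sep 𝓗 y z := ⟨hK', by rw [hc y hy]; tauto, by rwa [hc z hz]⟩
    rw [h, Set.mem_singleton_iff] at this
    exact hxH (this ▸ (hc x hx).mpr hxK)
  refine ⟨?_, fun K => ?_⟩
  · rw [List.pairwise_append]
    refine ⟨hp.1, List.pairwise_singleton _ _, ?_⟩
    intro K hK M hM
    rw [List.mem_singleton] at hM
    subst hM
    have hK' := (hp.2 K).mp hK
    have hzK' := hzK K hK'
    obtain ⟨hK1, hK2, hK3⟩ := hK'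
    refine Set.ssubset_iff_subset_ne.mpr ⟨?_, by rintro rfl; exact hyH hK3⟩
    rcases hs.nested M hH K hK1 with h4 | h4 | h4 | h4
    · exact h4
    · exact absurd (h4 hK3) hyH
    · exact absurd hzK' (Set.disjoint_left.mp h4 hzH)
    · exact absurd (h4 x hx) (by tauto)
  · rw [List.mem_append, List.mem_singleton, hp.2]
    constructor
    · rintro (hK | rfl)
      · exact ⟨hK.1, hK.2.1, hzK K hK⟩
      · exact ⟨hH, hxH, hzH⟩
    · rintro ⟨hK, hxK, hzK⟩
      by_cases hyK : y ∈ K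
      · exact Or.inl ⟨hK, hxK, hyK⟩
      · right
        have : K ∈ sep 𝓗 y z := ⟨hK, hyK, hzK⟩
        rwa [h] at this

theorem isDeveloping_cocycle (hs : HalfSpaceSystem O 𝓗 T) {x : X} (hx : x ∈ O) :
    IsDeveloping O 𝓗 T (cocycle 𝓗 T x) := by
  have key : ∀ y ∈ O, ∀ z ∈ O, ∀ H, sep 𝓗 y z = {H} → x ∉ H →
      cocycle 𝓗 T x z = cocycle 𝓗 T x y * T H := by
    intro y hy z hz H h hxH
    rw [cocycle, (hs.isPath_append hx hy hz h hxH).path_eq, cocycle]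
    simp
  refine ⟨fun y hy z hz h => ?_, fun y hy z hz H h => ?_⟩
  · have hp := hs.isPath_path hx z
    rw [IsPath, ← hs.sep_congr_right hy hz h x] at hp
    rw [cocycle, cocycle, IsPath.path_eq hp]
  -- When `x` lies in `H`, the path from `x` reaches z first and crosses the same boundary
  -- backwards, through the complementary half space with the inverse transition.
  · by_cases hxH : x ∈ H
    · obtain ⟨hH, hyH, hzH⟩ : H ∈ sep 𝓗 y z := by rw [h]; rfl
      obtain ⟨H', hH', hc, hT, -⟩ := hs.compl H hH
      have h' : sep 𝓗 z y = {H'} := by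
        ext K
        rw [Set.mem_singleton_iff]
        constructor
        · rintro ⟨hK, hzK, hyK⟩
          obtain ⟨K', hK', hc', -⟩ := hs.compl K hK
          have : K' ∈ sep 𝓗 y z := ⟨hK', by rw [hc' y hy]; tauto, by rwa [hc' z hz]⟩
          rw [h, Set.mem_singleton_iff] at this
          refine hs.eq_of_eq_on hH' hK fun w hw => ?_
          rw [hc w hw, ← this, hc' w hw, not_not]
        · rintro rfl
          exact ⟨hH', by rw [hc z hz]; tauto, by rwa [hc y hy]⟩
      have := key z hz y hy H' h' (by rw [hc x hx]; tauto)
      rw [this, hT, inv_mul_cancel_right]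
    · exact key y hy z hz H h hxH

/-- The cocycle based at `x` is a developing map, so uniqueness expresses it through the one based
at `y`. -/
theorem cocycle_mul (hs : HalfSpaceSystem O 𝓗 T) {x y z : X} (hx : x ∈ O) (hy : y ∈ O)
    (hz : z ∈ O) : cocycle 𝓗 T x y * cocycle 𝓗 T y z = cocycle 𝓗 T x z :=
  (hs.eq_mul_cocycle (hs.isDeveloping_cocycle hx) hy hz).symm

theorem cocycle_eq_one (hs : HalfSpaceSystem O 𝓗 T) {x y : X} (hx : x ∈ O)
    (h : sep 𝓗 x y = ∅) : cocycle 𝓗 T x y = 1 := by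
  have hp := hs.isPath_path hx y
  have : path 𝓗 x y = [] := by
    rw [List.eq_nil_iff_forall_not_mem]
    intro H hH
    have := (hp.2 H).mp hH
    rw [h] at this
    exact this
  rw [cocycle, this]; rfl

end HalfSpaceSystem

/-! ### The lifts of a simple closed geodesic -/

variable {Γ : Subgroup PSL2R} {ρ : Γ →* PSL2R} {a : Γ}

/-- The representation `ρ` is the holonomy of a marked closed hyperbolic surface on which the
closed geodesic determined by `a` has pairwise disjoint lifts. -/
structure HasSimpleLifts (ρ : Γ →* PSL2R) (a : Γ) : Prop where
  inj : Function.Injective ρ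
  surface : IsClosedSurfaceGroup ρ.range
  exists_isAxis : ∃ h, IsAxis (ρ a) h
  disjoint : ∀ h k, IsLift ρ a h → IsLift ρ a k → line h = line k ∨ Disjoint (line h) (line k)

/-- The half planes bounded by the lifts of the closed geodesic determined by `a`. -/
def halfPlanes (ρ : Γ →* PSL2R) (a : Γ) : Set (Set ℍ) := {H | ∃ h, IsLift ρ a h ∧ H = rightSide h}

open Classical in
/-- The translation by `t` along the oriented boundary of a half plane `H`, where `H` lies on the
right of its boundary. -/
def transition (t : ℝ) (H : Set ℍ) : PSL2R :=
  if h : ∃ k, rightSide k = H then translation h.choose t else 1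

theorem transition_rightSide (t : ℝ) (h : PSL2R) : transition t (rightSide h) = translation h t := by
  have H : ∃ k, rightSide k = rightSide h := ⟨h, rfl⟩
  rw [transition, dif_pos H]
  exact translation_eq_of_rightSide_eq H.choose_spec t

theorem IsLift.mul_revP {h : PSL2R} (H : IsLift ρ a h) : IsLift ρ a (h * revP) := by
  obtain ⟨g, hg⟩ := H
  exact ⟨g, isAxis_mul_revP hg⟩

theorem IsLift.smul {h : PSL2R} (H : IsLift ρ a h) (g : Γ) : IsLift ρ a (ρ g * h) := by
  obtain ⟨g', hg⟩ := H
  refine ⟨g * g', ?_⟩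
  have := isAxis_conj (ρ g) hg
  rw [← map_inv, ← map_mul, ← map_mul] at this
  convert this using 2
  group

theorem isLift_of_isAxis {h : PSL2R} (H : IsAxis (ρ a) h) : IsLift ρ a h := ⟨1, by simpa using H⟩

theorem isAxis_conj_map {h : PSL2R} (H : IsAxis (ρ a) h) (g : Γ) :
    IsAxis (ρ (g * a * g⁻¹)) (ρ g * h) := by
  rw [map_mul, map_mul, map_inv]
  exact isAxis_conj _ H

theorem notMem_line_of_mem_rightSide {h : PSL2R} {z : ℍ} (hz : z ∈ rightSide h) : z ∉ line h := by
  rw [mem_line_iff]; exact ne_of_gt hz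

theorem notMem_line_of_mem_leftSide {h : PSL2R} {z : ℍ} (hz : z ∈ leftSide h) : z ∉ line h := by
  rw [mem_line_iff]; exact ne_of_lt hz

theorem notMem_rightSide_of_mem_line {h : PSL2R} {z : ℍ} (hz : z ∈ line h) : z ∉ rightSide h :=
  fun h' => notMem_line_of_mem_rightSide h' hz

theorem notMem_leftSide_of_mem_rightSide {h : PSL2R} {z : ℍ} (hz : z ∈ rightSide h) :
    z ∉ leftSide h :=
  fun h' => lt_asymm (mem_rightSide_iff.mp hz) (mem_leftSide_iff.mp h')

theorem mem_leftSide_iff_of_mem_offLifts {h : PSL2R} (hh : IsLift ρ a h) {z : ℍ}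
    (hz : z ∈ offLifts ρ a) : z ∈ leftSide h ↔ z ∉ rightSide h := by
  have h1 := hz h hh
  rw [mem_leftSide_iff, mem_rightSide_iff, not_lt]
  refine ⟨le_of_lt, fun h2 => lt_of_le_of_ne h2 fun h3 => h1 (mem_line_iff.mpr h3)⟩

/-- Every point of a lift is the image of a point of a fixed compact segment of the axis. -/
theorem exists_segment {h₀ : PSL2R} {l : ℝ} (hl : l ≠ 0) (ha : ρ a = translation h₀ l) {h : PSL2R}
    (hh : IsLift ρ a h) {z : ℍ} (hz : z ∈ line h) :
    ∃ (g : Γ) (s : ℝ), |s| ≤ |l| ∧ z = ρ g • geodesic h₀ s ∧ line h = line (ρ g * h₀) := by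
  obtain ⟨g, hg⟩ := hh
  have hline := line_eq_of_isAxis hg (isAxis_conj_map ⟨l, hl, ha⟩ g)
  rw [hline] at hz
  obtain ⟨u, rfl⟩ := hz
  refine ⟨g * a ^ ⌊u / l⌋, l * Int.fract (u / l), ?_, ?_, ?_⟩
  · rw [abs_mul, abs_of_nonneg (Int.fract_nonneg (u / l))]
    exact mul_le_of_le_one_right (abs_nonneg l) (Int.fract_lt_one _).le
  · rw [geodesic_mul, map_mul, map_zpow, ha, mul_smul, translation_zpow, translation_smul_geodesic]
    congr 2
    have := Int.floor_add_fract (u / l)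
    rw [mul_comm _ l, ← mul_add, this]
    field_simp
  · rw [hline, map_mul, map_zpow, ha, translation_zpow]
    have : ρ g * translation h₀ (⌊u / l⌋ * l) * h₀ = ρ g * h₀ * diagP (⌊u / l⌋ * l) := by
      rw [translation_eq]; group
    rw [this, line_mul_diagP]

namespace HasSimpleLifts

/-- A lift that comes within `R` of `x` is the image of the axis under an element of bounded
displacement, of which there are finitely many; each line bounds two half planes. -/
theorem finite_halfPlanes (hs : HasSimpleLifts ρ a) (x : ℍ) (R : ℝ) :
    {H : Set ℍ | ∃ h, IsLift ρ a h ∧ H = rightSide h ∧ ∃ z ∈ line h, dist x z ≤ R}.Finite := by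
  obtain ⟨h₀, l, hl, ha⟩ := hs.exists_isAxis
  have hfin := finite_setOf_dist_le hs.surface.discrete (geodesic h₀ 0)
    (dist (geodesic h₀ 0) x + R + |l|)
  refine ((hfin.image fun g => rightSide (g * h₀)).union
    (hfin.image fun g => leftSide (g * h₀))).subset ?_
  rintro H ⟨h, hh, rfl, z, hz, hd⟩
  obtain ⟨g, s, hs', rfl, hline⟩ := exists_segment hl ha hh hz
  have hmem : ρ g ∈ {g : PSL2R | g ∈ ρ.range ∧ dist (geodesic h₀ 0) (g • geodesic h₀ 0) ≤
      dist (geodesic h₀ 0) x + R + |l|} := by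
    refine ⟨⟨g, rfl⟩, ?_⟩
    have h1 := dist_triangle4 (geodesic h₀ 0) x (ρ g • geodesic h₀ s) (ρ g • geodesic h₀ 0)
    rw [dist_smul_smul', dist_geodesic h₀, sub_zero] at h1
    linarith
  rcases rightSide_eq_or_of_line_eq hline with e | e
  · exact Or.inl ⟨ρ g, hmem, e.symm⟩
  · exact Or.inr ⟨ρ g, hmem, e.symm⟩

theorem isClosed_line (h : PSL2R) : IsClosed (line h) := by
  have : line h = (fun z : ℍ => (h⁻¹ • z).re) ⁻¹' {0} := by
    ext z; exact mem_line_iff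
  rw [this]
  exact isClosed_singleton.preimage
    (UpperHalfPlane.continuous_re.comp (continuous_const_smul h⁻¹))

/-- Distinct lifts have a uniform positive distance. -/
theorem exists_gap (hs : HasSimpleLifts ρ a) : ∃ δ > 0, ∀ h k, IsLift ρ a h → IsLift ρ a k →
    line h ≠ line k → ∀ p ∈ line h, ∀ q ∈ line k, δ ≤ dist p q := by
  obtain ⟨h₀, l, hl, ha⟩ := hs.exists_isAxis
  have hh₀ : IsLift ρ a h₀ := isLift_of_isAxis ⟨l, hl, ha⟩
  have hK : IsCompact (geodesic h₀ '' Set.Icc (-|l|) |l|) :=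
    isCompact_Icc.image (continuous_geodesic h₀)
  obtain ⟨δ, hδ, hδ'⟩ := exists_pos_forall_of_finite
    (P := fun δ H => ∀ k, IsLift ρ a k → H = rightSide k → line h₀ ≠ line k →
      ∀ p ∈ geodesic h₀ '' Set.Icc (-|l|) |l|, ∀ q ∈ line k, δ ≤ dist p q)
    (hs.finite_halfPlanes (geodesic h₀ 0) (|l| + 1)) (by
      rintro H ⟨k, hk, rfl, -⟩
      by_cases hne : line h₀ = line k
      · refine ⟨1, one_pos, fun k' _ e hne' => absurd ?_ hne'⟩
        rw [hne, line_eq_of_rightSide_eq e]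
      · have hdisj : Disjoint (geodesic h₀ '' Set.Icc (-|l|) |l|) (line k) :=
          ((hs.disjoint h₀ k hh₀ hk).resolve_left hne).mono_left (Set.image_subset_range _ _)
        obtain ⟨r, hr, H⟩ := Metric.exists_pos_forall_lt_edist hK (isClosed_line k) hdisj
        refine ⟨r, by exact_mod_cast hr, fun k' _ e _ p hp q hq => ?_⟩
        rw [← line_eq_of_rightSide_eq e] at hq
        have := H p hp q hq
        rw [edist_nndist, ENNReal.coe_lt_coe] at this
        exact (NNReal.coe_lt_coe.mpr this).le)
    (fun H δ δ' hle h k hk e hne p hp q hq => hle.trans (h k hk e hne p hp q hq))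
  -- The finite family only contains lifts that come within 1 of the fundamental segment; for the
  -- others 1 is a lower bound.
  refine ⟨min δ 1, lt_min hδ one_pos, fun h k hh hk hne p hp q hq => ?_⟩
  obtain ⟨g, s, hsl, rfl, hline⟩ := exists_segment hl ha hh hp
  set q' := (ρ g)⁻¹ • q with hq'
  have hk' : IsLift ρ a (ρ g⁻¹ * k) := hk.smul g⁻¹
  have hqk : q' ∈ line (ρ g⁻¹ * k) := by
    rw [hq', ← map_inv, smul_mem_line_iff]; exact hq
  have hne' : line h₀ ≠ line (ρ g⁻¹ * k) := by
    intro e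
    apply hne
    rw [hline]
    ext w
    have : w = ρ g • ((ρ g)⁻¹ • w) := by rw [smul_inv_smul]
    rw [this, smul_mem_line_iff, e, map_inv, smul_mem_line_iff, smul_inv_smul]
  have hdist : dist (ρ g • geodesic h₀ s) q = dist (geodesic h₀ s) q' := by
    rw [← dist_smul_smul' (ρ g) (geodesic h₀ s) q', hq', smul_inv_smul]
  rw [hdist]
  by_contra! hcon
  have hlt1 := hcon.trans_le (min_le_right _ _)
  have hlt2 := hcon.trans_le (min_le_left _ _)
  refine absurd (hδ' (rightSide (ρ g⁻¹ * k)) ⟨_, hk', rfl, q', hqk, ?_⟩ _ hk' rfl hne'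
    (geodesic h₀ s) ⟨s, abs_le.mp hsl, rfl⟩ q' hqk) (not_le.mpr hlt2)
  have h1 := dist_triangle (geodesic h₀ 0) (geodesic h₀ s) q'
  rw [dist_geodesic h₀ 0 s, zero_sub, abs_neg] at h1
  linarith

end HasSimpleLifts

theorem exists_near (h : PSL2R) {η : ℝ} (hη : 0 < η) : ∃ z ∈ leftSide h, ∃ z' ∈ rightSide h,
    dist z (geodesic h 0) ≤ η ∧ dist z' (geodesic h 0) ≤ η := by
  have key : ∀ x : ℝ, dist (⟨⟨x, 1⟩, one_pos⟩ : ℍ) (imagAxis 0) ≤ |x| := by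
    intro x
    refine (UpperHalfPlane.dist_le_dist_coe_div_sqrt _ _).trans ?_
    rw [imagAxis_im, Real.exp_zero, mul_one]
    change dist (⟨x, 1⟩ : ℂ) (imagAxis 0) / √(1 : ℝ) ≤ |x|
    rw [Real.sqrt_one, div_one, imagAxis_coe, Complex.dist_eq]
    have : (⟨x, 1⟩ : ℂ) - Complex.I * (Real.exp 0 : ℝ) = (x : ℂ) := by
      apply Complex.ext <;> simp
    rw [this, Complex.norm_real, Real.norm_eq_abs]
  refine ⟨h • ⟨⟨-η, 1⟩, one_pos⟩, ?_, h • ⟨⟨η, 1⟩, one_pos⟩, ?_, ?_, ?_⟩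
  · rw [mem_leftSide_iff, inv_smul_smul]
    change -η < 0
    linarith
  · rw [mem_rightSide_iff, inv_smul_smul]
    exact hη
  · rw [geodesic, dist_smul_smul']
    refine (key _).trans ?_
    rw [abs_neg, abs_of_pos hη]
  · rw [geodesic, dist_smul_smul']
    refine (key _).trans ?_
    rw [abs_of_pos hη]

theorem rightSide_eq_of_line_eq {h k : PSL2R} (hl : line k = line h) {z : ℍ} (hz : z ∈ rightSide h)
    (hz' : z ∈ rightSide k) : rightSide k = rightSide h := by
  refine (rightSide_eq_or_of_line_eq hl).resolve_right fun e => ?_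
  rw [e] at hz'
  exact notMem_leftSide_of_mem_rightSide hz hz'

theorem HasSimpleLifts.halfSpaceSystem (hs : HasSimpleLifts ρ a) (t : ℝ) :
    HalfSpaceSystem (offLifts ρ a) (halfPlanes ρ a) (transition t) where
  compl := by
    rintro _ ⟨h, hh, rfl⟩
    refine ⟨leftSide h, ⟨h * revP, hh.mul_revP, (rightSide_mul_revP h).symm⟩, ?_, ?_, ?_⟩
    · intro x hx
      exact mem_leftSide_iff_of_mem_offLifts hh hx
    · rw [← rightSide_mul_revP, transition_rightSide, transition_rightSide, translation_mul_revP,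
        translation_neg]
    · exact Set.disjoint_left.mpr fun z h1 h2 => notMem_leftSide_of_mem_rightSide h1 h2
  nested := by
    rintro _ ⟨h, hh, rfl⟩ _ ⟨k, hk, rfl⟩
    have hd : ∀ h : PSL2R, Disjoint (leftSide h) (rightSide h) := fun h =>
      Set.disjoint_left.mpr fun z h1 h2 => notMem_leftSide_of_mem_rightSide h2 h1
    rcases hs.disjoint h k hh hk with hl | hl
    · rcases rightSide_eq_or_of_line_eq hl with e | e
      · exact Or.inl e.subset
      · exact Or.inr (Or.inr (Or.inl (by rw [e]; exact hd k)))
    · rcases nested_of_disjoint hl with e | e | e | e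
      · exact Or.inr (Or.inl e)
      · refine Or.inr (Or.inr (Or.inr fun x hx => ?_))
        by_cases hxk : x ∈ rightSide k
        · exact Or.inr hxk
        · exact Or.inl (e ((mem_leftSide_iff_of_mem_offLifts hk hx).mpr hxk))
      · exact Or.inr (Or.inr (Or.inl ((hd h).symm.mono_right e)))
      · exact Or.inl e
  finite_sep := by
    intro x y
    refine (hs.finite_halfPlanes x (dist x y)).subset ?_
    rintro _ ⟨⟨h, hh, rfl⟩, hx, hy⟩
    obtain ⟨p, hp, e⟩ := exists_mem_line_dist hx hy
    exact ⟨h, hh, rfl, p, hp, by linarith [dist_nonneg (x := p) (y := y)]⟩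
  exists_adj := by
    rintro _ ⟨h, hh, rfl⟩
    obtain ⟨δ, hδ, gap⟩ := hs.exists_gap
    -- A point where a lift meets the segment from z to z' is within 2δ/5 of z, so within 3δ/5 of a
    -- point of `line h`. This is less than the gap, so that lift is `line h`.
    obtain ⟨z, hz, z', hz', hd, hd'⟩ := exists_near h (η := δ / 5) (by linarith)
    have hp : geodesic h 0 ∈ line h := ⟨0, rfl⟩
    have hclose : ∀ k, IsLift ρ a k → ∀ q ∈ line k, dist q (geodesic h 0) < δ →
        line h = line k := by
      intro k hk q hq hlt
      by_contra hne
      have := gap h k hh hk hne _ hp q hq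
      rw [dist_comm] at this
      linarith
    have hO : ∀ w, w ∉ line h → dist w (geodesic h 0) ≤ δ / 5 → w ∈ offLifts ρ a := by
      intro w hw hdw k hk hwk
      exact hw (by rw [hclose k hk w hwk (by linarith)]; exact hwk)
    refine ⟨z, hO z (notMem_line_of_mem_leftSide hz) hd, z',
      hO z' (notMem_line_of_mem_rightSide hz') hd', fun h' => notMem_leftSide_of_mem_rightSide h' hz, hz', ?_⟩
    rintro _ ⟨k, hk, rfl⟩ hzk hzk'
    obtain ⟨q, hq, e⟩ := exists_mem_line_dist hzk hzk'
    have h1 := dist_triangle z (geodesic h 0) z'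
    rw [dist_comm (geodesic h 0) z'] at h1
    have h2 := dist_triangle q z (geodesic h 0)
    rw [dist_comm q z] at h2
    have h3 := dist_nonneg (x := q) (y := z')
    exact rightSide_eq_of_line_eq (hclose k hk q hq (by linarith)).symm hz' hzk'

theorem HasSimpleLifts.of_mem_teichmuller (hΓ : IsClosedSurfaceGroup Γ)
    (ha : IsSimpleClosedGeodesic Γ a) (hρ : ρ ∈ teichmuller Γ) : HasSimpleLifts ρ a := by
  obtain ⟨h1, h2⟩ := mem_fuchsianMaps_iff.mp (mem_fuchsianMaps_of_mem_teichmuller hρ)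
  refine ⟨h1, h2, ?_, fun h k hh hk => lifts_disjoint hΓ ha hρ hh hk⟩
  refine FenchelNielsen.exists_isAxis h2 ⟨a, rfl⟩ fun h => ?_
  rw [map_eq_one_iff ρ h1] at h
  obtain ⟨k, l, hl, e, -⟩ := ha
  rw [h, Subgroup.coe_one] at e
  exact hl.ne' (translation_eq_one_iff.mp e.symm)

/-! ### The twisted representation -/

theorem image_rightSide (g h : PSL2R) : (fun z : ℍ => g • z) '' rightSide h = rightSide (g * h) := by
  ext z
  constructor
  · rintro ⟨w, hw, rfl⟩
    exact smul_mem_rightSide_iff.mpr hw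
  · intro hz
    refine ⟨g⁻¹ • z, ?_, smul_inv_smul _ _⟩
    rw [← smul_mem_rightSide_iff (g := g), smul_inv_smul]
    exact hz

theorem smul_mem_offLifts {x : ℍ} (hx : x ∈ offLifts ρ a) (g : Γ) : ρ g • x ∈ offLifts ρ a := by
  intro h hh hmem
  refine hx _ (hh.smul g⁻¹) ?_
  change x ∈ line (ρ g⁻¹ * h)
  rw [← smul_mem_line_iff (g := ρ g), ← mul_assoc, ← map_mul, mul_inv_cancel, map_one, one_mul]
  exact hmem

theorem continuous_transition (H : Set ℍ) : Continuous fun t => transition t H := by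
  by_cases h : ∃ k, rightSide k = H
  · obtain ⟨k, rfl⟩ := h
    simp only [transition_rightSide]
    exact continuous_translation k
  · simp only [transition, dif_neg h]
    exact continuous_const

theorem transition_zero (H : Set ℍ) : transition 0 H = 1 := by
  by_cases h : ∃ k, rightSide k = H
  · obtain ⟨k, rfl⟩ := h
    rw [transition_rightSide, translation_zero]
  · rw [transition, dif_neg h]

/-! ### Nesting and distance estimates for products of shears -/

theorem translation_smul_mem_rightSide_iff {h : PSL2R} {t : ℝ} {z : ℍ} :
    translation h t • z ∈ rightSide h ↔ z ∈ rightSide h := by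
  rw [translation_eq, mem_rightSide_iff, mem_rightSide_iff, mul_smul, mul_smul, inv_smul_smul,
    re_diagP_smul]
  simp [Real.exp_pos]

theorem translation_smul_mem_line {h : PSL2R} {t : ℝ} {z : ℍ} (hz : z ∈ line h) :
    translation h t • z ∈ line h ∧ dist (translation h t • z) z = |t| := by
  obtain ⟨s, rfl⟩ := hz
  rw [translation_smul_geodesic, dist_geodesic, add_sub_cancel_right]
  exact ⟨⟨_, rfl⟩, rfl⟩

/-- The ordered product of the transitions along a list of half planes. -/
def transitionProd (t : ℝ) (l : List (Set ℍ)) : PSL2R := (l.map (transition t)).prod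

theorem transitionProd_cons (t : ℝ) (H : Set ℍ) (l : List (Set ℍ)) :
    transitionProd t (H :: l) = transition t H * transitionProd t l := by
  simp [transitionProd]

theorem transitionProd_zero (l : List (Set ℍ)) : transitionProd 0 l = 1 := by
  induction l with
  | nil => rfl
  | cons H l ih => rw [transitionProd_cons, ih, transition_zero, one_mul]

theorem continuous_transitionProd (l : List (Set ℍ)) : Continuous fun t => transitionProd t l := by
  induction l with
  | nil => exact continuous_const
  | cons H l ih =>
    simp only [transitionProd_cons]
    exact (continuous_transition H).mul ih

theorem cocycle_eq_transitionProd (t : ℝ) (x y : ℍ) : cocycle (halfPlanes ρ a) (transition t) x y =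
    transitionProd t (path (halfPlanes ρ a) x y) := rfl

/-- Each shear preserves its own half plane, and the later ones act inside it; so the product keeps
`y` in the first half plane of the list for every `t`. -/
theorem transitionProd_smul_mem (t : ℝ) {l : List (Set ℍ)} (hl : ∀ H ∈ l, H ∈ halfPlanes ρ a)
    (hp : l.Pairwise fun H K => K ⊂ H) {y : ℍ} (hy : ∀ H ∈ l, y ∈ H) {K : Set ℍ}
    (hK : ∀ H ∈ l, H ⊆ K) (hyK : y ∈ K) : transitionProd t l • y ∈ K := by
  induction l generalizing K with
  | nil => simpa [transitionProd] using hyK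
  | cons H l ih =>
    rw [List.pairwise_cons] at hp
    have h1 := ih (fun M hM => hl M (by simp [hM])) hp.2 (fun M hM => hy M (by simp [hM]))
      (fun M hM => (hp.1 M hM).subset) (hy H (by simp))
    apply hK H (by simp)
    rw [transitionProd_cons, mul_smul]
    obtain ⟨h, hh, rfl⟩ := hl H (by simp)
    rw [transition_rightSide, translation_smul_mem_rightSide_iff]
    exact h1

/-- The segment from `x` to the sheared point meets the boundary of the first half plane at p.
Undoing the shear there replaces p by a point q of the same line at distance |t|, and the induction
continues from q. Each lift costs at most |t| in the first bound and contributes a gap δ in the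
others. Only the stretch from `x` to the first lift may be short, so one δ is lost unless `x` lies
on a lift; this third form feeds the induction. -/
theorem dist_le_dist_transitionProd (t : ℝ) {l : List (Set ℍ)} {δ : ℝ}
    (gap : ∀ h k, IsLift ρ a h → IsLift ρ a k →
      line h ≠ line k → ∀ p ∈ line h, ∀ q ∈ line k, δ ≤ dist p q)
    (hl : ∀ H ∈ l, H ∈ halfPlanes ρ a) (hp : l.Pairwise fun H K => K ⊂ H) {x y : ℍ}
    (hx : ∀ H ∈ l, x ∉ H) (hy : ∀ H ∈ l, y ∈ H) :
    dist x y ≤ dist x (transitionProd t l • y) + l.length * |t| ∧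
    l.length * δ ≤ dist x (transitionProd t l • y) + max δ 0 ∧
    ∀ k, IsLift ρ a k → x ∈ line k → (∀ H ∈ l, H ⊂ rightSide k) →
      l.length * δ ≤ dist x (transitionProd t l • y) := by
  induction l generalizing x with
  | nil =>
    have := dist_nonneg (x := x) (y := y)
    simp only [transitionProd, List.map_nil, List.prod_nil, one_smul, List.length_nil,
      Nat.cast_zero, zero_mul, add_zero, le_refl, true_and]
    exact ⟨by positivity, fun _ _ _ _ => this⟩
  | cons H l ih =>
    rw [List.pairwise_cons] at hp
    have hl' : ∀ M ∈ l, M ∈ halfPlanes ρ a := fun M hM => hl M (by simp [hM])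
    have hy' : ∀ M ∈ l, y ∈ M := fun M hM => hy M (by simp [hM])
    have h1 := transitionProd_smul_mem t hl' hp.2 hy' (fun M hM => (hp.1 M hM).subset)
      (hy H (by simp))
    obtain ⟨h, hh, rfl⟩ := hl H (by simp)
    rw [transitionProd_cons, transition_rightSide, mul_smul]
    set w := transitionProd t l • y with hw
    obtain ⟨p, hpl, hpd⟩ := exists_mem_line_dist (hx _ (by simp))
      (translation_smul_mem_rightSide_iff (t := t).mpr h1)
    obtain ⟨hq, hqd⟩ := translation_smul_mem_line (t := -t) hpl
    set q := translation h (-t) • p with hqe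
    have hpq : p = translation h t • q := by rw [hqe, translation_neg, smul_inv_smul]
    have hqw : dist p (translation h t • w) = dist q w := by rw [hpq, dist_smul_smul']
    have hqM : ∀ M ∈ l, q ∉ M := fun M hM hqM =>
      notMem_rightSide_of_mem_line hq ((hp.1 M hM).1 hqM)
    obtain ⟨i1, -, i3⟩ := ih hl' hp.2 hqM hy'
    have i3 := i3 h hh hq hp.1
    rw [hqw] at hpd
    rw [abs_neg, dist_comm] at hqd
    have t1 := dist_triangle4 x p q y
    have hxp := dist_nonneg (x := x) (y := p)
    have hmax := le_max_left δ 0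
    refine ⟨?_, ?_, fun k hk hxk hkM => ?_⟩
    · push_cast [List.length_cons]; linarith
    · push_cast [List.length_cons]; linarith
    · have hne : line k ≠ line h := by
        intro e
        have hs := hkM _ (List.mem_cons_self)
        rcases rightSide_eq_or_of_line_eq e with e' | e'
        · exact hs.ne e'.symm
        · have := hs.1 h1
          rw [e'] at this
          exact notMem_leftSide_of_mem_rightSide h1 this
      have := gap k h hk hh hne x hxk p hpl
      push_cast [List.length_cons]; linarith

/-- The converse comparison: cut the unsheared segment at each lift and insert a translation of
length |t|. -/
theorem dist_transitionProd_le (t : ℝ) {l : List (Set ℍ)}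
    (hl : ∀ H ∈ l, H ∈ halfPlanes ρ a) (hp : l.Pairwise fun H K => K ⊂ H) {x y : ℍ}
    (hx : ∀ H ∈ l, x ∉ H) (hy : ∀ H ∈ l, y ∈ H) :
    dist x (transitionProd t l • y) ≤ dist x y + l.length * |t| := by
  induction l generalizing x with
  | nil => simp [transitionProd]
  | cons H l ih =>
    rw [List.pairwise_cons] at hp
    obtain ⟨h, hh, rfl⟩ := hl H (by simp)
    rw [transitionProd_cons, transition_rightSide, mul_smul]
    obtain ⟨p, hpl, hpd⟩ := exists_mem_line_dist (hx (rightSide h) (by simp)) (hy (rightSide h) (by simp))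
    obtain ⟨-, hqd⟩ := translation_smul_mem_line (t := t) hpl
    have i1 := ih (fun M hM => hl M (by simp [hM])) hp.2 (x := p) (fun M hM hpM =>
      notMem_rightSide_of_mem_line hpl ((hp.1 M hM).1 hpM)) (fun M hM => hy M (by simp [hM]))
    have t1 := dist_triangle4 x p (translation h t • p) (translation h t • transitionProd t l • y)
    rw [dist_smul_smul', dist_comm p, hqd] at t1
    push_cast [List.length_cons]; linarith

/-! ### Equivariance of the cocycle and the twisted holonomy -/

namespace HasSimpleLifts

theorem path_smul (hs : HasSimpleLifts ρ a) (g : Γ) {x : ℍ} (hx : x ∈ offLifts ρ a) (y : ℍ) :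
    path (halfPlanes ρ a) (ρ g • x) (ρ g • y) =
      (path (halfPlanes ρ a) x y).map (fun H => (fun z : ℍ => ρ g • z) '' H) := by
  have hp := (hs.halfSpaceSystem 0).isPath_path hx y
  refine IsPath.path_eq ⟨?_, fun H => ?_⟩
  · rw [List.pairwise_map]
    refine hp.1.imp fun hab => ?_
    exact (MulAction.injective (ρ g)).image_strictMono hab
  · rw [List.mem_map]
    constructor
    · rintro ⟨K, hK, rfl⟩
      obtain ⟨⟨h, hh, rfl⟩, h1, h2⟩ := (hp.2 K).mp hK
      rw [image_rightSide]
      exact ⟨⟨_, hh.smul g, rfl⟩, by rwa [smul_mem_rightSide_iff], by rwa [smul_mem_rightSide_iff]⟩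
    · rintro ⟨⟨h, hh, rfl⟩, h1, h2⟩
      have e : ρ g * (ρ g⁻¹ * h) = h := by rw [map_inv, mul_inv_cancel_left]
      refine ⟨rightSide (ρ g⁻¹ * h), (hp.2 _).mpr ⟨⟨_, hh.smul g⁻¹, rfl⟩, ?_, ?_⟩, ?_⟩
      · rwa [← smul_mem_rightSide_iff (g := ρ g), e]
      · rwa [← smul_mem_rightSide_iff (g := ρ g), e]
      · rw [image_rightSide, e]

theorem cocycle_smul (hs : HasSimpleLifts ρ a) (t : ℝ) (g : Γ) {x : ℍ} (hx : x ∈ offLifts ρ a)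
    (y : ℍ) : cocycle (halfPlanes ρ a) (transition t) (ρ g • x) (ρ g • y) =
      ρ g * cocycle (halfPlanes ρ a) (transition t) x y * (ρ g)⁻¹ := by
  have hp := (hs.halfSpaceSystem 0).isPath_path hx y
  rw [cocycle, cocycle, hs.path_smul g hx, List.map_map]
  have : (path (halfPlanes ρ a) x y).map (transition t ∘ fun H => (fun z : ℍ => ρ g • z) '' H) =
      ((path (halfPlanes ρ a) x y).map (transition t)).map (MulAut.conj (ρ g)) := by
    rw [List.map_map]
    refine List.map_congr_left fun H hH => ?_
    obtain ⟨⟨h, hh, rfl⟩, -, -⟩ := (hp.2 H).mp hH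
    simp only [Function.comp_apply]
    rw [image_rightSide, transition_rightSide, transition_rightSide, translation_conj,
      MulAut.conj_apply]
  rw [this, ← map_list_prod, MulAut.conj_apply]

/-- The holonomy of the surface obtained by a left twist of distance `t`, normalised by the choice
of a base point. -/
def twist (hs : HasSimpleLifts ρ a) (t : ℝ) {x : ℍ} (hx : x ∈ offLifts ρ a) : Γ →* PSL2R where
  toFun g := cocycle (halfPlanes ρ a) (transition t) x (ρ g • x) * ρ g
  map_one' := by
    have h := (hs.halfSpaceSystem t).cocycle_mul hx hx hx
    simp only [map_one, one_smul, mul_one]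
    simpa using h
  -- The cocycle relation along x, gx, ghx with equivariance gives c(x, ghx) = c(x, gx) · g c(x, hx)
  -- g⁻¹, the crossed homomorphism identity.
  map_mul' g h := by
    have h1 := (hs.halfSpaceSystem t).cocycle_mul hx (smul_mem_offLifts hx g)
      (smul_mem_offLifts (smul_mem_offLifts hx h) g)
    rw [hs.cocycle_smul t g hx] at h1
    rw [map_mul, mul_smul, ← h1]
    group

theorem twist_apply (hs : HasSimpleLifts ρ a) (t : ℝ) {x : ℍ} (hx : x ∈ offLifts ρ a) (g : Γ) :
    hs.twist t hx g = cocycle (halfPlanes ρ a) (transition t) x (ρ g • x) * ρ g := rfl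

theorem twist_zero (hs : HasSimpleLifts ρ a) {x : ℍ} (hx : x ∈ offLifts ρ a) :
    hs.twist 0 hx = ρ := by
  ext1 g
  rw [twist_apply, cocycle_eq_transitionProd, transitionProd_zero, one_mul]

/-- The list of half planes crossed does not depend on `t`; only the shears do, continuously. -/
theorem continuous_twist (hs : HasSimpleLifts ρ a) {x : ℍ} (hx : x ∈ offLifts ρ a) :
    Continuous fun t => (⇑(hs.twist t hx) : Γ → PSL2R) := by
  refine continuous_pi fun g => ?_
  simp only [twist_apply, cocycle_eq_transitionProd]
  exact (continuous_transitionProd _).mul continuous_const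

theorem sep_eq_empty_iff {x y : ℍ} (hx : x ∈ offLifts ρ a) : sep (halfPlanes ρ a) x y = ∅ ↔
    ∀ h, IsLift ρ a h → ¬ (x ∈ leftSide h ∧ y ∈ rightSide h) := by
  rw [Set.eq_empty_iff_forall_notMem]
  constructor
  · rintro H h hh ⟨h1, h2⟩
    exact H (rightSide h) ⟨⟨h, hh, rfl⟩, (mem_leftSide_iff_of_mem_offLifts hh hx).mp h1, h2⟩
  · rintro H _ ⟨⟨h, hh, rfl⟩, h1, h2⟩
    exact H h hh ⟨(mem_leftSide_iff_of_mem_offLifts hh hx).mpr h1, h2⟩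

theorem isLeftTwist_twist (hs : HasSimpleLifts ρ a) (t : ℝ) {x : ℍ} (hx : x ∈ offLifts ρ a) :
    IsLeftTwist ρ a t (hs.twist t hx) := by
  have hd := (hs.halfSpaceSystem t).isDeveloping_cocycle hx
  refine ⟨cocycle (halfPlanes ρ a) (transition t) x, ?_, ?_, ?_⟩
  · intro y hy z hz h
    exact hd.const y hy z hz ((sep_eq_empty_iff hy).mpr h)
  · intro y hy z hz h hh h1 h2 H
    rw [hd.jump y hy z hz (rightSide h), transition_rightSide]
    ext K
    rw [Set.mem_singleton_iff]
    constructor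
    · rintro ⟨⟨k, hk, rfl⟩, hyk, hzk⟩
      exact rightSide_eq_of_line_eq
        (H k hk ((mem_leftSide_iff_of_mem_offLifts hk hy).mpr hyk) hzk) h2 hzk
    · rintro rfl
      exact ⟨⟨h, hh, rfl⟩, (mem_leftSide_iff_of_mem_offLifts hh hy).mp h1, h2⟩
  · intro g y hy
    have h1 := (hs.halfSpaceSystem t).cocycle_mul hx (smul_mem_offLifts hx g)
      (smul_mem_offLifts hy g)
    rw [hs.cocycle_smul t g hx] at h1
    rw [← h1, twist_apply]
    group

/-- The developing map of any left twist is `E x` times the cocycle, and equivariance at `x` turns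
this left factor into a conjugation. -/
theorem eq_conj_twist (hs : HasSimpleLifts ρ a) {t : ℝ} {ρ' : Γ →* PSL2R}
    (h : IsLeftTwist ρ a t ρ') {x : ℍ} (hx : x ∈ offLifts ρ a) :
    ∃ e : PSL2R, ∀ g, ρ' g = e * hs.twist t hx g * e⁻¹ := by
  obtain ⟨E, h1, h2, h3⟩ := h
  have hd : IsDeveloping (offLifts ρ a) (halfPlanes ρ a) (transition t) E := by
    refine ⟨fun y hy z hz he => h1 y hy z hz ((sep_eq_empty_iff hy).mp he), ?_⟩
    intro y hy z hz H hsep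
    obtain ⟨⟨h, hh, rfl⟩, h4, h5⟩ : H ∈ sep (halfPlanes ρ a) y z := by rw [hsep]; rfl
    rw [transition_rightSide]
    refine h2 y hy z hz h hh ((mem_leftSide_iff_of_mem_offLifts hh hy).mpr h4) h5 ?_
    intro k hk h6 h7
    have : rightSide k ∈ sep (halfPlanes ρ a) y z :=
      ⟨⟨k, hk, rfl⟩, (mem_leftSide_iff_of_mem_offLifts hk hy).mp h6, h7⟩
    rw [hsep, Set.mem_singleton_iff] at this
    exact line_eq_of_rightSide_eq this
  refine ⟨E x, fun g => ?_⟩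
  have h4 := h3 g x hx
  rw [(hs.halfSpaceSystem t).eq_mul_cocycle hd hx (smul_mem_offLifts hx g)] at h4
  rw [eq_mul_inv_iff_mul_eq, ← h4, twist_apply, mul_assoc]

end HasSimpleLifts

/-! ### The twisted representation is Fuchsian -/

namespace HasSimpleLifts

/-- A bound R on the twisted displacement bounds the number of lifts crossed by (R + δ)/δ, hence
also the displacement under `ρ`, and `ρ` has discrete image. -/
theorem finite_twist (hs : HasSimpleLifts ρ a) (t : ℝ) {x : ℍ} (hx : x ∈ offLifts ρ a) (R : ℝ) :
    {g : Γ | dist x (hs.twist t hx g • x) ≤ R}.Finite := by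
  obtain ⟨δ, hδ, gap⟩ := hs.exists_gap
  have hfin := finite_setOf_dist_le hs.surface.discrete x (R + (R + δ) / δ * |t|)
  refine (hfin.preimage (f := ρ) hs.inj.injOn).subset ?_
  intro g hg
  refine ⟨⟨g, rfl⟩, ?_⟩
  have hp := (hs.halfSpaceSystem t).isPath_path hx (ρ g • x)
  obtain ⟨h1, h2, -⟩ := dist_le_dist_transitionProd t gap (fun H hH => ((hp.2 H).mp hH).1) hp.1
    (fun H hH => ((hp.2 H).mp hH).2.1) (fun H hH => ((hp.2 H).mp hH).2.2)
  have e : transitionProd t (path (halfPlanes ρ a) x (ρ g • x)) • ρ g • x =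
      hs.twist t hx g • x := by
    rw [← mul_smul]; rfl
  rw [e] at h1 h2
  have hg' : dist x (hs.twist t hx g • x) ≤ R := hg
  rw [max_eq_left hδ.le] at h2
  have h3 : ((path (halfPlanes ρ a) x (ρ g • x)).length : ℝ) ≤ (R + δ) / δ := by
    rw [le_div_iff₀ hδ]; linarith
  have h4 := mul_le_mul_of_nonneg_right h3 (abs_nonneg t)
  linarith

/-- The powers of an element with a fixed point have bounded displacement, so there are finitely
many of them, and closed surface groups have no torsion. -/
theorem eq_one_of_twist_smul_eq (hs : HasSimpleLifts ρ a) (t : ℝ) {x : ℍ} (hx : x ∈ offLifts ρ a)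
    {g : Γ} {z : ℍ} (hz : hs.twist t hx g • z = z) : g = 1 := by
  have hn : ∀ n : ℕ, hs.twist t hx (g ^ n) • z = z := by
    intro n
    induction n with
    | zero => simp
    | succ n ih => rw [pow_succ, map_mul, mul_smul, hz, ih]
  have hfin := hs.finite_twist t hx (2 * dist x z)
  have hmem : ∀ n : ℕ, g ^ n ∈ {g : Γ | dist x (hs.twist t hx g • x) ≤ 2 * dist x z} := by
    intro n
    have h1 := dist_triangle x z (hs.twist t hx (g ^ n) • x)
    have h2 : dist z (hs.twist t hx (g ^ n) • x) = dist z x := by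
      nth_rw 1 [← hn n]
      rw [dist_smul_smul']
    rw [h2, dist_comm z x] at h1
    change dist x (hs.twist t hx (g ^ n) • x) ≤ 2 * dist x z
    linarith
  have hfo : IsOfFinOrder g := by
    by_contra hcon
    exact Set.infinite_of_injective_forall_mem (injective_pow_iff_not_isOfFinOrder.mpr hcon) hmem
      hfin
  obtain ⟨n, hn0, hgn⟩ := isOfFinOrder_iff_pow_eq_one.mp hfo
  have := eq_one_of_pow_eq_one hs.surface ⟨g, rfl⟩ hn0.ne' (by rw [← map_pow, hgn, map_one])
  rwa [map_eq_one_iff ρ hs.inj] at this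

theorem injective_twist (hs : HasSimpleLifts ρ a) (t : ℝ) {x : ℍ} (hx : x ∈ offLifts ρ a) :
    Function.Injective (hs.twist t hx) := by
  rw [injective_iff_map_eq_one]
  intro g hg
  exact hs.eq_one_of_twist_smul_eq t hx (z := x) (by rw [hg, one_smul])

theorem discrete_twist (hs : HasSimpleLifts ρ a) (t : ℝ) {x : ℍ} (hx : x ∈ offLifts ρ a) :
    DiscreteTopology (hs.twist t hx).range := by
  rw [discreteTopology_iff_isOpen_singleton_one]
  set U : Set (hs.twist t hx).range := {g | dist x ((g : PSL2R) • x) < 1} with hU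
  have hUo : IsOpen U := by
    have hc : Continuous fun g : (hs.twist t hx).range => dist x ((g : PSL2R) • x) :=
      continuous_const.dist (continuous_subtype_val.smul continuous_const)
    exact isOpen_lt hc continuous_const
  have hUf : U.Finite := by
    refine ((hs.finite_twist t hx 1).image
      (fun g => (⟨hs.twist t hx g, g, rfl⟩ : (hs.twist t hx).range))).subset ?_
    rintro ⟨_, g, rfl⟩ hg
    have hg' : dist x (hs.twist t hx g • x) < 1 := hg
    exact ⟨g, hg'.le, rfl⟩
  have h1 : (1 : (hs.twist t hx).range) ∈ U := by simp [hU]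
  have : ({1} : Set (hs.twist t hx).range) = U \ (U \ {1}) := by
    rw [Set.sdiff_sdiff_cancel_left (Set.singleton_subset_iff.mpr h1)]
  rw [this]
  exact hUo.sdiff (hUf.subset Set.sdiff_subset).isClosed

/-- Every point lies in the image of the closure of some complementary region. -/
theorem exists_region (hs : HasSimpleLifts ρ a) (t : ℝ) {x : ℍ} (hx : x ∈ offLifts ρ a) (p : ℍ) :
    ∃ y ∈ offLifts ρ a, ∀ H ∈ halfPlanes ρ a, y ∉ H →
      (cocycle (halfPlanes ρ a) (transition t) x y)⁻¹ • p ∉ H := by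
  have hsys := hs.halfSpaceSystem t
  obtain ⟨δ, hδ, gap⟩ := hs.exists_gap
  -- Otherwise one can walk from `x` towards `p` indefinitely, crossing one more lift at each step,
  -- while every half plane entered contains the pulled back `p`. The distance from `x` to `p` would
  -- exceed every bound.
  by_contra! hcon
  have step : ∀ n : ℕ, ∃ y ∈ offLifts ρ a, (path (halfPlanes ρ a) x y).length = n ∧
      ∀ H ∈ path (halfPlanes ρ a) x y,
        (cocycle (halfPlanes ρ a) (transition t) x y)⁻¹ • p ∈ H := by
    intro n
    induction n with
    | zero =>
      have : path (halfPlanes ρ a) x x = [] := by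
        rw [List.eq_nil_iff_forall_not_mem]
        intro H hH
        have := ((hsys.isPath_path hx x).2 H).mp hH
        exact this.2.1 this.2.2
      exact ⟨x, hx, by rw [this]; rfl, by rw [this]; simp⟩
    | succ n ih =>
      obtain ⟨y, hy, hlen, hmem⟩ := ih
      set p' := (cocycle (halfPlanes ρ a) (transition t) x y)⁻¹ • p with hp'
      have hne : (sep (halfPlanes ρ a) y p').Nonempty := by
        obtain ⟨H, hH, h1, h2⟩ := hcon y hy
        exact ⟨H, hH, h1, h2⟩
      -- A maximal half plane bounds the region of `y`: nothing separates `y` from the near side of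
      -- its boundary.
      obtain ⟨H, ⟨hH, hyH, hpH⟩, hmax⟩ := (hsys.finite_sep y p').exists_maximal hne
      obtain ⟨z, hz, z', hz', h1, h2, h3⟩ := hsys.exists_adj H hH
      have hyz : sep (halfPlanes ρ a) y z = ∅ := by
        rw [Set.eq_empty_iff_forall_notMem]
        rintro K ⟨hK, hyK, hzK⟩
        have hzK' : z' ∈ K := by
          by_contra hzK'
          obtain ⟨K', hK', hc, -⟩ := hsys.compl K hK
          have := h3 K' hK' (by rw [hc z hz]; tauto) (by rwa [hc z' hz'])
          exact hyH (this ▸ (hc y hy).mpr hyK)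
        rcases hsys.nested H hH K hK with h4 | h4 | h4 | h4
        · exact h1 (hmax ⟨hK, hyK, h4 hpH⟩ h4 hzK)
        · exact h1 (h4 hzK)
        · exact Set.disjoint_left.mp h4 h2 hzK'
        · exact absurd (h4 y hy) (by tauto)
      have hzz' : sep (halfPlanes ρ a) z z' = {H} := by
        ext K
        rw [Set.mem_singleton_iff]
        exact ⟨fun hK => h3 K hK.1 hK.2.1 hK.2.2, by rintro rfl; exact ⟨hH, h1, h2⟩⟩
      -- The walk does not turn back: otherwise the complement of `H` would be on the path and
      -- contain p', which lies in `H`.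
      have hxH : x ∉ H := by
        intro hxH
        obtain ⟨H', hH', hc, -, hd⟩ := hsys.compl H hH
        have : H' ∈ path (halfPlanes ρ a) x y := ((hsys.isPath_path hx y).2 H').mpr
          ⟨hH', by rw [hc x hx]; tauto, by rwa [hc y hy]⟩
        exact Set.disjoint_left.mp hd hpH (hmem H' this)
      have hpz : path (halfPlanes ρ a) x z = path (halfPlanes ρ a) x y := by
        have := hsys.isPath_path hx y
        rw [IsPath, hsys.sep_congr_right hy hz hyz x] at this
        exact IsPath.path_eq this
      have happ := hsys.isPath_append hx hz hz' hzz' hxH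
      have hpz' := happ.path_eq
      have hcz' : cocycle (halfPlanes ρ a) (transition t) x z' =
          cocycle (halfPlanes ρ a) (transition t) x y * transition t H := by
        rw [cocycle, hpz', hpz, cocycle]
        simp
      have hp'' : (cocycle (halfPlanes ρ a) (transition t) x z')⁻¹ • p ∈ H := by
        rw [hcz', mul_inv_rev, mul_smul, ← hp']
        obtain ⟨h, hh, rfl⟩ := hH
        rw [transition_rightSide, ← translation_neg, translation_smul_mem_rightSide_iff]
        exact hpH
      refine ⟨z', hz', by rw [hpz', hpz, List.length_append, hlen]; rfl, fun K hK => ?_⟩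
      rw [hpz', List.mem_append, List.mem_singleton] at hK
      rcases hK with hK | rfl
      · exact ((List.pairwise_append.mp happ.1).2.2 K hK H (by simp)).1 hp''
      · exact hp''
  obtain ⟨n, hn⟩ := exists_nat_gt ((dist x p + δ) / δ)
  obtain ⟨y, hy, hlen, hmem⟩ := step n
  have hp := hsys.isPath_path hx y
  obtain ⟨-, h2, -⟩ := dist_le_dist_transitionProd t gap (fun H hH => ((hp.2 H).mp hH).1) hp.1
    (fun H hH => ((hp.2 H).mp hH).2.1) hmem
  rw [← cocycle_eq_transitionProd, smul_inv_smul, hlen, max_eq_left hδ.le, ← le_div_iff₀ hδ] at h2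
  linarith

/-- Pull `p` back to the closure of a region of the old surface and pick a nearby orbit point of `x`
there. Only boundedly many lifts lie in between, so shearing back increases the distance by a
bounded amount. -/
theorem cocompact_twist (hs : HasSimpleLifts ρ a) (t : ℝ) {x : ℍ} (hx : x ∈ offLifts ρ a) :
    CompactSpace (Surface (hs.twist t hx).range) := by
  have hsys := hs.halfSpaceSystem t
  obtain ⟨δ, hδ, gap⟩ := hs.exists_gap
  obtain ⟨D, hD⟩ := exists_dist_le hs.surface.cocompact x
  refine compactSpace_of_exists_dist_le (x₀ := x) (D := D + (D + δ) / δ * |t|) fun p => ?_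
  obtain ⟨y, hy, hyp⟩ := hs.exists_region t hx p
  set c := cocycle (halfPlanes ρ a) (transition t) x y with hc
  obtain ⟨_, ⟨g, rfl⟩, hg⟩ := hD (c⁻¹ • p)
  refine ⟨_, ⟨g, rfl⟩, ?_⟩
  have hp := hsys.isPath_path hy (ρ g • x)
  have hm1 : ∀ H ∈ path (halfPlanes ρ a) y (ρ g • x), H ∈ halfPlanes ρ a :=
    fun H hH => ((hp.2 H).mp hH).1
  have hm2 : ∀ H ∈ path (halfPlanes ρ a) y (ρ g • x), c⁻¹ • p ∉ H :=
    fun H hH => hyp H (hm1 H hH) ((hp.2 H).mp hH).2.1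
  have hm3 : ∀ H ∈ path (halfPlanes ρ a) y (ρ g • x), ρ g • x ∈ H :=
    fun H hH => ((hp.2 H).mp hH).2.2
  have h1 := dist_transitionProd_le t hm1 hp.1 hm2 hm3
  obtain ⟨-, h2, -⟩ := dist_le_dist_transitionProd 0 gap hm1 hp.1 hm2 hm3
  rw [transitionProd_zero, one_smul, max_eq_left hδ.le] at h2
  have h3 : ((path (halfPlanes ρ a) y (ρ g • x)).length : ℝ) ≤ (D + δ) / δ := by
    rw [le_div_iff₀ hδ]; linarith
  have h4 := mul_le_mul_of_nonneg_right h3 (abs_nonneg t)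
  have e : dist p (hs.twist t hx g • x) =
      dist (c⁻¹ • p) (transitionProd t (path (halfPlanes ρ a) y (ρ g • x)) • ρ g • x) := by
    rw [← dist_smul_smul' c (c⁻¹ • p), smul_inv_smul, ← mul_smul, ← mul_smul, twist_apply,
      ← hsys.cocycle_mul hx hy (smul_mem_offLifts hx g), ← hc, mul_assoc, mul_assoc]
    rfl
  rw [e]
  linarith

theorem isClosedSurfaceGroup_twist (hs : HasSimpleLifts ρ a) (t : ℝ) {x : ℍ}
    (hx : x ∈ offLifts ρ a) : IsClosedSurfaceGroup (hs.twist t hx).range where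
  discrete := hs.discrete_twist t hx
  free := by
    rintro _ ⟨g, rfl⟩ z hz
    rw [hs.eq_one_of_twist_smul_eq t hx hz, map_one]
  cocompact := hs.cocompact_twist t hx

theorem twist_mem_teichmuller (hs : HasSimpleLifts ρ a) (hρ : ρ ∈ teichmuller Γ) (t : ℝ) {x : ℍ}
    (hx : x ∈ offLifts ρ a) : hs.twist t hx ∈ teichmuller Γ := by
  have hpre : IsPreconnected (Set.range fun t => (⇑(hs.twist t hx) : Γ → PSL2R)) :=
    isPreconnected_range (hs.continuous_twist hx)
  have hsub : (Set.range fun t => (⇑(hs.twist t hx) : Γ → PSL2R)) ⊆ fuchsianMaps Γ := by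
    rintro _ ⟨u, rfl⟩
    exact mem_fuchsianMaps_iff.mpr ⟨hs.injective_twist u hx, hs.isClosedSurfaceGroup_twist u hx⟩
  have h0 : (⇑ρ : Γ → PSL2R) ∈ Set.range fun t => (⇑(hs.twist t hx) : Γ → PSL2R) :=
    ⟨0, by simp only [hs.twist_zero hx]⟩
  have h1 : connectedComponentIn (fuchsianMaps Γ) (fun g : Γ => (g : PSL2R)) =
      connectedComponentIn (fuchsianMaps Γ) ⇑ρ := connectedComponentIn_eq hρ
  change _ ∈ connectedComponentIn _ _
  rw [h1]
  exact hpre.subset_connectedComponentIn h0 hsub ⟨t, rfl⟩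

end HasSimpleLifts

/-! ### Products of positive matrices -/

variable {b : Γ}

/-- All entries of a matrix are positive. -/
def IsPos (A : SL2R) : Prop := 0 < A 0 0 ∧ 0 < A 0 1 ∧ 0 < A 1 0 ∧ 0 < A 1 1

/-- The diagonal entries of a matrix are comparable to the geometric mean of the other two. -/
def IsBalanced (c C : ℝ) (A : SL2R) : Prop :=
  c * √(A 0 1 * A 1 0) ≤ |A 0 0| ∧ |A 0 0| ≤ C * √(A 0 1 * A 1 0) ∧
  c * √(A 0 1 * A 1 0) ≤ |A 1 1| ∧ |A 1 1| ≤ C * √(A 0 1 * A 1 0)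

theorem isBalanced_neg {c C : ℝ} {A : SL2R} : IsBalanced c C (-A) ↔ IsBalanced c C A := by
  simp [IsBalanced]

/-- `K` maps the nonnegative quadrant into the cone spanned by its own columns, so the ratio of the
entries in each column of `K * P` is confined to an interval depending only on `K`. -/
theorem le_and_le_of_mul_nonneg_right {K P : SL2R} (hK : IsPos K) (h00 : 0 < P 0 0)
    (h01 : 0 ≤ P 0 1) (h10 : 0 ≤ P 1 0) (h11 : 0 < P 1 1) : IsPos (K * P) ∧
    (∀ j, K 0 1 / K 1 1 * (K * P) 1 j ≤ (K * P) 0 j) ∧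
    ∀ j, (K * P) 0 j ≤ K 0 0 / K 1 0 * (K * P) 1 j := by
  obtain ⟨k00, k01, k10, k11⟩ := hK
  have hdet := K.det_eq
  simp only [IsPos, Fin.forall_fin_two, SL2R.mul_00, SL2R.mul_01, SL2R.mul_10, SL2R.mul_11]
  have key1 : ∀ p q : ℝ, 0 ≤ p → K 0 1 / K 1 1 * (K 1 0 * p + K 1 1 * q) ≤ K 0 0 * p + K 0 1 * q := by
    intro p q hp
    rw [div_mul_eq_mul_div, div_le_iff₀ k11]
    nlinarith
  have key2 : ∀ p q : ℝ, 0 ≤ q → K 0 0 * p + K 0 1 * q ≤ K 0 0 / K 1 0 * (K 1 0 * p + K 1 1 * q) := by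
    intro p q hq
    rw [div_mul_eq_mul_div, le_div_iff₀ k10]
    nlinarith
  exact ⟨⟨by positivity, by positivity, by positivity, by positivity⟩,
    ⟨key1 _ _ h00.le, key1 _ _ h01⟩, ⟨key2 _ _ h10, key2 _ _ h11.le⟩⟩

theorem le_and_le_of_mul_nonneg_left {L Q : SL2R} (hL : IsPos L) (h00 : 0 < Q 0 0)
    (h01 : 0 ≤ Q 0 1) (h10 : 0 ≤ Q 1 0) (h11 : 0 < Q 1 1) :
    (∀ i, L 1 0 / L 1 1 * (Q * L) i 1 ≤ (Q * L) i 0) ∧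
    ∀ i, (Q * L) i 0 ≤ L 0 0 / L 0 1 * (Q * L) i 1 := by
  obtain ⟨k00, k01, k10, k11⟩ := hL
  have hdet := L.det_eq
  simp only [Fin.forall_fin_two, SL2R.mul_00, SL2R.mul_01, SL2R.mul_10, SL2R.mul_11]
  have key1 : ∀ p q : ℝ, 0 ≤ p → L 1 0 / L 1 1 * (p * L 0 1 + q * L 1 1) ≤ p * L 0 0 + q * L 1 0 := by
    intro p q hp
    rw [div_mul_eq_mul_div, div_le_iff₀ k11]
    nlinarith
  have key2 : ∀ p q : ℝ, 0 ≤ q → p * L 0 0 + q * L 1 0 ≤ L 0 0 / L 0 1 * (p * L 0 1 + q * L 1 1) := by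
    intro p q hq
    rw [div_mul_eq_mul_div, le_div_iff₀ k01]
    nlinarith
  exact ⟨⟨key1 _ _ h00.le, key1 _ _ h10⟩, ⟨key2 _ _ h01, key2 _ _ h11.le⟩⟩

/-- A diagonal entry x is comparable to one off-diagonal entry through the column bounds and to the
other through the row bounds; multiplying the two compares x² with their product. -/
theorem mul_sqrt_le_and_le {u v u' v' x y z : ℝ} (hu : 0 ≤ u) (hv : 0 ≤ v) (hu' : 0 ≤ u')
    (hv' : 0 ≤ v') (hx : 0 ≤ x) (hy : 0 ≤ y) (hz : 0 ≤ z) (h1 : v * y ≤ x) (h2 : x ≤ u * y)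
    (h3 : v' * z ≤ x) (h4 : x ≤ u' * z) :
    √(v * v') * √(z * y) ≤ x ∧ x ≤ √(u * u') * √(z * y) := by
  rw [← Real.sqrt_mul (by positivity), ← Real.sqrt_mul (by positivity)]
  constructor
  · apply Real.sqrt_le_iff.mpr ⟨hx, ?_⟩
    have := mul_le_mul h1 h3 (by positivity) hx
    linarith
  · apply Real.le_sqrt_of_sq_le
    have := mul_le_mul h2 h4 hx (by positivity)
    linarith

/-- Matrices which have a fixed positive left factor and a fixed positive right factor are
uniformly balanced. -/
theorem exists_isBalanced {K L : SL2R} (hK : IsPos K) (hL : IsPos L) : ∃ c > 0, ∃ C,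
    ∀ P Q : SL2R, 0 < P 0 0 → 0 ≤ P 0 1 → 0 ≤ P 1 0 → 0 < P 1 1 → 0 < Q 0 0 → 0 ≤ Q 0 1 →
      0 ≤ Q 1 0 → 0 < Q 1 1 → K * P = Q * L → IsBalanced c C (K * P) := by
  obtain ⟨k00, k01, k10, k11⟩ := id hK
  obtain ⟨l00, l01, l10, l11⟩ := id hL
  set u := K 0 0 / K 1 0 with hu
  set v := K 0 1 / K 1 1 with hv
  set u' := L 0 0 / L 0 1 with hu'
  set v' := L 1 0 / L 1 1 with hv'
  have pu : 0 < u := by positivity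
  have pv : 0 < v := by positivity
  have pu' : 0 < u' := by positivity
  have pv' : 0 < v' := by positivity
  refine ⟨min √(v * v') √(u⁻¹ * u'⁻¹), by positivity, max √(u * u') √(v⁻¹ * v'⁻¹), ?_⟩
  intro P Q p00 p01 p10 p11 q00 q01 q10 q11 e
  obtain ⟨⟨n00, n01, n10, n11⟩, i1, i2⟩ := le_and_le_of_mul_nonneg_right hK p00 p01 p10 p11
  obtain ⟨j1, j2⟩ := le_and_le_of_mul_nonneg_left hL q00 q01 q10 q11
  rw [← e] at j1 j2
  set N := K * P
  rw [← hu] at i2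
  rw [← hv] at i1
  rw [← hu'] at j2
  rw [← hv'] at j1
  obtain ⟨r1, r2⟩ := mul_sqrt_le_and_le pu.le pv.le pu'.le pv'.le n00.le n10.le n01.le
    (i1 0) (i2 0) (j1 0) (j2 0)
  obtain ⟨r3, r4⟩ := mul_sqrt_le_and_le (u := v'⁻¹) (v := u'⁻¹) (u' := v⁻¹) (v' := u⁻¹)
    (by positivity) (by positivity) (by positivity) (by positivity) n11.le n10.le n01.le
    ((inv_mul_le_iff₀ pu').mpr (j2 1)) ((le_inv_mul_iff₀ pv').mpr (j1 1))
    ((inv_mul_le_iff₀ pu).mpr (i2 1)) ((le_inv_mul_iff₀ pv).mpr (i1 1))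
  rw [mul_comm u'⁻¹] at r3
  rw [mul_comm v'⁻¹] at r4
  rw [IsBalanced, abs_of_pos n00, abs_of_pos n11]
  have hw := Real.sqrt_nonneg (N 0 1 * N 1 0)
  exact ⟨(mul_le_mul_of_nonneg_right (min_le_left _ _) hw).trans r1,
    r2.trans (mul_le_mul_of_nonneg_right (le_max_left _ _) hw),
    (mul_le_mul_of_nonneg_right (min_le_right _ _) hw).trans r3,
    r4.trans (mul_le_mul_of_nonneg_right (le_max_right _ _) hw)⟩

/-! ### The angle along a twist -/

/-- Row scaling leaves the product of the off-diagonal entries unchanged, so the twist parameter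
enters only through the two diagonal entries. -/
theorem cotAngle_diagMatrix_mul (t : ℝ) (N : SL2R) : cotAngle (diagMatrix t * N) =
    (Real.exp (-(t / 2)) * |N 1 1| - Real.exp (t / 2) * |N 0 0|) / (2 * √(N 0 1 * N 1 0)) := by
  rw [cotAngle]
  simp only [SL2R.mul_00, SL2R.mul_01, SL2R.mul_10, SL2R.mul_11, diagMatrix_00, diagMatrix_01,
    diagMatrix_10, diagMatrix_11, zero_mul, zero_add, add_zero, abs_mul, Real.abs_exp]
  congr 3
  rw [mul_mul_mul_comm, ← Real.exp_add, add_neg_cancel, Real.exp_zero, one_mul]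

theorem tendsto_cotAngle_atTop {N : ℝ → SL2R} {c C : ℝ} (hc : 0 < c)
    (hpos : ∀ t, 0 < N t 0 1 * N t 1 0) (hN : ∀ t, IsBalanced c C (N t)) :
    Tendsto (fun t => cotAngle (diagMatrix t * N t)) atTop atBot := by
  have h1 : Tendsto (fun t : ℝ => (C - Real.exp (t / 2) * c) / 2) atTop atBot := by
    have := (Real.tendsto_exp_atTop.comp (tendsto_id.atTop_div_const (r := (2 : ℝ)) two_pos))
    have := (tendsto_atBot_add_const_left _ C
      (tendsto_neg_atTop_atBot.comp (this.atTop_mul_const hc))).atBot_div_const two_pos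
    simpa [sub_eq_add_neg] using this
  refine tendsto_atBot_mono' _ ?_ h1
  filter_upwards [eventually_ge_atTop 0] with t ht
  obtain ⟨b1, b2, b3, b4⟩ := hN t
  rw [cotAngle_diagMatrix_mul]
  have hw := Real.sqrt_pos.mpr (hpos t)
  rw [div_le_div_iff₀ (by positivity) two_pos]
  have e1 : Real.exp (-(t / 2)) ≤ 1 := Real.exp_le_one_iff.mpr (by linarith)
  have e2 := mul_le_mul_of_nonneg_left b1 (Real.exp_pos (t / 2)).le
  have e3 := mul_le_mul e1 b4 (abs_nonneg _) zero_le_one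
  linarith

theorem tendsto_cotAngle_atBot {N : ℝ → SL2R} {c C : ℝ} (hc : 0 < c)
    (hpos : ∀ t, 0 < N t 0 1 * N t 1 0) (hN : ∀ t, IsBalanced c C (N t)) :
    Tendsto (fun t => cotAngle (diagMatrix t * N t)) atBot atTop := by
  have h1 : Tendsto (fun t : ℝ => (Real.exp (-(t / 2)) * c - C) / 2) atBot atTop := by
    have := Real.tendsto_exp_atTop.comp (tendsto_neg_atBot_atTop.comp
      (tendsto_id.atBot_div_const (r := (2 : ℝ)) two_pos))
    have := ((this.atTop_mul_const hc).atTop_add (tendsto_const_nhds (x := -C)))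
      |>.atTop_div_const (r := (2 : ℝ)) two_pos
    simpa [sub_eq_add_neg] using this
  refine tendsto_atTop_mono' _ ?_ h1
  filter_upwards [eventually_le_atBot 0] with t ht
  obtain ⟨b1, b2, b3, b4⟩ := hN t
  rw [cotAngle_diagMatrix_mul]
  have hw := Real.sqrt_pos.mpr (hpos t)
  rw [div_le_div_iff₀ two_pos (by positivity)]
  have e1 : Real.exp (t / 2) ≤ 1 := Real.exp_le_one_iff.mpr (by linarith)
  have e2 := mul_le_mul_of_nonneg_left b3 (Real.exp_pos (-(t / 2))).le
  have e3 := mul_le_mul e1 b2 (abs_nonneg _) zero_le_one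
  linarith

theorem continuous_cotAngle {M : ℝ → SL2R} (hM : Continuous M) (hpos : ∀ t, 0 < M t 0 1 * M t 1 0) :
    Continuous fun t => cotAngle (M t) := by
  have h : ∀ i j, Continuous fun t => M t i j := fun i j =>
    (continuous_subtype_val.comp hM).matrix_elem i j
  simp only [cotAngle]
  refine Continuous.div₀ (by fun_prop) (by fun_prop) fun t => ?_
  have := Real.sqrt_pos.mpr (hpos t)
  positivity

theorem surjective_and_tendsto_angle {κ : ℝ → ℝ} (hc : Continuous κ) (h1 : Tendsto κ atTop atBot)
    (h2 : Tendsto κ atBot atTop) :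
    (∀ θ ∈ Set.Ioo 0 Real.pi, ∃ t : ℝ, Real.pi / 2 - Real.arctan (κ t) = θ) ∧
    Tendsto (fun t => Real.pi / 2 - Real.arctan (κ t)) atTop (𝓝 Real.pi) ∧
    Tendsto (fun t => Real.pi / 2 - Real.arctan (κ t)) atBot (𝓝 0) := by
  refine ⟨fun θ hθ => ?_, ?_, ?_⟩
  · obtain ⟨t, ht⟩ := hc.surjective' h2 h1 (Real.tan (Real.pi / 2 - θ))
    refine ⟨t, ?_⟩
    rw [ht, Real.arctan_tan (by linarith [hθ.2]) (by linarith [hθ.1])]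
    ring
  · have := ((tendsto_nhds_of_tendsto_nhdsWithin Real.tendsto_arctan_atBot).comp h1).const_sub
      (Real.pi / 2)
    simpa using this
  · have := ((tendsto_nhds_of_tendsto_nhdsWithin Real.tendsto_arctan_atTop).comp h2).const_sub
      (Real.pi / 2)
    simpa using this

/-! ### Twisting along a crossed geodesic -/

theorem ratio_mk_smul_imagAxis (A : SL2R) (s : ℝ) :
    ((A : PSL2R) • imagAxis s).re / ((A : PSL2R) • imagAxis s).im =
      A 0 0 * A 1 0 * Real.exp s + A 0 1 * A 1 1 * Real.exp (-s) := by
  have hn := normSq_denom_pos A (imagAxis s)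
  have hs := Real.exp_pos s
  have e : Complex.normSq (imagAxis s) = Real.exp s ^ 2 := by
    rw [imagAxis_coe, map_mul, Complex.normSq_I, Complex.normSq_ofReal]; ring
  rw [re_mk_smul, im_mk_smul, div_div_div_cancel_right₀ hn.ne', imagAxis_re, imagAxis_im, e,
    Real.exp_neg]
  field_simp
  ring

theorem dist_imagAxis_log_im_le (w : ℍ) : dist w (imagAxis (Real.log w.im)) ≤ |w.re / w.im| := by
  have him : (imagAxis (Real.log w.im)).im = w.im := by
    rw [imagAxis_im, Real.exp_log w.im_pos]
  refine (UpperHalfPlane.dist_le_dist_coe_div_sqrt _ _).trans ?_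
  rw [him, Real.sqrt_mul_self w.im_pos.le, abs_div, abs_of_pos w.im_pos]
  have : dist (w : ℂ) (imagAxis (Real.log w.im)) = |w.re| := by
    rw [Complex.dist_of_im_eq (by rw [UpperHalfPlane.coe_im, UpperHalfPlane.coe_im, him]),
      UpperHalfPlane.coe_re, UpperHalfPlane.coe_re, imagAxis_re, Real.dist_0_eq_abs]
  rw [this]

/-- Geodesics at positive distance do not share an end point. -/
theorem exists_isPos_of_rightSide_subset {h k : PSL2R} (H : rightSide h ⊆ rightSide k) {δ : ℝ}
    (hδ : 0 < δ) (gap : ∀ p ∈ line k, ∀ q ∈ line h, δ ≤ dist p q) :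
    ∃ A : SL2R, (A : PSL2R) = k⁻¹ * h ∧ IsPos A := by
  obtain ⟨A, hA, a00, a01, a10, a11⟩ := exists_nonneg_of_rightSide_subset H
  have hd : ∀ s, δ ≤ |A 0 0 * A 1 0 * Real.exp s + A 0 1 * A 1 1 * Real.exp (-s)| := by
    intro s
    rw [← ratio_mk_smul_imagAxis]
    set w := (A : PSL2R) • imagAxis s with hw
    refine le_trans ?_ (dist_imagAxis_log_im_le w)
    have := gap (k • imagAxis (Real.log w.im)) ⟨_, rfl⟩ (h • imagAxis s) ⟨_, rfl⟩
    rw [dist_comm, ← dist_smul_smul' k⁻¹, inv_smul_smul, ← mul_smul, ← hA] at this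
    exact this
  -- A vanishing off-diagonal entry means a common end point; towards that end the ratio re/im,
  -- which bounds the distance between the lines, tends to 0.
  refine ⟨A, hA, a00, lt_of_le_of_ne a01 fun h0 => ?_, lt_of_le_of_ne a10 fun h0 => ?_, a11⟩
  · have ht : Tendsto (fun s => |A 0 0 * A 1 0 * Real.exp s + A 0 1 * A 1 1 * Real.exp (-s)|)
        atBot (𝓝 0) := by
      simpa [← h0] using (Real.tendsto_exp_atBot.const_mul (A 0 0 * A 1 0)).abs
    exact absurd (ge_of_tendsto' ht hd) (not_le.mpr hδ)
  · have ht : Tendsto (fun s => |A 0 0 * A 1 0 * Real.exp s + A 0 1 * A 1 1 * Real.exp (-s)|)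
        atTop (𝓝 0) := by
      simpa [← h0] using ((Real.tendsto_exp_neg_atTop_nhds_zero).const_mul (A 0 1 * A 1 1)).abs
    exact absurd (ge_of_tendsto' ht hd) (not_le.mpr hδ)

theorem rightSide_nonempty (h : PSL2R) : (rightSide h).Nonempty := by
  obtain ⟨-, -, z, hz, -⟩ := exists_near h one_pos
  exact ⟨z, hz⟩

theorem HasSimpleLifts.exists_isPos (hs : HasSimpleLifts ρ a) {h k : PSL2R} (hh : IsLift ρ a h)
    (hk : IsLift ρ a k) (H : rightSide h ⊂ rightSide k) :
    ∃ A : SL2R, (A : PSL2R) = k⁻¹ * h ∧ IsPos A := by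
  obtain ⟨δ, hδ, gap⟩ := hs.exists_gap
  refine exists_isPos_of_rightSide_subset H.1 hδ fun p hp q hq =>
    gap k h hk hh (fun e => ?_) p hp q hq
  obtain ⟨z, hz⟩ := rightSide_nonempty h
  exact H.ne (rightSide_eq_of_line_eq e hz (H.1 hz)).symm

/-- Crossing makes the off-diagonal entries of `g'` have the same sign once the diagonal is
positive; reversing the orientation of the axis of `g` changes that sign. -/
theorem exists_axis_isPos {g g' h : PSL2R} (hg : IsAxis g h) (H : commTrace g g' < 2) :
    ∃ (k : PSL2R) (l : ℝ), l ≠ 0 ∧ g = translation k l ∧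
      ∃ B : SL2R, (B : PSL2R) = k⁻¹ * g' * k ∧ IsPos B := by
  obtain ⟨l, hl, rfl⟩ := hg
  obtain ⟨B, hB⟩ := exists_mk (h⁻¹ * g' * h)
  have hb : g' = h * (B : PSL2R) * h⁻¹ := by rw [hB]; group
  rw [hb, translation_eq, commTrace_conj, commTrace_diagP_lt_iff hl] at H
  have hdet := B.det_eq
  have key : ∀ C : SL2R, (C : PSL2R) = h⁻¹ * g' * h → 0 < C 0 0 → 0 < C 1 1 →
      0 < C 0 1 * C 1 0 → ∃ (k : PSL2R) (m : ℝ), m ≠ 0 ∧ translation h l = translation k m ∧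
      ∃ B : SL2R, (B : PSL2R) = k⁻¹ * g' * k ∧ IsPos B := by
    intro C hC h00 h11 hm
    rcases pos_and_pos_or_neg_and_neg_of_mul_pos hm with ⟨h01, h10⟩ | ⟨h01, h10⟩
    · exact ⟨h, l, hl, rfl, C, hC, h00, h01, h10, h11⟩
    · refine ⟨h * revP, -l, neg_ne_zero.mpr hl, by rw [translation_mul_revP, neg_neg],
        (rotMatrix Real.pi)⁻¹ * C * rotMatrix Real.pi, ?_, ?_⟩
      · rw [mk_mul, mk_mul, mk_inv, hC, revP, rotP]; group
      · simp only [IsPos, SL2R.mul_00, SL2R.mul_01, SL2R.mul_10, SL2R.mul_11, SL2R.inv_00,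
          SL2R.inv_01, SL2R.inv_10, SL2R.inv_11, rotMatrix, mkSL_00, mkSL_01, mkSL_10, mkSL_11,
          Real.cos_pi_div_two, Real.sin_pi_div_two]
        refine ⟨?_, ?_, ?_, ?_⟩ <;> linarith
  have hm : 0 < B 0 0 * B 1 1 := by linarith
  rcases pos_and_pos_or_neg_and_neg_of_mul_pos hm with ⟨h00, h11⟩ | ⟨h00, h11⟩
  · exact key B hB h00 h11 H
  · refine key (-B) (by rw [mk_neg, hB]) ?_ ?_ ?_
    · simpa using h00
    · simpa using h11
    · simpa using H

theorem rightSide_ssubset_of_isPos {g h : PSL2R} {B : SL2R} (hB : (B : PSL2R) = h⁻¹ * g * h)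
    (hp : IsPos B) : rightSide (g * h) ⊂ rightSide h := by
  obtain ⟨b00, b01, b10, b11⟩ := hp
  refine Set.ssubset_iff_subset_ne.mpr ⟨fun z hz => ?_, fun e => ?_⟩
  · rw [mem_rightSide_iff] at hz ⊢
    have e : h⁻¹ • z = (B : PSL2R) • (g * h)⁻¹ • z := by
      rw [← mul_smul, hB]; group
    rw [e, re_mk_smul_pos_iff]
    have := Complex.normSq_nonneg ((g * h)⁻¹ • z : ℍ)
    positivity
  · obtain ⟨s, hs⟩ := eq_of_rightSide_eq e
    have : (B : PSL2R) = (diagMatrix s : PSL2R) := by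
      rw [hB, mul_assoc, hs, inv_mul_cancel_left]; rfl
    rcases mk_eq_mk_iff.mp this with h1 | h1
    · rw [← h1, diagMatrix_01] at b01; exact lt_irrefl _ b01
    · have : diagMatrix s 0 1 = -B 0 1 := by rw [h1]; rfl
      rw [diagMatrix_01] at this; linarith

/-- The translations along the sides of `l` admit continuous lifts to `SL(2, ℝ)`. -/
theorem exists_continuous_lift_transitionProd (l : List (Set ℍ)) :
    ∃ M : ℝ → SL2R, Continuous M ∧ ∀ t, (M t : PSL2R) = transitionProd t l := by
  induction l with
  | nil => exact ⟨fun _ => 1, continuous_const, fun _ => rfl⟩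
  | cons H l ih =>
    obtain ⟨M, hM, hM'⟩ := ih
    have : ∃ M : ℝ → SL2R, Continuous M ∧ ∀ t, (M t : PSL2R) = transition t H := by
      by_cases h : ∃ k, rightSide k = H
      · obtain ⟨k, rfl⟩ := h
        obtain ⟨K, rfl⟩ := exists_mk k
        refine ⟨fun t => K * diagMatrix t * K⁻¹,
          (continuous_const.mul continuous_diagMatrix).mul continuous_const, fun t => ?_⟩
        rw [transition_rightSide]; rfl
      · exact ⟨fun _ => 1, continuous_const, fun t => by rw [transition, dif_neg h]; rfl⟩
    obtain ⟨M', hc, hc'⟩ := this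
    exact ⟨fun t => M' t * M t, hc.mul hM, fun t => by rw [transitionProd_cons, mk_mul, hc', hM']⟩

/-- The points `x` and `x'` lie on adjacent sides of the half plane `H`. -/
def IsAdjacent (ρ : Γ →* PSL2R) (a : Γ) (H : Set ℍ) (x x' : ℍ) : Prop :=
  x ∉ H ∧ x' ∈ H ∧ ∀ K ∈ halfPlanes ρ a, x ∉ K → x' ∈ K → K = H

theorem IsAdjacent.smul {h : PSL2R} {x x' : ℍ} (H : IsAdjacent ρ a (rightSide h) x x') (g : Γ) :
    IsAdjacent ρ a (rightSide (ρ g * h)) (ρ g • x) (ρ g • x') := by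
  refine ⟨fun h' => H.1 (smul_mem_rightSide_iff.mp h'), smul_mem_rightSide_iff.mpr H.2.1, ?_⟩
  rintro _ ⟨k, hk, rfl⟩ h1 h2
  have e : k = ρ g * (ρ g⁻¹ * k) := by rw [← mul_assoc, ← map_mul]; simp
  rw [e, smul_mem_rightSide_iff] at h1 h2
  rw [e, ← image_rightSide, H.2.2 _ ⟨_, hk.smul g⁻¹, rfl⟩ h1 h2, image_rightSide]

/-- Points adjacent along `H` lie on the same side of any other half plane that does not
cover the complement of `H`. -/
theorem HasSimpleLifts.mem_of_isAdjacent (hs : HasSimpleLifts ρ a) {H : Set ℍ} {x x' : ℍ}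
    (hx : x ∈ offLifts ρ a) (hx' : x' ∈ offLifts ρ a) (hadj : IsAdjacent ρ a H x x') {K : Set ℍ}
    (hK : K ∈ halfPlanes ρ a) (hxK : x ∈ K) {y : ℍ} (hy : y ∈ offLifts ρ a) (hyK : y ∉ K)
    (hyH : y ∉ H) : x' ∈ K := by
  by_contra hx'K
  obtain ⟨K', hK', hc, -⟩ := (hs.halfSpaceSystem 0).compl K hK
  have e := hadj.2.2 K' hK' (by rw [hc x hx]; tauto) (by rwa [hc x' hx'])
  exact hyH (e ▸ (hc y hy).mpr hyK)

/-- If the base point is adjacent to the axis of `ρ a`, the twist does not change `ρ a`. -/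
theorem HasSimpleLifts.twist_axis (hs : HasSimpleLifts ρ a) (t : ℝ) {h : PSL2R} {l : ℝ} (hl : l ≠ 0)
    (ha : ρ a = translation h l) {x x' : ℍ} (hx : x ∈ offLifts ρ a) (hx' : x' ∈ offLifts ρ a)
    (hadj : IsAdjacent ρ a (rightSide h) x x') : hs.twist t hx a = ρ a := by
  have hsys := hs.halfSpaceSystem t
  have hH : rightSide h ∈ halfPlanes ρ a := ⟨h, isLift_of_isAxis ⟨l, hl, ha⟩, rfl⟩
  have hadj' := hadj.smul a
  have e : rightSide (ρ a * h) = rightSide h := by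
    rw [ha, translation_eq, inv_mul_cancel_right, rightSide_mul_diagP]
  rw [e] at hadj'
  rw [twist_apply, hsys.cocycle_eq_one hx, one_mul]
  rw [Set.eq_empty_iff_forall_notMem]
  rintro K ⟨hK, hxK, haxK⟩
  have hx'K : x' ∉ K := fun h' => hadj'.1 (hadj.2.2 K hK hxK h' ▸ haxK)
  have hax'K := hs.mem_of_isAdjacent (smul_mem_offLifts hx a) (smul_mem_offLifts hx' a) hadj'
    hK haxK hx hxK hadj.1
  rcases hsys.nested _ hH K hK with h1 | h1 | h1 | h1
  · exact hx'K (h1 hadj.2.1)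
  · exact hadj'.1 (h1 haxK)
  · exact Set.disjoint_left.mp h1 hadj'.2.1 hax'K
  · exact (h1 x hx).elim hadj.1 hxK

/-- If `ρ b` maps the half plane `rightSide h` strictly into itself, the path from `x` to
`ρ b • x` starts with this half plane and stays outside of its image. -/
theorem HasSimpleLifts.exists_path_eq_cons (hs : HasSimpleLifts ρ a) {h : PSL2R}
    (hh : IsLift ρ a h) {x x' : ℍ} (hx : x ∈ offLifts ρ a) (hx' : x' ∈ offLifts ρ a)
    (hadj : IsAdjacent ρ a (rightSide h) x x') (hb : rightSide (ρ b * h) ⊂ rightSide h) :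
    ∃ l, path (halfPlanes ρ a) x (ρ b • x) = rightSide h :: l ∧
      ∀ K ∈ rightSide h :: l, rightSide (ρ b * h) ⊂ K := by
  have hsys := hs.halfSpaceSystem 0
  have hH : rightSide h ∈ halfPlanes ρ a := ⟨h, hh, rfl⟩
  have hbH : rightSide (ρ b * h) ∈ halfPlanes ρ a := ⟨_, hh.smul b, rfl⟩
  have hadj' := hadj.smul b
  have hbx : ρ b • x ∈ rightSide h := by
    by_contra hcon
    exact hb.ne (hadj'.2.2 _ hH hcon (hb.1 hadj'.2.1)).symm
  have hp := hsys.isPath_path hx (ρ b • x)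
  have hle : ∀ K ∈ path (halfPlanes ρ a) x (ρ b • x), K ⊆ rightSide h := by
    intro K hKp
    obtain ⟨hK, hxK, hbxK⟩ := (hp.2 K).mp hKp
    rcases hsys.nested _ hH K hK with h1 | h1 | h1 | h1
    · exact (hadj.2.2 K hK hxK (h1 hadj.2.1)).subset
    · exact h1
    · exact absurd hbxK (Set.disjoint_left.mp h1 hbx)
    · exact absurd (h1 x hx) (not_or.mpr ⟨hadj.1, hxK⟩)
  have hlt : ∀ K ∈ path (halfPlanes ρ a) x (ρ b • x), rightSide (ρ b * h) ⊂ K := by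
    intro K hKp
    obtain ⟨hK, hxK, hbxK⟩ := (hp.2 K).mp hKp
    have hxb : x ∉ rightSide (ρ b * h) := fun h' => hadj.1 (hb.1 h')
    have hbx'K := hs.mem_of_isAdjacent (smul_mem_offLifts hx b) (smul_mem_offLifts hx' b) hadj'
      hK hbxK hx hxK hxb
    refine Set.ssubset_iff_subset_ne.mpr ⟨?_, fun e => hadj'.1 (e ▸ hbxK)⟩
    rcases hsys.nested _ hbH K hK with h1 | h1 | h1 | h1
    · exact h1
    · exact absurd (h1 hbxK) hadj'.1
    · exact absurd hbx'K (Set.disjoint_left.mp h1 hadj'.2.1)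
    · exact absurd (h1 x hx) (not_or.mpr ⟨hxb, hxK⟩)
  have hmem : rightSide h ∈ path (halfPlanes ρ a) x (ρ b • x) :=
    (hp.2 _).mpr ⟨hH, hadj.1, hbx⟩
  match hpath : path (halfPlanes ρ a) x (ρ b • x) with
  | [] => rw [hpath] at hmem; simp at hmem
  | K :: l =>
    rw [hpath] at hmem hle hlt
    have hpw := hp.1
    rw [hpath, List.pairwise_cons] at hpw
    have e : rightSide h = K := by
      rcases List.mem_cons.mp hmem with h1 | h1
      · exact h1
      · exact absurd (hle K (by simp)) (hpw.1 _ h1).2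
    exact ⟨l, by rw [e], by rw [e]; exact hlt⟩

/-- In the coordinate in which the axis of `ρ a` is the imaginary axis, the matrices of the twists
of `ρ b` differ from diagonal ones by uniformly balanced matrices. -/
theorem HasSimpleLifts.exists_isBalanced (hs : HasSimpleLifts ρ a) {h : PSL2R}
    (hh : IsLift ρ a h) (hb : rightSide (ρ b * h) ⊂ rightSide h) {l : List (Set ℍ)}
    (hl : ∀ K ∈ rightSide h :: l, K ∈ halfPlanes ρ a)
    (hpw : (rightSide h :: l).Pairwise fun H K => K ⊂ H)
    (hlt : ∀ K ∈ rightSide h :: l, rightSide (ρ b * h) ⊂ K) :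
    ∃ c > 0, ∃ C, ∀ t, ∃ N : SL2R,
      (N : PSL2R) = h⁻¹ * (transitionProd t l * ρ b) * h ∧ IsPos N ∧ IsBalanced c C N := by
  have hpw' := List.pairwise_cons.mp hpw
  have hl' : ∀ K ∈ l, K ∈ halfPlanes ρ a := fun K hK => hl K (by simp [hK])
  have hlt' : ∀ K ∈ l, rightSide (ρ b * h) ⊂ K := fun K hK => hlt K (by simp [hK])
  -- `k` bounds the second half plane of the path, or the image under `ρ b` of the first if there is
  -- no second. It gives the fixed left factor K = h⁻¹k.
  obtain ⟨k, hk, hkh, hkt⟩ : ∃ k, IsLift ρ a k ∧ rightSide k ⊂ rightSide h ∧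
      ∀ t, rightSide (transitionProd t l * ρ b * h) ⊆ rightSide k := by
    match l with
    | [] => exact ⟨ρ b * h, hh.smul b, hb, fun t => by simp [transitionProd]⟩
    | K :: r =>
      obtain ⟨k, hk, rfl⟩ := hl' K (by simp)
      refine ⟨k, hk, hpw'.1 _ (by simp), fun t => ?_⟩
      rw [mul_assoc, ← image_rightSide]
      rintro _ ⟨y, hy, rfl⟩
      refine transitionProd_smul_mem t hl' hpw'.2 (fun H hH => (hlt' H hH).1 hy) ?_
        ((hlt' _ (by simp)).1 hy)
      intro H hH
      rcases List.mem_cons.mp hH with rfl | hH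
      · exact subset_rfl
      · exact ((List.pairwise_cons.mp hpw'.2).1 H hH).1
  -- `m` bounds the last half plane of the path, possibly `rightSide h` itself. It gives the fixed
  -- right factor L = m⁻¹ ρ(b) h.
  obtain ⟨m, hm, hbm, hmt⟩ : ∃ m, IsLift ρ a m ∧ rightSide (ρ b * h) ⊂ rightSide m ∧
      ∀ t, rightSide (transitionProd t l * m) ⊆ rightSide h := by
    obtain ⟨m, hm, hme⟩ := hl _ (List.getLast_mem (List.cons_ne_nil (rightSide h) l))
    have hle : ∀ K ∈ rightSide h :: l, rightSide m ⊆ K := by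
      intro K hK
      rw [← hme]
      rw [← List.dropLast_append_getLast (List.cons_ne_nil (rightSide h) l)] at hpw hK
      rcases List.mem_append.mp hK with h1 | h1
      · exact ((List.pairwise_append.mp hpw).2.2 K h1 _ (by simp)).1
      · rw [List.mem_singleton.mp h1]
    refine ⟨m, hm, hme ▸ hlt _ (List.getLast_mem _), fun t => ?_⟩
    rw [← image_rightSide]
    rintro _ ⟨y, hy, rfl⟩
    exact transitionProd_smul_mem t hl' hpw'.2 (fun H hH => hle H (by simp [hH]) hy)
      (fun H hH => (hpw'.1 H hH).1) (hle _ (by simp) hy)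
  obtain ⟨K, hK, hKp⟩ := hs.exists_isPos hk hh hkh
  obtain ⟨L, hL, hLp⟩ := hs.exists_isPos (hh.smul b) hm hbm
  obtain ⟨c, hc, C, hC⟩ := FenchelNielsen.exists_isBalanced hKp hLp
  refine ⟨c, hc, C, fun t => ?_⟩
  obtain ⟨P, hP, p00, p01, p10, p11⟩ := exists_nonneg_of_rightSide_subset (hkt t)
  obtain ⟨Q, hQ, q00, q01, q10, q11⟩ := exists_nonneg_of_rightSide_subset (hmt t)
  have hKP : ((K * P : SL2R) : PSL2R) = h⁻¹ * (transitionProd t l * ρ b) * h := by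
    rw [mk_mul, hK, hP]; group
  have hQL : ((Q * L : SL2R) : PSL2R) = h⁻¹ * (transitionProd t l * ρ b) * h := by
    rw [mk_mul, hQ, hL]; group
  have hpos := (le_and_le_of_mul_nonneg_right hKp p00 p01 p10 p11).1
  obtain ⟨l00, l01, l10, l11⟩ := id hLp
  refine ⟨K * P, hKP, hpos, hC P Q p00 p01 p10 p11 q00 q01 q10 q11 ?_⟩
  -- The two factorisations agree a priori only up to sign; both have a positive upper left entry.
  rcases mk_eq_mk_iff.mp (hKP.trans hQL.symm) with e | e
  · exact e.symm
  · have h1 : (Q * L) 0 0 = -(K * P) 0 0 := by rw [e]; rfl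
    have h2 : 0 < (Q * L) 0 0 := by rw [SL2R.mul_00]; positivity
    linarith [hpos.1]

/-- The angle between `a` and `b` along the twists of `ρ` along `a`. -/
theorem HasSimpleLifts.exists_angle (hs : HasSimpleLifts ρ a) (hab : commTrace (ρ a) (ρ b) < 2) :
    ∃ x, ∃ hx : x ∈ offLifts ρ a, ∃ κ : ℝ → ℝ, Continuous κ ∧ Tendsto κ atTop atBot ∧
      Tendsto κ atBot atTop ∧ ∀ t θ, HasAngle (hs.twist t hx a) (hs.twist t hx b) θ ↔
        θ = Real.pi / 2 - Real.arctan (κ t) := by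
  obtain ⟨h', hh'⟩ := hs.exists_isAxis
  obtain ⟨h, l, hl, hah, B, hB, hBp⟩ := exists_axis_isPos hh' hab
  have hh : IsLift ρ a h := isLift_of_isAxis ⟨l, hl, hah⟩
  have hb := rightSide_ssubset_of_isPos hB hBp
  obtain ⟨x, hx, x', hx', h1, h2, h3⟩ := (hs.halfSpaceSystem 0).exists_adj _ ⟨h, hh, rfl⟩
  have hadj : IsAdjacent ρ a (rightSide h) x x' := ⟨h1, h2, h3⟩
  obtain ⟨r, hr, hlt⟩ := hs.exists_path_eq_cons hh hx hx' hadj hb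
  have hp := (hs.halfSpaceSystem 0).isPath_path hx (ρ b • x)
  rw [hr] at hp
  obtain ⟨c, hc, C, hN⟩ := hs.exists_isBalanced hh hb (fun K hK => ((hp.2 K).mp hK).1) hp.1 hlt
  obtain ⟨M, hM, hMr⟩ := exists_continuous_lift_transitionProd r
  obtain ⟨A, rfl⟩ := exists_mk h
  obtain ⟨D, hD⟩ := exists_mk (ρ b)
  -- A lift continuous in `t`, which agrees with the positive one only up to sign. The cotangent and
  -- the balance conditions do not see this sign.
  set N : ℝ → SL2R := fun t => A⁻¹ * (M t * D) * A with hNdef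
  have hNmk : ∀ t, (N t : PSL2R) = (A : PSL2R)⁻¹ * (transitionProd t r * ρ b) * A := by
    intro t
    rw [hNdef, mk_mul, mk_mul, mk_mul, mk_inv, hMr, hD]
  have hNc : Continuous N := by fun_prop
  have hNpos : ∀ t, 0 < N t 0 1 * N t 1 0 ∧ IsBalanced c C (N t) := by
    intro t
    obtain ⟨N', h1, ⟨-, p01, p10, -⟩, hbal⟩ := hN t
    rcases mk_eq_mk_iff.mp (h1.trans (hNmk t).symm) with e | e
    · rw [e]; exact ⟨mul_pos p01 p10, hbal⟩
    · rw [e]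
      refine ⟨?_, isBalanced_neg.mpr hbal⟩
      have : (-N') 0 1 * (-N') 1 0 = N' 0 1 * N' 1 0 := neg_mul_neg _ _
      rw [this]; exact mul_pos p01 p10
  have hMpos : ∀ t, 0 < (diagMatrix t * N t) 0 1 * (diagMatrix t * N t) 1 0 := by
    intro t
    simp only [SL2R.mul_01, SL2R.mul_10, diagMatrix_00, diagMatrix_01, diagMatrix_10,
      diagMatrix_11, zero_mul, zero_add, add_zero]
    rw [mul_mul_mul_comm]
    have := (hNpos t).1
    positivity
  refine ⟨x, hx, fun t => cotAngle (diagMatrix t * N t),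
    continuous_cotAngle (continuous_diagMatrix.mul hNc) hMpos,
    tendsto_cotAngle_atTop hc (fun t => (hNpos t).1) fun t => (hNpos t).2,
    tendsto_cotAngle_atBot hc (fun t => (hNpos t).1) fun t => (hNpos t).2, fun t θ => ?_⟩
  have ea : hs.twist t hx a = A * diagP l * (A : PSL2R)⁻¹ := by
    rw [hs.twist_axis t hl hah hx hx' hadj, hah, translation_eq]
  obtain ⟨N', h1, ⟨p00, p01, p10, p11⟩, -⟩ := hN t
  -- The first lift on the path is the axis of `ρ a` itself, so its shear is diagonal in this frame.
  have eb : hs.twist t hx b = A * ((diagMatrix t * N' : SL2R) : PSL2R) * (A : PSL2R)⁻¹ := by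
    rw [twist_apply, cocycle_eq_transitionProd, hr, transitionProd_cons, transition_rightSide,
      translation_eq, mk_mul, h1, diagP]
    group
  have ek : cotAngle (diagMatrix t * N t) = cotAngle (diagMatrix t * N') := by
    rcases mk_eq_mk_iff.mp (h1.trans (hNmk t).symm) with e | e
    · rw [e]
    · rw [e, mul_neg, cotAngle_neg]
  rw [ea, eb, hasAngle_conj_iff]
  beta_reduce
  rw [ek]
  apply hasAngle_diagP_iff hl <;>
    simp only [SL2R.mul_00, SL2R.mul_01, SL2R.mul_10, SL2R.mul_11, diagMatrix_00, diagMatrix_01,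
      diagMatrix_10, diagMatrix_11, zero_mul, zero_add, add_zero] <;> positivity

end FenchelNielsen

end

/-! ### The main theorem -/

theorem mainTheorem6 (Γ : Subgroup FenchelNielsen.PSL2R)
    (hΓ : FenchelNielsen.IsClosedSurfaceGroup Γ)
    (a b : Γ)
    (ha : FenchelNielsen.IsSimpleClosedGeodesic Γ a)
    (z : UpperHalfPlane)
    (hza : z ∈ FenchelNielsen.axis (a : FenchelNielsen.PSL2R))
    (hzb : z ∈ FenchelNielsen.axis (b : FenchelNielsen.PSL2R))
    (hab : FenchelNielsen.closedGeodesic Γ a ≠ FenchelNielsen.closedGeodesic Γ b)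
    (ρ₀ : Γ →* FenchelNielsen.PSL2R)
    (hρ₀ : ρ₀ ∈ FenchelNielsen.teichmuller Γ) :
    (∀ t : ℝ, ∃ ρ ∈ FenchelNielsen.teichmuller Γ, FenchelNielsen.IsLeftTwist ρ₀ a t ρ) ∧
    ∀ ρ : ℝ → (Γ →* FenchelNielsen.PSL2R),
      (∀ t : ℝ, FenchelNielsen.IsLeftTwist ρ₀ a t (ρ t)) →
      ∃ ϑ : ℝ → ℝ,
        (∀ t θ : ℝ, FenchelNielsen.HasAngle (ρ t a) (ρ t b) θ ↔ θ = ϑ t) ∧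
        (∀ θ ∈ Set.Ioo 0 Real.pi, ∃ t : ℝ, ϑ t = θ) ∧
        (∃ L ∈ ({0, Real.pi} : Set ℝ), Tendsto ϑ atTop (𝓝 L)) ∧
        (∃ L ∈ ({0, Real.pi} : Set ℝ), Tendsto ϑ atBot (𝓝 L)) := by
  have hs := FenchelNielsen.HasSimpleLifts.of_mem_teichmuller hΓ ha hρ₀
  obtain ⟨x, hx, κ, hκ, htop, hbot, hangle⟩ := hs.exists_angle
    (FenchelNielsen.commTrace_lt_two_of_mem_axis hΓ hza hzb hab hρ₀)
  obtain ⟨hsurj, hlim, hlim'⟩ := FenchelNielsen.surjective_and_tendsto_angle hκ htop hbot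
  refine ⟨fun t => ⟨hs.twist t hx, hs.twist_mem_teichmuller hρ₀ t hx, hs.isLeftTwist_twist t hx⟩,
    fun ρ hρ => ⟨_, fun t θ => ?_, hsurj, ⟨_, by simp, hlim⟩, ⟨_, by simp, hlim'⟩⟩⟩
  -- The conjugating element may depend arbitrarily on `t`; angles are invariant under conjugation.
  obtain ⟨e, he⟩ := hs.eq_conj_twist (hρ t) hx
  rw [he, he, FenchelNielsen.hasAngle_conj_iff]
  exact hangle t θ
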